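/- **Bäcklund transformation for the $\hat B_n^{(1)}$-hierarchy.** *Setting.* Let $n\ge 1$, $j\ge 1$. All matrices are real of size $2n+1$, and $e_{ik}$ are the matrix units. Put $\rho_n=\sum_{i=1}^{2n+1}(-1)^{n+i-1}e_{i,2n+2-i}$, $A^\sharp=\rho_nA^t\rho_n$, $\beta=\frac12(e_{1,2n}+e_{2,2n+1})$, $b=\sum_{i=1}^{2n}e_{i+1,i}$, $o(n+1,n)=\{A: A^t\rho_n+\rho_nA=0\}$, let $\mathcal B_n^+$ be the set of upper triangular matrices in $o(n+1,n)$, and $$\Pi=\{\pi : \pi^2=\pi,\ \operatorname{rank}\pi=1,\ \pi\pi^\sharp=\pi^\sharp\pi=0\}.$$ For an open set $U\subset\mathbb R^2$ and a smooth map $q:U\to\mathcal B_n^+$, $(x,t)\mapsto q(x,t)$, let $T(q,\lambda)=\beta\lambda+\sum_{i\le 0}T_{1,i}(q)\lambda^i$ be the unique formal series with smooth matrix-valued coefficients on $U$ such that $$[\partial_x+\beta\lambda+b+q,\ T(q,\lambda)]=0,\qquad T(q,\lambda)^{2n+1}=\lambda\,T(q,\lambda),$$ and write $T(q,\lambda)^{2j-1}=\sum_{i\le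 2j-1}T_{2j-1,i}(q)\lambda^i$. The map $q$ is a solution on $U$ of the $(2j-1)$-th $\hat B_n^{(1)}$-flow if $$q_t=[\partial_x+b+q,\ T_{2j-1,0}(q)]\quad\text{on } U.$$ For real $\alpha$ put $A(q,\alpha)=\alpha\beta+b+q$ and $B(q,\alpha)=\sum_{i=0}^{2j-1}\alpha^i\,T_{2j-1,i}(q)$. *Theorem.* Let $\alpha_1\neq\alpha_2$ be real numbers and let $q$ be a solution of the $(2j-1)$-th $\hat B_n^{(1)}$-flow on an open set $U\subset\mathbb R^2$ (for instance $U=\mathbb R^2$). For an open set $V\subset U$ and a smooth map $\tilde\pi:V\to\Pi$ put $\tilde q=q+(\alpha_1-\alpha_2)[\beta,\tilde\pi-\tilde\pi^\sharp]$ and consider the system $$(BT)_{q,\alpha_1,\alpha_2}\qquad \begin{cases}\tilde\pi_x=\tilde\pi A(q,\alpha_2)-A(\tilde q,\alpha_2)\tilde\pi,\\ \tilde\pi_t=\tilde\pi B(q,\alpha_2)-B(\tilde q,\alpha_2)\tilde\pi.\end{cases}$$ 1. $(BT)_{q,\alpha_1,\alpha_2}$ is a first order system for $\tilde\pi$: there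 are real polynomials $P_{ac}$ $(1\le a,c\le 2n+1)$, depending only on $n,j,\alpha_1,\alpha_2$, such that for every smooth $\tilde\pi:V\to\Pi$ that satisfies the first equation on an open set $V\subset U$, the $(a,c)$ entry of $B(\tilde q,\alpha_2)$ is, at every point of $V$, the value of $P_{ac}$ at the entries of $\tilde\pi$ and of $T_{2j-1,i}(q)$, $0\le i\le 2j-1$, at that point. Thus no derivatives of $\tilde\pi$ enter the right-hand side. The system is (locally) solvable for any initial value: for every $p_0\in U$ and every $\pi_0\in\Pi$ there are an open set $V$ with $p_0\in V\subset U$ and a smooth solution $\tilde\pi:V\to\Pi$ of $(BT)_{q,\alpha_1,\alpha_2}$ on $V$ with $\tilde\pi(p_0)=\pi_0$. 2. If $\tilde\pi:V\to\Pi$ is a smooth solution of $(BT)_{q,\alpha_1,\alpha_2}$ on an open set $V\subset U$, then $\tilde q=q+(\alpha_1-\alpha_2)[\beta,\tilde\pi-\tilde\pi^\sharp]$ is a solution on $V$ of the same $(2j-1)$-th $\hat B_n^{(1)}$-flow. -/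

import Mathlib

open scoped ContDiff

namespace BHierarchy

noncomputable section

/-- Real square matrices of size `2n+1`; the row and column indices run from `0` to `2n`. -/
abbrev Mat (n : ℕ) : Type := Matrix (Fin (2 * n + 1)) (Fin (2 * n + 1)) ℝ

/-- Formal series `∑_{i ≤ m} ξ_i λ^i` with matrix coefficients. They are stored as Laurent series
in the variable `λ⁻¹`, with the Cauchy product. -/
abbrev Loop (n : ℕ) : Type := LaurentSeries (Mat n)

/-- The monomial `A λ^i`. -/
def monomial {n : ℕ} (i : ℤ) (A : Mat n) : Loop n := HahnSeries.single (-i) A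

/-- The coefficient of `λ^i`. -/
def lcoeff {n : ℕ} (i : ℤ) (ξ : Loop n) : Mat n := HahnSeries.coeff ξ (-i)

/-- The matrix `ρ_n = ∑_{i=1}^{2n+1} (-1)^{n+i-1} e_{i,2n+2-i}`. -/
def rho (n : ℕ) : Mat n :=
  Matrix.of fun i k => if (i : ℕ) + (k : ℕ) = 2 * n then (-1 : ℝ) ^ (n + (i : ℕ)) else 0

/-- The adjoint with respect to the bilinear form `⟨X, Y⟩ = Xᵗ ρ_n Y`. -/
def sharp {n : ℕ} (A : Mat n) : Mat n := rho n * A.transpose * rho n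

/-- `β = (e_{1,2n} + e_{2,2n+1}) / 2`. -/
def beta (n : ℕ) : Mat n :=
  Matrix.of fun i k =>
    if ((i : ℕ) = 0 ∧ (k : ℕ) + 1 = 2 * n) ∨ ((i : ℕ) = 1 ∧ (k : ℕ) = 2 * n) then 1 / 2 else 0

/-- `b = ∑_{i=1}^{2n} e_{i+1,i}`. -/
def bmat (n : ℕ) : Mat n :=
  Matrix.of fun i k => if (i : ℕ) = (k : ℕ) + 1 then 1 else 0

/-- The Lie algebra of upper triangular matrices in `o(n+1,n)`. -/
def borel (n : ℕ) : Set (Mat n) :=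
  {A | A.transpose * rho n + rho n * A = 0 ∧ ∀ i k, k < i → A i k = 0}

/-- The set `Π` of rank one projections `π` with `π π♯ = π♯ π = 0`. -/
def isoProj (n : ℕ) : Set (Mat n) :=
  {π | π * π = π ∧ π.rank = 1 ∧ π * sharp π = 0 ∧ sharp π * π = 0}

/-- Smoothness of a matrix valued function of `(x,t)` on a set, entry by entry. -/
def SmoothOn {n : ℕ} (U : Set (ℝ × ℝ)) (f : ℝ × ℝ → Mat n) : Prop :=
  ∀ i k, ContDiffOn ℝ ∞ (fun p => f p i k) U

/-- The partial derivative in `x` of a function of `(x,t)`. -/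
def dx {n : ℕ} (f : ℝ × ℝ → Mat n) (p : ℝ × ℝ) : Mat n :=
  Matrix.of fun i k => deriv (fun s => f (s, p.2) i k) p.1

/-- The partial derivative in `t` of a function of `(x,t)`. -/
def dt {n : ℕ} (f : ℝ × ℝ → Mat n) (p : ℝ × ℝ) : Mat n :=
  Matrix.of fun i k => deriv (fun s => f (p.1, s) i k) p.2

/-- `J_B(λ) + Q = β λ + b + Q`. -/
def laxLoop {n : ℕ} (Q : Mat n) : Loop n := monomial 1 (beta n) + monomial 0 (bmat n + Q)

/-- `T = β λ + ∑_{i ≤ 0} T_i λ^i` has smooth coefficients on `U` and solves there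
`[∂_x + β λ + b + q, T] = 0` and `T^{2n+1} = λ T`. -/
structure IsResolventOn {n : ℕ} (U : Set (ℝ × ℝ)) (q : ℝ × ℝ → Mat n)
    (T : ℝ × ℝ → Loop n) : Prop where
  smooth : ∀ i : ℤ, SmoothOn U (fun p => lcoeff i (T p))
  coeff_of_gt : ∀ p ∈ U, ∀ i : ℤ, 1 < i → lcoeff i (T p) = 0
  coeff_one : ∀ p ∈ U, lcoeff 1 (T p) = beta n
  commute : ∀ p ∈ U, ∀ i : ℤ,
    dx (fun p' => lcoeff i (T p')) p + lcoeff i ⁅laxLoop (q p), T p⁆ = 0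
  pow_eq : ∀ p ∈ U, T p ^ (2 * n + 1) = monomial 1 1 * T p

/-- The series `T(q,λ)`: the unique solution in the sense of `IsResolventOn` (only its values
on `U` are meaningful). -/
def resolvent {n : ℕ} (U : Set (ℝ × ℝ)) (q : ℝ × ℝ → Mat n) : ℝ × ℝ → Loop n :=
  Classical.epsilon (IsResolventOn U q)

/-- `T_{2j-1,i}(q)`, the coefficient of `λ^i` in `T(q,λ)^{2j-1}`. -/
def resCoeff {n : ℕ} (U : Set (ℝ × ℝ)) (j : ℕ) (q : ℝ × ℝ → Mat n) (i : ℤ) (p : ℝ × ℝ) : Mat n :=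
  lcoeff i (resolvent U q p ^ (2 * j - 1))

/-- `q` is a smooth solution on `U`, with values in the upper triangular matrices of `o(n+1,n)`,
of the `(2j-1)`-th flow `q_t = [∂_x + b + q, T_{2j-1,0}(q)]`. -/
structure IsFlowSolutionOn {n : ℕ} (U : Set (ℝ × ℝ)) (j : ℕ) (q : ℝ × ℝ → Mat n) : Prop where
  smooth : SmoothOn U q
  mem_borel : ∀ p ∈ U, q p ∈ borel n
  flow : ∀ p ∈ U, dt q p = dx (resCoeff U j q 0) p + ⁅bmat n + q p, resCoeff U j q 0 p⁆

/-- `A(q,α) = J_B(α) + q = α β + b + q`. -/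
def laxA {n : ℕ} (q : ℝ × ℝ → Mat n) (α : ℝ) (p : ℝ × ℝ) : Mat n := α • beta n + bmat n + q p

/-- `B(q,α)`, the value at `λ = α` of the polynomial part `(T(q,λ)^{2j-1})_+`. Since `T(q,λ)` has
degree `1` in `λ`, the coefficients of `λ^i` in its power vanish for `i > 2j-1`. -/
def laxB {n : ℕ} (U : Set (ℝ × ℝ)) (j : ℕ) (q : ℝ × ℝ → Mat n) (α : ℝ) (p : ℝ × ℝ) : Mat n :=
  ∑ i ∈ Finset.range (2 * j), α ^ i • resCoeff U j q (i : ℤ) p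

/-- `q̃ = q + (α₁ - α₂) [β, π̃ - π̃♯]`. -/
def newSol {n : ℕ} (q : ℝ × ℝ → Mat n) (α₁ α₂ : ℝ) (π : ℝ × ℝ → Mat n) (p : ℝ × ℝ) : Mat n :=
  q p + (α₁ - α₂) • ⁅beta n, π p - sharp (π p)⁆

/-- `π̃` is a smooth map from `V` to `Π` that satisfies the first equation
`π̃_x = π̃ A(q,α₂) - A(q̃,α₂) π̃` of the system `(BT)`. -/
structure IsBTxSolutionOn {n : ℕ} (V : Set (ℝ × ℝ)) (q : ℝ × ℝ → Mat n) (α₁ α₂ : ℝ)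
    (π : ℝ × ℝ → Mat n) : Prop where
  smooth : SmoothOn V π
  mem_isoProj : ∀ p ∈ V, π p ∈ isoProj n
  eq_x : ∀ p ∈ V, dx π p = π p * laxA q α₂ p - laxA (newSol q α₁ α₂ π) α₂ p * π p

/-- `π̃ : V → Π` is a smooth solution on `V` of the system `(BT)` for a solution `q` on `U`:
it satisfies the first equation and also
`π̃_t = π̃ B(q,α₂) - B(q̃,α₂) π̃`. -/
structure IsBTSolutionOn {n : ℕ} (U V : Set (ℝ × ℝ)) (j : ℕ) (q : ℝ × ℝ → Mat n) (α₁ α₂ : ℝ)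
    (π : ℝ × ℝ → Mat n) : Prop extends IsBTxSolutionOn V q α₁ α₂ π where
  eq_t : ∀ p ∈ V, dt π p = π p * laxB U j q α₂ p - laxB V j (newSol q α₁ α₂ π) α₂ p * π p

end

end BHierarchy

open BHierarchy

/-!
The series `T(q, λ)` is controlled by an abstract statement about a ring with a complete filtration
and a derivation `δ`. If `J` is homogeneous of degree one with `J ^ (N + 1) = z J`, `z` central and
invertible, then the ring is the sum of the centralizer of `J` and the image of `ad J`, so that
`δ + J + q` can be conjugated, order by order, to `δ + J + f` with `f` commuting with `J`. The
conjugates of `J` converge to an element `T` that commutes with `δ + J + q` and satisfies the same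
polynomial equation (`FilteredDiffRing.IsCyclic.exists_resolvent`), and `T` is unique
(`FilteredDiffRing.IsCyclic.IsResolvent.unique`). This is applied to smooth families of series in
`λ` with the principal filtration, to `J = β λ + b`, `N = 2n` and `z = λ`. Uniqueness also makes `T`
skew for the adjoint `♯`.

For a map `π` into `Π` put `c = α₁ - α₂` and
`F = 1 - c π / (λ - α₂) + c π♯ / (λ - α₁)`. Its inverse is obtained by exchanging `π` and `π♯`. For
skew `W` one has `π W π♯ = π♯ W π = 0`, since `π` has rank one; hence in `F W F⁻¹` the products of
two poles reduce to divided differences, and the equation `π_x = π A(q, α₂) - A(q̃, α₂) π` is a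
Riccati equation for `π` with coefficients in `q`. Therefore `F` intertwines the operators
`∂_x + β λ + b + q` and `∂_x + β λ + b + q̃` (`loopDeriv_gauge`). By uniqueness
`T(q̃, λ) = F T(q, λ) F⁻¹` (`isResolventOn_gauge`), and the polynomial part of the power of this
series expresses `B(q̃, λ)` by `π`, `B(q, λ)` and the divided differences of `B(q, ·)`
(`laxB_newSol`). This gives the polynomials of the first claim (`exists_polynomial`), and it shows
that the equation in `t` is a Riccati equation too.

The curvature of the connection `(A(q, λ), B(q, λ))`, apart from `q_t`, does not depend on `λ`
(`dirDeriv_laxB`), so the flow equation is the flatness of this connection at any one value of `λ`.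
A solution of both Riccati equations makes `F` a gauge transformation between the connections of `q`
and `q̃`, and flatness is preserved; hence `q̃` solves the flow (`isFlowSolutionOn_newSol`).

For solvability the Riccati system is linearized. If `v` is a parallel section of the connection of
`q` at `λ = α₁` and `w` is one of the dual connection at `λ = α₂`, then `π = v wᵗ / (w ⬝ v)` solves
the system. The connections take values in the orthogonal Lie algebra, so `v` and `w` remain
isotropic and `π` remains in `Π` (`exists_isBTSolutionOn`). Parallel sections of a flat connection
exist locally: they are obtained by transport along rays, and flatness with Gronwall's inequality
gives the derivative in the other directions (`exists_parallel_section`).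
-/

namespace BHierarchy

noncomputable section

/-! ### Dressing in a filtered differential ring -/

/-- A ring with a complete separated increasing `ℤ`-filtration and a derivation preserving it. -/
structure FilteredDiffRing (L : Type*) [Ring L] [Algebra ℝ L] where
  /-- The elements of degree at most `d`. -/
  F : ℤ → Submodule ℝ L
  /-- The derivation. -/
  δ : L →ₗ[ℝ] L
  mono : ∀ {d e}, d ≤ e → F d ≤ F e
  one_mem : (1 : L) ∈ F 0
  mul_mem : ∀ {d e x y}, x ∈ F d → y ∈ F e → x * y ∈ F (d + e)
  δ_mem : ∀ {d x}, x ∈ F d → δ x ∈ F d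
  leibniz : ∀ x y, δ (x * y) = δ x * y + x * δ y
  separated : ∀ x, (∀ d, x ∈ F d) → x = 0
  complete : ∀ x : ℕ → L, (∀ k : ℕ, x (k + 1) - x k ∈ F (-k)) → ∃ y, ∀ k : ℕ, y - x k ∈ F (-k)

namespace FilteredDiffRing

variable {L : Type*} [Ring L] [Algebra ℝ L] (D : FilteredDiffRing L)

lemma mul_mem_of_le {d e f : ℤ} {x y : L} (hx : x ∈ D.F d) (hy : y ∈ D.F e) (h : d + e ≤ f) :
    x * y ∈ D.F f := D.mono h (D.mul_mem hx hy)

lemma δ_one : D.δ 1 = 0 := by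
  have h := D.leibniz 1 1
  simp only [mul_one, one_mul] at h
  simpa using h

lemma pow_mem {d : ℤ} {x : L} (hx : x ∈ D.F d) (k : ℕ) : x ^ k ∈ D.F (k * d) := by
  induction k with
  | zero => simpa using D.one_mem
  | succ k ih =>
    rw [pow_succ]
    exact D.mul_mem_of_le ih hx (le_of_eq (by push_cast; ring))

/-- It suffices to test vanishing on the negative half of the filtration. -/
lemma eq_zero_of_forall_mem {x : L} (m : ℤ) (h : ∀ k : ℕ, x ∈ D.F (m - k)) : x = 0 := by
  refine D.separated x fun d => D.mono ?_ (h (m - d).toNat)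
  have := Int.self_le_toNat (m - d)
  omega

/-- Elements `1 + m` with `m` of negative degree are invertible (geometric series). -/
lemma exists_inverse {d : ℤ} (hd : d ≤ -1) {m : L} (hm : m ∈ D.F d) :
    ∃ r, r - 1 ∈ D.F d ∧ (1 + m) * r = 1 ∧ r * (1 + m) = 1 := by
  have hpow : ∀ k : ℕ, (-m) ^ k ∈ D.F (-k) := fun k =>
    D.mono (by nlinarith [Int.natCast_nonneg k]) (D.pow_mem (neg_mem hm) k)
  obtain ⟨r, hr⟩ := D.complete (fun k => ∑ i ∈ Finset.range (k + 1), (-m) ^ i) (fun k => by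
    rw [Finset.sum_range_succ _ (k + 1), add_sub_cancel_left]
    exact D.mono (by push_cast; omega) (hpow (k + 1)))
  have h0 : ∀ k : ℕ, (∑ i ∈ Finset.range (k + 1), (-m) ^ i) * (1 + m) = 1 - (-m) ^ (k + 1) := by
    intro k
    have := geom_sum_mul (-m) (k + 1)
    rw [← neg_inj, ← mul_neg, neg_sub, ← this]
    congr 1; abel
  have h1 : ∀ k : ℕ, (1 + m) * (∑ i ∈ Finset.range (k + 1), (-m) ^ i) = 1 - (-m) ^ (k + 1) := by
    intro k
    have := mul_geom_sum (-m) (k + 1)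
    rw [← neg_inj, ← neg_mul, neg_sub, ← this]
    congr 1; abel
  have h1m : 1 + m ∈ D.F 0 := add_mem D.one_mem (D.mono (by omega) hm)
  have hr1 : (1 + m) * r = 1 := by
    rw [← sub_eq_zero]
    refine D.eq_zero_of_forall_mem 0 fun k => ?_
    have e : (1 + m) * r - 1
        = (1 + m) * (r - ∑ i ∈ Finset.range (k + 1), (-m) ^ i) - (-m) ^ (k + 1) := by
      rw [mul_sub, h1]; abel
    rw [e]
    exact sub_mem (D.mul_mem_of_le h1m (hr k) (by omega))
      (D.mono (by push_cast; omega) (hpow (k + 1)))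
  have hr2 : r * (1 + m) = 1 := by
    rw [← sub_eq_zero]
    refine D.eq_zero_of_forall_mem 0 fun k => ?_
    have e : r * (1 + m) - 1
        = (r - ∑ i ∈ Finset.range (k + 1), (-m) ^ i) * (1 + m) - (-m) ^ (k + 1) := by
      rw [sub_mul, h0]; abel
    rw [e]
    exact sub_mem (D.mul_mem_of_le (hr k) h1m (by omega))
      (D.mono (by push_cast; omega) (hpow (k + 1)))
  have hrmem : r ∈ D.F 0 := by
    have h2 : r - 1 ∈ D.F 0 := by simpa using hr 0
    simpa using add_mem h2 D.one_mem
  refine ⟨r, ?_, hr1, hr2⟩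
  have e : r - 1 = -(m * r) := by
    rw [← hr1]; noncomm_ring
  rw [e]
  exact neg_mem (D.mul_mem_of_le hm hrmem (by omega))

/-- `J` of degree one with `J ^ (N + 1) = z J`, where `z` is central and invertible of degree `N`
with inverse `w`. -/
structure IsCyclic (N : ℕ) (J z w : L) : Prop where
  pos : 1 ≤ N
  J_mem : J ∈ D.F 1
  z_mem : z ∈ D.F N
  w_mem : w ∈ D.F (-N)
  z_comm : ∀ x, z * x = x * z
  zw : z * w = 1
  pow : J ^ (N + 1) = z * J
  δJ : D.δ J = 0

namespace IsCyclic

variable {D} {N : ℕ} {J z w : L} (h : D.IsCyclic N J z w)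
include h

lemma w_comm (x : L) : w * x = x * w := by
  have hwz : w * z = 1 := by rw [← h.z_comm, h.zw]
  calc w * x = w * x * (z * w) := by rw [h.zw, mul_one]
    _ = w * (x * z) * w := by noncomm_ring
    _ = w * (z * x) * w := by rw [h.z_comm]
    _ = (w * z) * x * w := by noncomm_ring
    _ = x * w := by rw [hwz, one_mul]

lemma pow_add (a : ℕ) : J ^ (a + 1 + N) = z * J ^ (a + 1) := by
  rw [show a + 1 + N = a + (N + 1) by ring, _root_.pow_add, h.pow, ← mul_assoc, ← h.z_comm,
    mul_assoc, ← pow_succ]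

/-- The degree zero projection `P = w J ^ N` onto the image of `J`, and the inverse `K` of `J`
on that image. -/
lemma exists_partial_inverse : ∃ P K : L, P ∈ D.F 0 ∧ K ∈ D.F (-1) ∧ P * P = P ∧ J * K = P ∧
    K * J = P ∧ P * J = J ∧ J * P = J ∧ K * P = K ∧ P * K = K ∧ J ^ N = z * P ∧ K ^ N = w * P ∧
    P = w * J ^ N := by
  obtain ⟨a, rfl⟩ : ∃ a, N = a + 1 := ⟨N - 1, by have := h.pos; omega⟩
  have hwz : w * z = 1 := by rw [← h.z_comm, h.zw]
  have hwJ : ∀ k, Commute w (J ^ k) := fun k => h.w_comm _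
  set P := w * J ^ (a + 1) with hP
  have hJP : J * P = J := by
    rw [hP, ← mul_assoc, ← h.w_comm, mul_assoc, ← pow_succ', h.pow, ← mul_assoc, hwz, one_mul]
  have hPJ : P * J = J := by
    rw [hP, mul_assoc, ← pow_succ, h.pow, ← mul_assoc, hwz, one_mul]
  have hJkP : ∀ k, J ^ (k + 1) * P = J ^ (k + 1) := fun k => by
    rw [pow_succ, mul_assoc, hJP]
  have hPJk : ∀ k, P * J ^ (k + 1) = J ^ (k + 1) := fun k => by
    rw [pow_succ', ← mul_assoc, hPJ]
  have hPP : P * P = P := by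
    conv_lhs => rw [hP]
    rw [mul_assoc, hJkP]
  set K := w * w * J ^ (a + (a + 1)) with hK
  have hJK : J * K = P := by
    have : J * (w * w * J ^ (a + (a + 1))) = w * w * J ^ (a + 1 + (a + 1)) := by
      rw [show a + 1 + (a + 1) = (a + (a + 1)) + 1 by ring, pow_succ' J (a + (a + 1)),
        ← mul_assoc, ← mul_assoc, ← h.w_comm J, mul_assoc w J w, ← h.w_comm J]
      noncomm_ring
    rw [hK, this, h.pow_add, mul_assoc, ← mul_assoc w z, hwz, one_mul]
  have hKJ : K * J = P := by
    have : (w * w * J ^ (a + (a + 1))) * J = w * w * J ^ (a + 1 + (a + 1)) := by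
      rw [show a + 1 + (a + 1) = (a + (a + 1)) + 1 by ring, pow_succ J (a + (a + 1)), mul_assoc]
    rw [hK, this, h.pow_add, mul_assoc, ← mul_assoc w z, hwz, one_mul]
  have hKP : K * P = K := by
    rw [hK, mul_assoc, ← add_assoc, hJkP]
  have hPK : P * K = K := by
    rw [hK, ← mul_assoc, ← mul_assoc, ← h.w_comm P, mul_assoc w P w, ← h.w_comm P, ← mul_assoc,
      mul_assoc _ P, ← add_assoc, hPJk]
  have hJN : J ^ (a + 1) = z * P := by rw [hP, ← mul_assoc, h.zw, one_mul]
  have hcomm : Commute J K := by rw [Commute, SemiconjBy, hJK, hKJ]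
  have hKN : K ^ (a + 1) = w * P := by
    have h1 : J ^ (a + 1) * K ^ (a + 1) = P := by
      rw [← hcomm.mul_pow, hJK]
      clear_value P
      clear * - hPP
      induction a with
      | zero => simp
      | succ b ih => rw [pow_succ, ih, hPP]
    have h2 : P * K ^ (a + 1) = K ^ (a + 1) := by rw [pow_succ', ← mul_assoc, hPK]
    calc K ^ (a + 1) = w * z * (P * K ^ (a + 1)) := by rw [hwz, one_mul, h2]
      _ = w * (z * P * K ^ (a + 1)) := by noncomm_ring
      _ = w * P := by rw [← hJN, h1]
  have hJpow := D.pow_mem h.J_mem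
  refine ⟨P, K, ?_, ?_, hPP, hJK, hKJ, hPJ, hJP, hKP, hPK, hJN, hKN, rfl⟩
  · exact D.mul_mem_of_le h.w_mem (hJpow _) (by push_cast; omega)
  · exact D.mul_mem_of_le (D.mul_mem h.w_mem h.w_mem) (hJpow _) (by push_cast; omega)

/-- The ring is the sum of the centralizer of `J` and the image of `ad J`, compatibly with the
filtration. On the block `P x P` the centralizer component is the average of the conjugates
`J ^ k x K ^ k`; on the blocks `P x (1 - P)` and `(1 - P) x P` the map `ad J` is invertible; the
block `(1 - P) x (1 - P)` centralizes `J`. -/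
lemma exists_decomposition {d : ℤ} {x : L} (hx : x ∈ D.F d) :
    ∃ g y, g ∈ D.F d ∧ y ∈ D.F (d - 1) ∧ J * g = g * J ∧ x = g + (J * y - y * J) := by
  obtain ⟨P, K, hP, hK, hPP, hJK, hKJ, hPJ, hJP, hKP, hPK, hJN, hKN, -⟩ :=
    h.exists_partial_inverse
  set Q := 1 - P with hQ
  have hQm : Q ∈ D.F 0 := sub_mem D.one_mem hP
  have hJQ : J * Q = 0 := by rw [hQ, mul_sub, mul_one, hJP, sub_self]
  have hQJ : Q * J = 0 := by rw [hQ, sub_mul, one_mul, hPJ, sub_self]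
  set u := P * x * P with hu
  have hum : u ∈ D.F d := D.mul_mem_of_le (D.mul_mem hP hx) hP (by omega)
  have huP : u * P = u := by rw [hu, mul_assoc, hPP]
  have hPu : P * u = u := by rw [hu, ← mul_assoc, ← mul_assoc, hPP]
  have e5 : x = Q * x * Q + u + P * x * Q + Q * x * P := by rw [hu, hQ]; noncomm_ring
  clear_value u Q
  have hPKk : ∀ k, P * K ^ k = K ^ k * P := fun k =>
    (show Commute P K by rw [Commute, SemiconjBy, hPK, hKP]).pow_right k
  have huK : ∀ k, u * K ^ (k + 1) * J = u * K ^ k := fun k => by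
    rw [pow_succ, mul_assoc, mul_assoc, hKJ, ← hPKk, ← mul_assoc, huP]
  have hconj : ∀ k : ℕ, J ^ k * u * K ^ k ∈ D.F d := fun k =>
    D.mul_mem_of_le (D.mul_mem (D.pow_mem h.J_mem k) hum) (D.pow_mem hK k) (by ring_nf; rfl)
  have hdiff : ∀ k : ℕ, ∃ y ∈ D.F (d - 1), J ^ k * u * K ^ k = u + (J * y - y * J) := by
    intro k
    induction k with
    | zero => exact ⟨0, zero_mem _, by simp⟩
    | succ k ih =>
      obtain ⟨y, hy, e⟩ := ih
      refine ⟨y + J ^ k * u * K ^ (k + 1), add_mem hy (D.mul_mem_of_le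
        (D.mul_mem (D.pow_mem h.J_mem k) hum) (D.pow_mem hK (k + 1))
        (by push_cast; ring_nf; rfl)), ?_⟩
      have e2 : J ^ k * u * K ^ (k + 1) * J = J ^ k * u * K ^ k := by
        rw [mul_assoc (J ^ k), mul_assoc (J ^ k), huK, mul_assoc]
      rw [mul_add, add_mul, e2, e, pow_succ' J]
      noncomm_ring
  choose Y hY hYe using hdiff
  -- the average commutes with `J` because conjugation by `J ^ N = z P` fixes the block `P x P`
  set S := ∑ k ∈ Finset.range N, J ^ k * u * K ^ k with hS
  have hSJ : J * S = S * J := by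
    have e : ∀ k ∈ Finset.range N, J * (J ^ k * u * K ^ k) - J ^ k * u * K ^ k * J
        = J ^ (k + 1) * u * K ^ (k + 1) * J - J ^ k * u * K ^ k * J := by
      intro k _
      rw [mul_assoc (J ^ (k + 1)), mul_assoc (J ^ (k + 1)), huK, pow_succ']
      noncomm_ring
    rw [← sub_eq_zero, hS, Finset.mul_sum, Finset.sum_mul, ← Finset.sum_sub_distrib,
      Finset.sum_congr rfl e, Finset.sum_range_sub (fun k => J ^ k * u * K ^ k * J), hJN, hKN,
      sub_eq_zero]
    calc z * P * u * (w * P) * J = z * (P * u) * w * (P * J) := by noncomm_ring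
      _ = z * (u * w) * J := by rw [hPu, hPJ]; noncomm_ring
      _ = z * w * u * J := by rw [← h.w_comm]; noncomm_ring
      _ = J ^ 0 * u * K ^ 0 * J := by rw [h.zw]; simp
  have hSe : S = (N : ℝ) • u + (J * (∑ k ∈ Finset.range N, Y k)
      - (∑ k ∈ Finset.range N, Y k) * J) := by
    rw [hS, Finset.sum_congr rfl fun k _ => hYe k, Finset.sum_add_distrib, Finset.sum_const,
      Finset.card_range, Finset.sum_sub_distrib, Finset.mul_sum, Finset.sum_mul,
      Nat.cast_smul_eq_nsmul]
  have hN : (N : ℝ) ≠ 0 := by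
    have := h.pos
    positivity
  have hue : u = (N : ℝ)⁻¹ • S - (J * ((N : ℝ)⁻¹ • ∑ k ∈ Finset.range N, Y k)
      - ((N : ℝ)⁻¹ • ∑ k ∈ Finset.range N, Y k) * J) := by
    rw [hSe, mul_smul_comm, smul_mul_assoc, ← smul_sub, ← smul_sub, add_sub_cancel_right,
      smul_smul, inv_mul_cancel₀ hN, one_smul]
  set Z := (N : ℝ)⁻¹ • ∑ k ∈ Finset.range N, Y k with hZ
  refine ⟨Q * x * Q + (N : ℝ)⁻¹ • S, K * x * Q - Q * x * K - Z, ?_, ?_, ?_, ?_⟩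
  · exact add_mem (D.mul_mem_of_le (D.mul_mem hQm hx) hQm (by omega))
      (Submodule.smul_mem _ _ (sum_mem fun k _ => hconj k))
  · exact sub_mem (sub_mem (D.mul_mem_of_le (D.mul_mem hK hx) hQm (by omega))
      (D.mul_mem_of_le (D.mul_mem hQm hx) hK (by omega)))
      (Submodule.smul_mem _ _ (sum_mem fun k _ => hY k))
  · rw [mul_add, add_mul, mul_smul_comm, hSJ, smul_mul_assoc, ← mul_assoc, ← mul_assoc, hJQ,
      mul_assoc (Q * x), hQJ]
    simp
  · have e1 : J * (K * x * Q) = P * x * Q := by rw [← mul_assoc, ← mul_assoc, hJK]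
    have e2 : J * (Q * x * K) = 0 := by rw [← mul_assoc, ← mul_assoc, hJQ]; simp
    have e3 : K * x * Q * J = 0 := by rw [mul_assoc (K * x), hQJ, mul_zero]
    have e4 : Q * x * K * J = Q * x * P := by rw [mul_assoc (Q * x), hKJ]
    have e5 : x = Q * x * Q + u + P * x * Q + Q * x * P := by rw [hu, hQ]; noncomm_ring
    rw [mul_sub, mul_sub, sub_mul, sub_mul, e1, e2, e3, e4]
    conv_lhs => rw [e5, hue]
    abel

/-- `T` is a resolvent of `δ + J + q`: it commutes with this operator, satisfies the same
polynomial equation as `J`, and differs from `J` by a term of degree zero. -/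
structure IsResolvent (_h : D.IsCyclic N J z w) (q T : L) : Prop where
  diff_mem : T - J ∈ D.F 0
  commute : D.δ T + ((J + q) * T - T * (J + q)) = 0
  pow_eq : T ^ (N + 1) = z * T

omit h in
lemma pow_sub_pow_mem {a b : L} {d : ℤ} (ha : a ∈ D.F 1) (hb : b ∈ D.F 1) (hab : a - b ∈ D.F d)
    (m : ℕ) : a ^ (m + 1) - b ^ (m + 1) ∈ D.F (m + d) := by
  induction m with
  | zero => simpa using hab
  | succ m ih =>
    have e : a ^ (m + 1 + 1) - b ^ (m + 1 + 1)
        = (a ^ (m + 1) - b ^ (m + 1)) * a + b ^ (m + 1) * (a - b) := by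
      rw [pow_succ a, pow_succ b (m + 1)]; noncomm_ring
    rw [e]
    exact add_mem (D.mul_mem_of_le ih ha (by push_cast; omega))
      (D.mul_mem_of_le (D.pow_mem hb (m + 1)) hab (by push_cast; omega))

/-- A dressing to order `k`: invertible `M` with inverse `R` carrying `δ + J + f` to `δ + J + q`
up to degree `-k`, where `f` commutes with `J`. -/
structure IsDressing (_h : D.IsCyclic N J z w) (q : L) (k : ℕ) (M R f : L) : Prop where
  M_mem : M ∈ D.F 0
  R_mem : R ∈ D.F 0
  f_mem : f ∈ D.F 0
  MR : M * R = 1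
  RM : R * M = 1
  f_comm : J * f = f * J
  rem : D.δ M + (J + q) * M - M * (J + f) ∈ D.F (-k)

/-- The inductive step of the dressing: the remainder is removed to one more order by the
decomposition of `exists_decomposition`. The last clause says that the dressed elements `M J R` form
a Cauchy sequence. -/
lemma exists_dressing_succ {q : L} {k : ℕ} {M R f : L} (hM : h.IsDressing q k M R f) :
    ∃ M' R' f', h.IsDressing q (k + 1) M' R' f' ∧ M' * J * R' - M * J * R ∈ D.F (-k) := by
  set E := D.δ M + (J + q) * M - M * (J + f) with hE
  have hRE : R * E ∈ D.F (-k) := D.mul_mem_of_le hM.R_mem hM.rem (by omega)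
  obtain ⟨g, y, hg, hy, hgJ, e⟩ := h.exists_decomposition hRE
  -- `M (1 - y)` and `f + g` cancel the remainder `E = M (R E)` up to lower order.
  obtain ⟨r, hr, hr1, hr2⟩ := D.exists_inverse (d := -k - 1) (by omega) (neg_mem hy)
  have hr0 : r ∈ D.F 0 := by
    simpa using add_mem (D.mono (by omega) hr) D.one_mem
  have hy1 : 1 + -y ∈ D.F 0 := add_mem D.one_mem (D.mono (by omega) (neg_mem hy))
  have hME : M * g - M * (y * J) + M * (J * y) = E := by
    calc M * g - M * (y * J) + M * (J * y) = M * (g + (J * y - y * J)) := by noncomm_ring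
      _ = M * (R * E) := by rw [← e]
      _ = E := by rw [← mul_assoc, hM.MR, one_mul]
  refine ⟨M * (1 + -y), r * R, f + g, ⟨D.mul_mem_of_le hM.M_mem hy1 le_rfl,
    D.mul_mem_of_le hr0 hM.R_mem le_rfl, add_mem hM.f_mem (D.mono (by omega) hg), ?_, ?_, ?_, ?_⟩,
    ?_⟩
  · calc M * (1 + -y) * (r * R) = M * ((1 + -y) * r) * R := by noncomm_ring
      _ = 1 := by rw [hr1, mul_one, hM.MR]
  · calc r * R * (M * (1 + -y)) = r * (R * M) * (1 + -y) := by noncomm_ring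
      _ = 1 := by rw [hM.RM, mul_one, hr2]
  · rw [mul_add, add_mul, hM.f_comm, hgJ]
  · have e2 : D.δ (M * (1 + -y)) + (J + q) * (M * (1 + -y)) - M * (1 + -y) * (J + (f + g))
        = M * (y * f - f * y) + M * (y * g) - E * y - M * D.δ y := by
      rw [D.leibniz, map_add, map_neg, D.δ_one]
      have e3 : D.δ M = E - (J + q) * M + M * (J + f) := by rw [hE]; abel
      have e4 : M * g = E + M * (y * J) - M * (J * y) := by rw [← hME]; abel
      rw [e3]
      have e5 : M * (1 + -y) * (J + (f + g)) = M * (1 + -y) * (J + f) + M * g - M * (y * g) := by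
        noncomm_ring
      rw [e5, e4]
      noncomm_ring
    rw [e2]
    have hyf := D.mul_mem hy hM.f_mem
    have hfy := D.mul_mem hM.f_mem hy
    refine sub_mem (sub_mem (add_mem ?_ ?_) ?_) ?_
    · exact D.mul_mem_of_le hM.M_mem (d := 0) (e := -k - 1)
        (sub_mem (D.mono (by omega) hyf) (D.mono (by omega) hfy)) (by push_cast; omega)
    · exact D.mul_mem_of_le hM.M_mem (D.mul_mem hy hg) (by push_cast; omega)
    · exact D.mul_mem_of_le hM.rem hy (by push_cast; omega)
    · exact D.mul_mem_of_le hM.M_mem (D.δ_mem hy) (by push_cast; omega)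
  · have e6 : M * (1 + -y) * J * (r * R) - M * J * R = M * ((J * y - y * J) * r) * R := by
      have : (1 + -y) * J * r = J + (J * y - y * J) * r := by
        calc (1 + -y) * J * r = J * ((1 + -y) * r) + (J * y - y * J) * r := by noncomm_ring
          _ = _ := by rw [hr1, mul_one]
      calc M * (1 + -y) * J * (r * R) - M * J * R
          = M * ((1 + -y) * J * r) * R - M * J * R := by noncomm_ring
        _ = _ := by rw [this]; noncomm_ring
    rw [e6]
    have hJy : J * y - y * J ∈ D.F (-k) :=
      sub_mem (D.mul_mem_of_le h.J_mem hy (by omega)) (D.mul_mem_of_le hy h.J_mem (by omega))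
    exact D.mul_mem_of_le (D.mul_mem hM.M_mem (D.mul_mem hJy hr0)) hM.R_mem (by omega)

/-- A dressing to order `k` carries `J` to a resolvent up to degree `1 - k`. -/
lemma IsDressing.commute_mem {q : L} {k : ℕ} {M R f : L} (hM : h.IsDressing q k M R f) :
    D.δ (M * J * R) + ((J + q) * (M * J * R) - M * J * R * (J + q)) ∈ D.F (1 - k) := by
  set E := D.δ M + (J + q) * M - M * (J + f) with hE
  have e3 : D.δ M = E - (J + q) * M + M * (J + f) := by rw [hE]; abel
  have hδR : D.δ R = -(R * D.δ M * R) := by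
    have h1 : D.δ M * R + M * D.δ R = 0 := by rw [← D.leibniz, hM.MR, D.δ_one]
    calc D.δ R = R * M * D.δ R := by rw [hM.RM, one_mul]
      _ = R * (D.δ M * R + M * D.δ R) - R * D.δ M * R := by noncomm_ring
      _ = _ := by rw [h1]; noncomm_ring
  -- with the remainder `E`, the dressed operator is `M (δ + J + f) M⁻¹ = δ + J + q - E M⁻¹`, and it
  -- commutes with `M J M⁻¹` because `f` commutes with `J`
  have e : D.δ (M * J * R) + ((J + q) * (M * J * R) - M * J * R * (J + q))
      = E * R * (M * J * R) - M * J * R * (E * R) := by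
    rw [D.leibniz, D.leibniz, h.δJ, hδR, e3]
    have c1 : ∀ x, M * J * R * (M * x) = M * (J * x) := fun x => by
      calc M * J * R * (M * x) = M * J * (R * M) * x := by noncomm_ring
        _ = _ := by rw [hM.RM]; noncomm_ring
    have c2 : ∀ x y, x * R * (M * y) = x * y := fun x y => by
      calc x * R * (M * y) = x * (R * M) * y := by noncomm_ring
        _ = _ := by rw [hM.RM]; noncomm_ring
    have c3 : M * J * (R * (E - (J + q) * M + M * (J + f)) * R)
        = M * J * R * (E * R) - M * J * R * (J + q) * (M * R) + M * J * (R * M) * (J + f) * R := by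
      noncomm_ring
    rw [mul_neg, c3, hM.MR, hM.RM, mul_assoc M J R, c2]
    have c4 : M * (J + f) * J * R = M * J * (J + f) * R := by
      rw [mul_assoc M (J + f), add_mul, ← hM.f_comm, ← mul_add, ← mul_assoc]
    calc ((E - (J + q) * M + M * (J + f)) * J + M * 0) * R
          + -(M * (J * R) * (E * R) - M * (J * R) * (J + q) * 1 + M * J * 1 * (J + f) * R)
          + ((J + q) * (M * (J * R)) - M * (J * R) * (J + q))
        = E * (J * R) - M * (J * R) * (E * R) + (M * (J + f) * J * R - M * J * (J + f) * R) := by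
          noncomm_ring
      _ = _ := by rw [c4, sub_self, add_zero]
  rw [e]
  have hER : E * R ∈ D.F (-k) := D.mul_mem_of_le hM.rem hM.R_mem (by omega)
  have hT : M * J * R ∈ D.F 1 := D.mul_mem_of_le (D.mul_mem hM.M_mem h.J_mem) hM.R_mem (by omega)
  exact sub_mem (D.mul_mem_of_le hER hT (by omega)) (D.mul_mem_of_le hT hER (by omega))

lemma IsDressing.pow_eq {q : L} {k : ℕ} {M R f : L} (hM : h.IsDressing q k M R f) :
    (M * J * R) ^ (N + 1) = z * (M * J * R) := by
  have e : ∀ m : ℕ, (M * J * R) ^ m = M * J ^ m * R := by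
    intro m
    induction m with
    | zero => simp [hM.MR]
    | succ m ih =>
      calc (M * J * R) ^ (m + 1) = M * J ^ m * (R * M) * J * R := by
            rw [pow_succ, ih]; noncomm_ring
        _ = _ := by rw [hM.RM, pow_succ]; noncomm_ring
  rw [e, h.pow, ← mul_assoc, ← mul_assoc, ← mul_assoc, h.z_comm M]

/-- The resolvent is the limit of the dressed elements `M J M⁻¹`. -/
theorem exists_resolvent {q : L} (hq : q ∈ D.F 0) : ∃ T, h.IsResolvent q T := by
  -- the successive dressings, packaged with their order
  have h0 : h.IsDressing q 0 1 1 0 :=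
    ⟨D.one_mem, D.one_mem, zero_mem _, one_mul _, one_mul _, by simp, by simpa [D.δ_one] using hq⟩
  choose m r f hs hc using fun (k : ℕ) (x : {x : L × L × L // h.IsDressing q k x.1 x.2.1 x.2.2}) =>
    h.exists_dressing_succ x.2
  let x : (k : ℕ) → {x : L × L × L // h.IsDressing q k x.1 x.2.1 x.2.2} := fun k =>
    Nat.rec ⟨(1, 1, 0), h0⟩ (fun k y => ⟨(m k y, r k y, f k y), hs k y⟩) k
  let t : ℕ → L := fun k => (x k).1.1 * J * (x k).1.2.1
  have ht0 : t 0 = J := by change 1 * J * 1 = J; simp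
  obtain ⟨T, hT⟩ := D.complete t fun k => hc k (x k)
  have hTJ : T - J ∈ D.F 0 := by simpa [ht0] using hT 0
  have hT1 : T ∈ D.F 1 := by
    simpa using add_mem (D.mono (by omega) hTJ) h.J_mem
  have ht1 : ∀ k, t k ∈ D.F 1 := fun k => D.mul_mem_of_le
    (D.mul_mem (x k).2.M_mem h.J_mem) (x k).2.R_mem (by omega)
  have hJq : J + q ∈ D.F 1 := add_mem h.J_mem (D.mono (by omega) hq)
  refine ⟨T, hTJ, D.eq_zero_of_forall_mem 1 fun k => ?_, ?_⟩
  · have e : D.δ T + ((J + q) * T - T * (J + q))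
        = D.δ (T - t k) + ((J + q) * (T - t k) - (T - t k) * (J + q))
          + (D.δ (t k) + ((J + q) * t k - t k * (J + q))) := by
      rw [map_sub]; noncomm_ring
    rw [e]
    refine add_mem (add_mem (D.mono (by omega) (D.δ_mem (hT k))) (sub_mem ?_ ?_))
      (x k).2.commute_mem
    · exact D.mul_mem_of_le hJq (hT k) (by omega)
    · exact D.mul_mem_of_le (hT k) hJq (by omega)
  · rw [← sub_eq_zero]
    refine D.eq_zero_of_forall_mem N fun k => ?_
    have e : T ^ (N + 1) - z * T = (T ^ (N + 1) - t k ^ (N + 1)) - z * (T - t k) := by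
      have : t k ^ (N + 1) = z * t k := (x k).2.pow_eq
      rw [this, mul_sub]; abel
    rw [e]
    exact sub_mem (D.mono (by omega) (pow_sub_pow_mem hT1 (ht1 k) (hT k) N))
      (D.mul_mem_of_le h.z_mem (hT k) (by omega))

/-- If `T - T'` has degree `d`, its leading part `E` commutes with `J`, and the polynomial
equation gives `(N + 1) P E = E` with `P` idempotent, so `E = 0`. -/
theorem IsResolvent.unique {q T T' : L} (hq : q ∈ D.F 0) (hT : h.IsResolvent q T)
    (hT' : h.IsResolvent q T') : T = T' := by
  obtain ⟨P, K, hP, -, hPP, -, -, -, -, -, -, -, -, hPe⟩ := h.exists_partial_inverse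
  have hwz : w * z = 1 := by rw [← h.z_comm, h.zw]
  have hmem : ∀ {S : L}, h.IsResolvent q S → S ∈ D.F 1 := fun {S} hS => by
    simpa using add_mem (D.mono (by omega : (0 : ℤ) ≤ 1) hS.diff_mem) h.J_mem
  set E := T - T' with hE
  have hcomm : D.δ E + ((J + q) * E - E * (J + q)) = 0 := by
    have : D.δ E + ((J + q) * E - E * (J + q)) = (D.δ T + ((J + q) * T - T * (J + q)))
        - (D.δ T' + ((J + q) * T' - T' * (J + q))) := by
      rw [hE, map_sub]; noncomm_ring
    rw [this, hT.commute, hT'.commute, sub_zero]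
  have step : ∀ d : ℤ, E ∈ D.F d → E ∈ D.F (d - 1) := by
    -- modulo lower order, `T ^ (N + 1) - T' ^ (N + 1)` is `(N + 1) J ^ N E = (N + 1) z P E`,
    -- whereas it equals `z E` by the polynomial equation
    intro d hd
    have hJE : J * E - E * J ∈ D.F d := by
      have : J * E - E * J = -D.δ E - (q * E - E * q) := by
        rw [← sub_eq_zero, ← hcomm]; noncomm_ring
      rw [this]
      exact sub_mem (neg_mem (D.δ_mem hd)) (sub_mem (D.mul_mem_of_le hq hd (by omega))
        (D.mul_mem_of_le hd hq (by omega)))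
    have hEJ : ∀ m : ℕ, E * J ^ m - J ^ m * E ∈ D.F (m - 1 + d) := by
      intro m
      induction m with
      | zero => simp
      | succ m ih =>
        have : E * J ^ (m + 1) - J ^ (m + 1) * E
            = (E * J ^ m - J ^ m * E) * J - J ^ m * (J * E - E * J) := by
          rw [pow_succ]; noncomm_ring
        rw [this]
        exact sub_mem (D.mul_mem_of_le ih h.J_mem (by push_cast; omega))
          (D.mul_mem_of_le (D.pow_mem h.J_mem m) hJE (by push_cast; omega))
    have hpow : ∀ m : ℕ, T ^ (m + 1) - T' ^ (m + 1) - ((m : ℝ) + 1) • (J ^ m * E)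
        ∈ D.F (m - 1 + d) := by
      intro m
      induction m with
      | zero => simp [← hE]
      | succ m ih =>
        have hTm : T ^ (m + 1) - T' ^ (m + 1) ∈ D.F (m + d) :=
          pow_sub_pow_mem (hmem hT) (hmem hT') hd m
        have hT'J : T' ^ (m + 1) - J ^ (m + 1) ∈ D.F (m + 0) :=
          pow_sub_pow_mem (hmem hT') h.J_mem hT'.diff_mem m
        have e : T ^ (m + 1 + 1) - T' ^ (m + 1 + 1)
            - (((m + 1 : ℕ) : ℝ) + 1) • (J ^ (m + 1) * E)
            = (T - J) * (T ^ (m + 1) - T' ^ (m + 1))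
              + J * (T ^ (m + 1) - T' ^ (m + 1) - ((m : ℝ) + 1) • (J ^ m * E))
              + E * (T' ^ (m + 1) - J ^ (m + 1)) + (E * J ^ (m + 1) - J ^ (m + 1) * E) := by
          have e1 : J * ((m : ℝ) + 1) • (J ^ m * E) = ((m : ℝ) + 1) • (J ^ (m + 1) * E) := by
            rw [mul_smul_comm, pow_succ', mul_assoc]
          rw [mul_sub J, e1, pow_succ' T, pow_succ' T' (m + 1), hE]
          push_cast
          rw [add_smul _ (1 : ℝ), one_smul]
          noncomm_ring
        rw [e]
        refine add_mem (add_mem (add_mem ?_ ?_) ?_) ?_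
        · exact D.mul_mem_of_le hT.diff_mem hTm (by push_cast; omega)
        · exact D.mul_mem_of_le h.J_mem ih (by push_cast; omega)
        · exact D.mul_mem_of_le hd hT'J (by push_cast; omega)
        · simpa using hEJ (m + 1)
    have h1 := hpow N
    rw [hT.pow_eq, hT'.pow_eq, ← mul_sub] at h1
    have h2 : E - ((N : ℝ) + 1) • (P * E) ∈ D.F (d - 1) := by
      have := D.mul_mem_of_le h.w_mem h1 (show _ ≤ d - 1 by omega)
      rwa [mul_sub, ← mul_assoc, hwz, one_mul, mul_smul_comm, ← mul_assoc, ← hPe] at this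
    have h3 : P * E ∈ D.F (d - 1) := by
      have h4 := D.mul_mem_of_le hP h2 (show _ ≤ d - 1 by omega)
      rw [mul_sub, mul_smul_comm, ← mul_assoc, hPP, add_smul, one_smul, sub_add_cancel_right] at h4
      have hN : (N : ℝ) ≠ 0 := by
        have := h.pos
        positivity
      have := Submodule.smul_mem _ (N : ℝ)⁻¹ (neg_mem h4)
      rwa [neg_neg, smul_smul, inv_mul_cancel₀ hN, one_smul] at this
    simpa using add_mem h2 (Submodule.smul_mem _ ((N : ℝ) + 1) h3)
  have hE0 : E ∈ D.F 0 := by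
    have : E = (T - J) - (T' - J) := by rw [hE]; abel
    rw [this]
    exact sub_mem hT.diff_mem hT'.diff_mem
  rw [← sub_eq_zero, ← hE]
  refine D.eq_zero_of_forall_mem 0 fun k => ?_
  induction k with
  | zero => simpa using hE0
  | succ k ih => exact D.mono (by push_cast; omega) (step _ ih)

/-- An anti-automorphism that negates `J` and `q` maps the resolvent to minus a resolvent, hence
negates it by uniqueness. -/
lemma IsResolvent.eq_neg_of_anti {q T : L} (hT : h.IsResolvent q T) (hN : Even N) (s : L →+ L)
    (hmul : ∀ x y, s (x * y) = s y * s x) (hF : ∀ {x}, x ∈ D.F 0 → s x ∈ D.F 0)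
    (hδ : ∀ x, D.δ (s x) = s (D.δ x)) (hJ : s J = -J) (hsq : s q = -q) (hz : s z = z)
    (hq : q ∈ D.F 0) : s T = -T := by
  have hpow : ∀ k : ℕ, s (T ^ (k + 1)) = s T ^ (k + 1) := by
    intro k
    induction k with
    | zero => simp
    | succ k ih => rw [pow_succ, hmul, ih, ← pow_succ']
  have hT' : h.IsResolvent q (-s T) := by
    refine ⟨?_, ?_, ?_⟩
    · have e : -s T - J = -s (T - J) := by rw [map_sub, hJ]; abel
      rw [e]
      exact neg_mem (hF hT.diff_mem)
    · have h1 := congrArg s hT.commute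
      rw [map_add, map_sub, hmul, hmul, map_add, hJ, hsq, map_zero, ← hδ] at h1
      rw [map_neg, ← neg_eq_zero, ← h1]
      noncomm_ring
    · rw [hN.add_one.neg_pow, ← hpow, hT.pow_eq, hmul, hz, ← h.z_comm, mul_neg]
  exact neg_eq_iff_eq_neg.1 (hT.unique h hq hT').symm

end IsCyclic
end FilteredDiffRing

/-! ### Parallel sections of flat connections -/

section Frobenius
set_option maxSynthPendingDepth 3
open Metric Set Filter Topology

variable {P E : Type*} [NormedAddCommGroup P] [NormedSpace ℝ P] [NormedAddCommGroup E]
  [NormedSpace ℝ E]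

/-- Near a point of an open set, a `C^∞` connection form and its derivative are bounded, and the
derivative is Lipschitz. -/
lemma exists_local_bounds {U : Set P} (hU : IsOpen U) {θ : P → P →L[ℝ] E →L[ℝ] E}
    (hθ : ContDiffOn ℝ ∞ θ U) {p₀ : P} (hp₀ : p₀ ∈ U) :
    ∃ ε > 0, ∃ K : ℝ, 1 ≤ K ∧ ball p₀ ε ⊆ U ∧ (∀ p ∈ ball p₀ ε, ‖θ p‖ ≤ K) ∧
      (∀ p ∈ ball p₀ ε, ‖fderiv ℝ θ p‖ ≤ K) ∧
      ∀ p ∈ ball p₀ ε, ∀ p' ∈ ball p₀ ε, ‖fderiv ℝ θ p' - fderiv ℝ θ p‖ ≤ K * ‖p' - p‖ := by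
  have hat : ContDiffAt ℝ ∞ θ p₀ := hθ.contDiffAt (hU.mem_nhds hp₀)
  have hD : ContDiffAt ℝ 1 (fderiv ℝ θ) p₀ := hat.fderiv_right
    (show ((1 + 1 : ℕ∞) : WithTop ℕ∞) ≤ ((⊤ : ℕ∞) : WithTop ℕ∞) from WithTop.coe_le_coe.2 le_top)
  obtain ⟨K, s, hs, hL⟩ := hD.exists_lipschitzOnWith
  have b1 := hat.continuousAt.norm.eventually_lt continuousAt_const
    (show ‖θ p₀‖ < ‖θ p₀‖ + 1 by linarith)
  have b2 := hD.continuousAt.norm.eventually_lt continuousAt_const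
    (show ‖fderiv ℝ θ p₀‖ < ‖fderiv ℝ θ p₀‖ + 1 by linarith)
  obtain ⟨ε, hε, hball⟩ := Metric.eventually_nhds_iff_ball.1
    (((hU.eventually_mem hp₀).and hs).and (b1.and b2))
  have k1 := norm_nonneg (θ p₀)
  have k2 := norm_nonneg (fderiv ℝ θ p₀)
  refine ⟨ε, hε, K + ‖θ p₀‖ + ‖fderiv ℝ θ p₀‖ + 1, by linarith [K.2],
    fun p hp => (hball p hp).1.1, fun p hp => ?_, fun p hp => ?_, fun p hp p' hp' => ?_⟩
  · linarith [(hball p hp).2.1, K.2]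
  · linarith [(hball p hp).2.2, K.2]
  · refine (hL.norm_sub_le (hball p' hp').1.2 (hball p hp).1.2).trans ?_
    gcongr
    linarith

/-- Parallel transport along a ray, for a bounded connection form and a short ray. -/
lemma exists_radial_solution [CompleteSpace E] {θ : P → P →L[ℝ] E →L[ℝ] E} {p₀ h : P} {K : ℝ}
    (hcont : ∀ s ∈ Icc (0 : ℝ) 1, ContinuousAt θ (p₀ + s • h))
    (hK : ∀ s ∈ Icc (0 : ℝ) 1, ‖θ (p₀ + s • h)‖ ≤ K) (hh : K * ‖h‖ ≤ 1 / 2) (v₀ : E) :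
    ∃ w : ℝ → E, w 0 = v₀ ∧
      ∀ s ∈ Icc (0 : ℝ) 1, HasDerivWithinAt w (-(θ (p₀ + s • h) h (w s))) (Icc 0 1) s := by
  have hK0 : 0 ≤ K := (norm_nonneg _).trans (hK 0 (by simp))
  have hop : ∀ s ∈ Icc (0 : ℝ) 1, ‖θ (p₀ + s • h) h‖ ≤ 1 / 2 := fun s hs =>
    ((θ _).le_opNorm h).trans ((mul_le_mul_of_nonneg_right (hK s hs) (norm_nonneg _)).trans hh)
  have hpl : IsPicardLindelof (fun s v => -(θ (p₀ + s • h) h v))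
      (⟨0, by simp⟩ : Icc (0 : ℝ) 1) v₀ (‖v₀‖₊ + 1) 0 (‖v₀‖₊ + 1) 1 := by
    refine ⟨fun s hs => ?_, fun x _ => ?_, fun s hs x hx => ?_, ?_⟩
    · refine LipschitzOnWith.of_dist_le_mul fun x _ y _ => ?_
      rw [dist_neg_neg, dist_eq_norm, dist_eq_norm, ← map_sub]
      refine ((θ _ h).le_opNorm _).trans ?_
      gcongr
      exact (hop s hs).trans (by norm_num)
    · have : ContinuousOn (fun s : ℝ => θ (p₀ + s • h)) (Icc 0 1) := fun s hs => by
        have h1 : ContinuousAt (fun s : ℝ => p₀ + s • h) s := by fun_prop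
        exact (ContinuousAt.comp (f := fun s : ℝ => p₀ + s • h) (hcont s hs) h1).continuousWithinAt
      exact ((this.clm_apply continuousOn_const).clm_apply continuousOn_const).neg
    · rw [norm_neg]
      have hxn : ‖x‖ ≤ 2 * ‖v₀‖ + 1 := by
        have h1 : ‖x - v₀‖ ≤ ‖v₀‖ + 1 := by simpa [dist_eq_norm] using hx
        have h2 := norm_add_le (x - v₀) v₀
        rw [sub_add_cancel] at h2
        linarith
      calc ‖θ (p₀ + s • h) h x‖ ≤ 1 / 2 * (2 * ‖v₀‖ + 1) := by
            refine ((θ _ h).le_opNorm _).trans ?_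
            gcongr
            exact hop s hs
        _ ≤ ‖v₀‖ + 1 := by linarith
    · simp
  exact hpl.exists_eq_forall_mem_Icc_hasDerivWithinAt₀

/-- Comparison of the parallel transports along two nearby rays: by flatness, moving the end point
by `k` changes the result by `-θ(k)` to first order. -/
lemma norm_radial_sub_le {θ : P → P →L[ℝ] E →L[ℝ] E} {p₀ h k : P} {ε K C : ℝ}
    (hε : ε ≤ 1) (hK1 : 1 ≤ K) (hdiff : ∀ p ∈ ball p₀ ε, DifferentiableAt ℝ θ p)
    (hb : ∀ p ∈ ball p₀ ε, ‖θ p‖ ≤ K) (hDb : ∀ p ∈ ball p₀ ε, ‖fderiv ℝ θ p‖ ≤ K)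
    (hDl : ∀ p ∈ ball p₀ ε, ∀ p' ∈ ball p₀ ε,
      ‖fderiv ℝ θ p' - fderiv ℝ θ p‖ ≤ K * ‖p' - p‖)
    (flat : ∀ p ∈ ball p₀ ε, ∀ h k v, fderiv ℝ θ p h k v - fderiv ℝ θ p k h v
      + (θ p h (θ p k v) - θ p k (θ p h v)) = 0)
    (hh : ‖h‖ < ε) (hhk : ‖h + k‖ < ε) {w w' : ℝ → E} (hww' : w 0 = w' 0)
    (hw : ∀ s ∈ Icc (0 : ℝ) 1, HasDerivWithinAt w (-(θ (p₀ + s • h) h (w s))) (Icc 0 1) s)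
    (hw' : ∀ s ∈ Icc (0 : ℝ) 1,
      HasDerivWithinAt w' (-(θ (p₀ + s • (h + k)) (h + k) (w' s))) (Icc 0 1) s)
    (hC : ∀ s ∈ Icc (0 : ℝ) 1, ‖w s‖ ≤ C) :
    ‖w' 1 - w 1 + θ (p₀ + h) k (w 1)‖
      ≤ (2 * K + 2 * K ^ 2) * C / K * (Real.exp K - 1) * ‖k‖ ^ 2 := by
  have hC0 : 0 ≤ C := (norm_nonneg _).trans (hC 0 (by simp))
  have hmem : ∀ s ∈ Icc (0 : ℝ) 1, ∀ u : P, ‖u‖ < ε → p₀ + s • u ∈ ball p₀ ε := by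
    intro s hs u hu
    rw [mem_ball_iff_norm, add_sub_cancel_left, norm_smul, Real.norm_of_nonneg hs.1]
    exact (mul_le_of_le_one_left (norm_nonneg _) hs.2).trans_lt hu
  -- the first order prediction for the transport along the second ray
  set z : ℝ → E := fun s => w s - s • θ (p₀ + s • h) k (w s) with hz
  set g : ℝ → E := fun s => -(θ (p₀ + s • (h + k)) (h + k) (w' s))
    - (-(θ (p₀ + s • h) h (w s)) - (s • (fderiv ℝ θ (p₀ + s • h) h k (w s)
      + θ (p₀ + s • h) k (-(θ (p₀ + s • h) h (w s)))) + (1 : ℝ) • θ (p₀ + s • h) k (w s)))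
    with hg
  have hder : ∀ s ∈ Icc (0 : ℝ) 1, HasDerivWithinAt (fun s => w' s - z s) (g s) (Icc 0 1) s := by
    intro s hs
    have h1 : HasDerivWithinAt (fun s : ℝ => θ (p₀ + s • h)) (fderiv ℝ θ (p₀ + s • h) h)
        (Icc 0 1) s := by
      have h2 : HasDerivAt (fun s : ℝ => p₀ + s • h) ((1 : ℝ) • h) s :=
        ((hasDerivAt_id s).smul_const h).const_add p₀
      have := (hdiff _ (hmem s hs h hh)).hasFDerivAt.comp_hasDerivAt s h2
      rw [one_smul] at this
      exact this.hasDerivWithinAt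
    have h3 : HasDerivWithinAt (fun s : ℝ => θ (p₀ + s • h) k) (fderiv ℝ θ (p₀ + s • h) h k)
        (Icc 0 1) s := by
      simpa using h1.clm_apply (hasDerivWithinAt_const s (Icc 0 1) k)
    have h4 := h3.clm_apply (hw s hs)
    exact (hw' s hs).sub ((hw s hs).sub ((hasDerivWithinAt_id s _).smul h4))
  have key : ∀ s ∈ Icc (0 : ℝ) 1,
      ‖g s‖ ≤ K * ‖w' s - z s‖ + (2 * K + 2 * K ^ 2) * C * ‖k‖ ^ 2 := by
    intro s hs
    have hγ := hmem s hs h hh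
    have hγ' := hmem s hs (h + k) hhk
    have hs1 : |s| ≤ 1 := by rw [abs_of_nonneg hs.1]; exact hs.2
    have hsk : ‖s • k‖ ≤ ‖k‖ := by
      rw [norm_smul]; exact mul_le_of_le_one_left (norm_nonneg _) hs1
    have hγγ : p₀ + s • (h + k) - (p₀ + s • h) = s • k := by rw [smul_add]; abel
    set O := θ (p₀ + s • h) with hO
    set O' := θ (p₀ + s • (h + k)) with hO'
    set D := fderiv ℝ θ (p₀ + s • h) with hD
    have hseg : segment ℝ (p₀ + s • h) (p₀ + s • (h + k)) ⊆ ball p₀ ε :=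
      (convex_ball p₀ ε).segment_subset hγ hγ'
    have hR : ‖O' - O - D (s • k)‖ ≤ K * ‖k‖ * ‖k‖ := by
      have := (convex_segment (p₀ + s • h) (p₀ + s • (h + k))).norm_image_sub_le_of_norm_fderiv_le'
        (𝕜 := ℝ) (f := θ) (φ := D) (C := K * ‖k‖) (fun x hx => hdiff x (hseg hx)) (fun x hx => ?_)
        (left_mem_segment ℝ _ _) (right_mem_segment ℝ _ _)
      · rw [hγγ] at this
        exact this.trans (by gcongr)
      · refine (hDl _ hγ _ (hseg hx)).trans ?_
        gcongr
        refine le_trans ?_ hsk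
        rw [← hγγ]
        exact norm_sub_le_of_mem_segment hx
    have hOO : ‖O' - O‖ ≤ K * ‖k‖ := by
      have := (convex_ball p₀ ε).norm_image_sub_le_of_norm_fderiv_le hdiff hDb hγ hγ'
      rw [hγγ] at this
      exact this.trans (by gcongr)
    -- flatness cancels the terms of first order in `k`
    have hg' : g s = -(O' (h + k) (w' s - z s)) + (-(s • D k k (w s))
        - (O' - O - D (s • k)) (h + k) (w s) + s • O k (O k (w s))
        + s • (O' - O) (h + k) (O k (w s))) := by
      have hf := flat _ hγ h k (w s)
      rw [← hO, ← hD] at hf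
      have hf2 : s • D h k (w s) = s • D k h (w s) - s • (O h (O k (w s)) - O k (O h (w s))) := by
        rw [← sub_eq_zero, ← smul_zero s, ← hf]; module
      simp only [hg, hz, ← hO, ← hO', ← hD]
      simp only [map_add, map_sub, map_smul, map_neg, add_apply, sub_apply, smul_apply, smul_add,
        hf2]
      module
    have hwC := hC s hs
    have hOK : ‖O‖ ≤ K := hb _ hγ
    have hOK' : ‖O'‖ ≤ K := hb _ hγ'
    have hDK : ‖D‖ ≤ K := hDb _ hγ
    have hhk1 : ‖h + k‖ ≤ 1 := hhk.le.trans hε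
    have b0 : ‖O' (h + k) (w' s - z s)‖ ≤ K * ‖w' s - z s‖ := by
      refine (O'.le_opNorm₂ _ _).trans ?_
      have : ‖O'‖ * ‖h + k‖ ≤ K * 1 := by gcongr
      rw [mul_one] at this
      gcongr
    have hOk : ‖O k (w s)‖ ≤ K * ‖k‖ * C := (O.le_opNorm₂ _ _).trans (by gcongr)
    have b1 : ‖s • D k k (w s)‖ ≤ K * ‖k‖ * ‖k‖ * C := by
      rw [norm_smul]
      refine (mul_le_of_le_one_left (norm_nonneg _) hs1).trans (((D k).le_opNorm₂ _ _).trans ?_)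
      have : ‖D k‖ ≤ K * ‖k‖ := (D.le_opNorm k).trans (by gcongr)
      gcongr
    have b2 : ‖(O' - O - D (s • k)) (h + k) (w s)‖ ≤ K * ‖k‖ * ‖k‖ * 1 * C :=
      ((O' - O - D (s • k)).le_opNorm₂ _ _).trans (by gcongr)
    have b3 : ‖s • O k (O k (w s))‖ ≤ K * ‖k‖ * (K * ‖k‖ * C) := by
      rw [norm_smul]
      refine (mul_le_of_le_one_left (norm_nonneg _) hs1).trans ((O.le_opNorm₂ _ _).trans ?_)
      gcongr
    have b4 : ‖s • (O' - O) (h + k) (O k (w s))‖ ≤ K * ‖k‖ * 1 * (K * ‖k‖ * C) := by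
      rw [norm_smul]
      refine (mul_le_of_le_one_left (norm_nonneg _) hs1).trans
        (((O' - O).le_opNorm₂ _ _).trans ?_)
      gcongr
    rw [hg']
    refine (norm_add_le _ _).trans (add_le_add (by rw [norm_neg]; exact b0) ?_)
    refine (norm_add_le _ _).trans ((add_le_add ((norm_add_le _ _).trans (add_le_add
      ((norm_sub_le _ _).trans (add_le_add ((norm_neg _).le.trans b1) b2)) b3)) b4).trans ?_)
    apply le_of_eq
    ring
  have hgron := norm_le_gronwallBound_of_norm_deriv_right_le (f := fun s => w' s - z s) (f' := g)
    (δ := 0) (K := K) (ε := (2 * K + 2 * K ^ 2) * C * ‖k‖ ^ 2) (a := 0) (b := 1)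
    (fun s hs => (hder s hs).continuousWithinAt)
    (fun s hs => (hder s (Ico_subset_Icc_self hs)).mono_of_mem_nhdsWithin
      (mem_of_superset (Icc_mem_nhdsGE hs.2) (Icc_subset_Icc_left hs.1)))
    (by simp [hz, hww']) (fun s hs => key s (Ico_subset_Icc_self hs)) 1 (by simp)
  rw [gronwallBound_of_K_ne_0 (by positivity)] at hgron
  simp only [sub_zero, mul_one] at hgron
  have e : w' 1 - z 1 = w' 1 - w 1 + θ (p₀ + h) k (w 1) := by
    simp only [hz, one_smul]; abel
  rw [← e]
  refine hgron.trans (le_of_eq ?_)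
  ring

/-- A flat smooth connection has, near every point, a smooth parallel section with any prescribed
value at that point. The section is obtained by transport along rays. -/
theorem exists_parallel_section [CompleteSpace E] {U : Set P} (hU : IsOpen U)
    {θ : P → P →L[ℝ] E →L[ℝ] E} (hθ : ContDiffOn ℝ ∞ θ U)
    (flat : ∀ p ∈ U, ∀ h k v, fderiv ℝ θ p h k v - fderiv ℝ θ p k h v
      + (θ p h (θ p k v) - θ p k (θ p h v)) = 0)
    {p₀ : P} (hp₀ : p₀ ∈ U) (v₀ : E) :
    ∃ ε > 0, ball p₀ ε ⊆ U ∧ ∃ v : P → E, v p₀ = v₀ ∧ ContDiffOn ℝ ∞ v (ball p₀ ε) ∧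
      ∀ p ∈ ball p₀ ε, HasFDerivAt v (-(θ p).flip (v p)) p := by
  obtain ⟨ε₁, hε₁, K, hK1, hsub₁, hb₁, hDb₁, hDl₁⟩ := exists_local_bounds hU hθ hp₀
  have hK0 : 0 < K := by linarith
  -- on rays of length below `1 / (2 K)` the transport exists up to time one
  set ε := min ε₁ (1 / (2 * K)) with hεdef
  have hε : 0 < ε := by positivity
  have hεK : K * ε ≤ 1 / 2 := by
    calc K * ε ≤ K * (1 / (2 * K)) := by gcongr; exact min_le_right _ _
      _ = 1 / 2 := by field_simp
  have hε1 : ε ≤ 1 := by nlinarith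
  have hball : ball p₀ ε ⊆ ball p₀ ε₁ := ball_subset_ball (min_le_left _ _)
  have hsub : ball p₀ ε ⊆ U := hball.trans hsub₁
  have hdiff : ∀ p ∈ ball p₀ ε, DifferentiableAt ℝ θ p := fun p hp =>
    (hθ.contDiffAt (hU.mem_nhds (hsub hp))).differentiableAt (by simp)
  have hmem : ∀ h : P, ‖h‖ < ε → ∀ s ∈ Icc (0 : ℝ) 1, p₀ + s • h ∈ ball p₀ ε := by
    intro u hu s hs
    rw [mem_ball_iff_norm, add_sub_cancel_left, norm_smul, Real.norm_of_nonneg hs.1]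
    exact (mul_le_of_le_one_left (norm_nonneg _) hs.2).trans_lt hu
  have hex : ∀ h : P, ∃ w : ℝ → E, ‖h‖ < ε → w 0 = v₀ ∧ ∀ s ∈ Icc (0 : ℝ) 1,
      HasDerivWithinAt w (-(θ (p₀ + s • h) h (w s))) (Icc 0 1) s := by
    intro h
    by_cases hh : ‖h‖ < ε
    · obtain ⟨w, hw⟩ := exists_radial_solution (θ := θ) (p₀ := p₀) (h := h) (K := K)
        (fun s hs => (hdiff _ (hmem h hh s hs)).continuousAt)
        (fun s hs => hb₁ _ (hball (hmem h hh s hs)))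
        ((mul_le_mul_of_nonneg_left hh.le hK0.le).trans hεK) v₀
      exact ⟨w, fun _ => hw⟩
    · exact ⟨0, fun h' => absurd h' hh⟩
  choose w hw using hex
  set C := gronwallBound ‖v₀‖ K 0 1 with hC
  have hwC : ∀ h : P, ‖h‖ < ε → ∀ s ∈ Icc (0 : ℝ) 1, ‖w h s‖ ≤ C := by
    intro h hh s hs
    have := norm_le_gronwallBound_of_norm_deriv_right_le (f := w h)
      (f' := fun s => -(θ (p₀ + s • h) h (w h s))) (δ := ‖v₀‖) (K := K) (ε := 0) (a := 0) (b := 1)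
      (fun s hs => ((hw h hh).2 s hs).continuousWithinAt)
      (fun s hs => ((hw h hh).2 s (Ico_subset_Icc_self hs)).mono_of_mem_nhdsWithin
        (mem_of_superset (Icc_mem_nhdsGE hs.2) (Icc_subset_Icc_left hs.1)))
      (by rw [(hw h hh).1]) (fun s hs => ?_) s hs
    · refine this.trans ?_
      exact gronwallBound_mono (norm_nonneg _) le_rfl hK0.le (by linarith [hs.2])
    · rw [norm_neg, add_zero]
      refine ((θ _).le_opNorm₂ _ _).trans ?_
      have h1 := hb₁ _ (hball (hmem h hh s (Ico_subset_Icc_self hs)))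
      have h2 : ‖θ (p₀ + s • h)‖ * ‖h‖ ≤ K * 1 := by
        gcongr
        exact hh.le.trans hε1
      rw [mul_one] at h2
      gcongr
  set v : P → E := fun p => w (p - p₀) 1 with hv
  have hder : ∀ p ∈ ball p₀ ε, HasFDerivAt v (-(θ p).flip (v p)) p := by
    intro p hp
    have hp' : ‖p - p₀‖ < ε := by rwa [mem_ball_iff_norm] at hp
    rw [hasFDerivAt_iff_isLittleO_nhds_zero]
    refine Asymptotics.IsBigO.trans_isLittleO (g := fun k : P => ‖k‖ ^ 2) ?_
      (Asymptotics.isLittleO_norm_pow_id one_lt_two)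
    refine Asymptotics.IsBigO.of_bound ((2 * K + 2 * K ^ 2) * C / K * (Real.exp K - 1)) ?_
    have hev : ∀ᶠ k : P in 𝓝 0, ‖p - p₀ + k‖ < ε := by
      have : ContinuousAt (fun k : P => ‖p - p₀ + k‖) 0 := by fun_prop
      exact this.eventually_lt continuousAt_const (by simpa using hp')
    filter_upwards [hev] with k hk
    have := norm_radial_sub_le hε1 hK1 hdiff (fun q hq => hb₁ q (hball hq))
      (fun q hq => hDb₁ q (hball hq)) (fun q hq q' hq' => hDl₁ q (hball hq) q' (hball hq'))
      (fun q hq => flat q (hsub hq)) hp' hk ((hw _ hp').1.trans (hw _ hk).1.symm) (hw _ hp').2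
      (hw _ hk).2 (hwC _ hp')
    rw [Real.norm_of_nonneg (by positivity)]
    refine le_trans (le_of_eq ?_) this
    congr 1
    simp only [hv, add_sub_cancel, neg_apply, ContinuousLinearMap.flip_apply]
    rw [show p + k - p₀ = p - p₀ + k by abel]
    abel
  refine ⟨ε, hε, hsub, v, ?_, ?_, hder⟩
  · simp only [hv, sub_self]
    have h0 : ‖(0 : P)‖ < ε := by simpa using hε
    obtain ⟨hw0, hw1⟩ := hw 0 h0
    have := constant_of_has_deriv_right_zero (f := w 0) (a := 0) (b := 1)
      (fun s hs => (hw1 s hs).continuousWithinAt) (fun s hs => by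
        have : HasDerivWithinAt (w 0) _ (Ici s) s :=
          (hw1 s (Ico_subset_Icc_self hs)).mono_of_mem_nhdsWithin
          (mem_of_superset (Icc_mem_nhdsGE hs.2) (Icc_subset_Icc_left hs.1))
        simpa using this)
    rw [this 1 (by simp), hw0]
  · -- the equation expresses the derivative of `v` by `v`, which gives one more derivative
    rw [contDiffOn_infty]
    intro m
    induction m with
    | zero =>
      rw [Nat.cast_zero, contDiffOn_zero]
      exact fun p hp => (hder p hp).continuousAt.continuousWithinAt
    | succ m ih =>
      rw [Nat.cast_succ, contDiffOn_succ_iff_fderiv_of_isOpen isOpen_ball]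
      refine ⟨fun p hp => (hder p hp).differentiableAt.differentiableWithinAt, by simp, ?_⟩
      refine ContDiffOn.congr ?_ (fun p hp => (hder p hp).fderiv)
      have h1 : ContDiffOn ℝ m (fun p => (θ p).flip) (ball p₀ ε) :=
        (ContinuousLinearMap.flipₗᵢ ℝ P E E).contDiff.comp_contDiffOn
          ((hθ.mono hsub).of_le (by exact_mod_cast le_top))
      exact (h1.clm_apply ih).neg

end Frobenius

/-! ### Gauge factors with two simple poles -/

section Gauge
variable {K R : Type*} [CommRing K] [Ring R] [Algebra K R]

/-- The rational gauge factor `1 - c g₂ π + c g₁ σ`, where `gᵢ` stands for `1 / (λ - αᵢ)`. -/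
def darboux (c g₁ g₂ : K) (π σ : R) : R := 1 - (c * g₂) • π + (c * g₁) • σ

/-- The polynomial part of the conjugate of `B(λ)` by the gauge factor, where `Dᵢ` stands for the
divided difference `(B(λ) - B(αᵢ)) / (λ - αᵢ)`. -/
def dressed (c : K) (π σ B D₁ D₂ : R) : R :=
  B - c • (π * D₂) + c • (σ * D₁) - c • (D₂ * σ) + c • (D₁ * π) - c • (π * (D₁ - D₂) * π)
    - c • (σ * (D₁ - D₂) * σ)

lemma darboux_sub_one (c g₁ g₂ : K) (π σ : R) :
    darboux c g₁ g₂ π σ - 1 = c • (g₁ • σ) - c • (g₂ • π) := by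
  rw [darboux, mul_smul, mul_smul]
  abel

lemma dressed_self (c : K) (π σ B D : R) : dressed c π σ B D D
    = B - c • (π * D) + c • (σ * D) - c • (D * σ) + c • (D * π) := by
  simp only [dressed, sub_self, mul_zero, zero_mul, smul_zero, sub_zero]

lemma mul_mul_sub {S : Type*} [Ring S] (a b t : S) :
    a * t * b - t = (a - 1) * t * (b - 1) + (a - 1) * t + t * (b - 1) := by
  noncomm_ring

/-- Two orthogonal idempotents. -/
structure IsOrthogonalPair (π σ : R) : Prop where
  left : π * π = π
  right : σ * σ = σ
  left_right : π * σ = 0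
  right_left : σ * π = 0

lemma IsOrthogonalPair.symm {π σ : R} (h : IsOrthogonalPair π σ) : IsOrthogonalPair σ π :=
  ⟨h.right, h.left, h.right_left, h.left_right⟩

/-- The hypothesis on `g₁` and `g₂` is the partial fraction identity for
`1 / (λ - α₁) - 1 / (λ - α₂)` with `c = α₁ - α₂`. -/
lemma darboux_mul {c g₁ g₂ : K} (hg : g₁ - g₂ = c * g₁ * g₂) {π σ : R} (h : IsOrthogonalPair π σ) :
    darboux c g₁ g₂ π σ * darboux c g₁ g₂ σ π = 1 := by
  simp only [darboux, mul_add, add_mul, mul_sub, sub_mul, smul_mul_assoc, mul_smul_comm, one_mul,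
    mul_one, h.left, h.right, h.left_right, h.right_left, smul_zero]
  match_scalars
  · ring
  · linear_combination c * hg
  · linear_combination c * hg

/-- The two double poles of the conjugate cancel because `π W σ = σ W π = 0`. -/
lemma darboux_conj {c g₁ g₂ : K} (hg : g₁ - g₂ = c * g₁ * g₂) {π σ W : R}
    (h1 : π * W * σ = 0) (h2 : σ * W * π = 0) :
    darboux c g₁ g₂ π σ * W * darboux c g₁ g₂ σ π = dressed c π σ W (g₁ • W) (g₂ • W) := by
  simp only [darboux, dressed, mul_add, add_mul, mul_sub, sub_mul, smul_mul_assoc, mul_smul_comm,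
    one_mul, mul_one, h1, h2, smul_zero]
  match_scalars <;> first | ring1 | linear_combination c * hg

/-- The gauge factor intertwines `B` with its transform as soon as its residues satisfy the Riccati
equations on the left-hand side. -/
lemma darboux_deriv {c g₁ g₂ : K} (hg : g₁ - g₂ = c * g₁ * g₂) {π σ B B₁ B₂ : R}
    (h : IsOrthogonalPair π σ) (h0 : π * B * σ = 0) (h2 : π * B₂ * σ = 0)
    (h0' : σ * B * π = 0) (h1' : σ * B₁ * π = 0) :
    -((c * g₂) • (π * B₂ - B₁ * π + π * (B₁ - B₂) * π))
      + (c * g₁) • (σ * B₁ - B₂ * σ - σ * (B₁ - B₂) * σ)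
    = darboux c g₁ g₂ π σ * B
      - dressed c π σ B (g₁ • (B - B₁)) (g₂ • (B - B₂)) * darboux c g₁ g₂ π σ := by
  rw [mul_assoc] at h0 h2 h0' h1'
  simp only [darboux, dressed, mul_add, add_mul, mul_sub, sub_mul, smul_mul_assoc, mul_smul_comm,
    one_mul, mul_one, h0, h2, h0', h1', mul_assoc, h.left, h.right,
    h.left_right, h.right_left, mul_zero]
  match_scalars <;> first | ring1 | linear_combination c * hg | linear_combination -c * hg

/-- At the pole `α₂` the transform enters the equation of `π` only through `B(α₁)` and `B(α₂)`, so
that this equation is of Riccati type. -/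
lemma dressed_mul {c : K} {π σ B₁ B₂ D₁ D₂ : R} (h : IsOrthogonalPair π σ)
    (h1 : σ * B₁ * π = 0) (h2 : σ * B₂ * π = 0) (hD : c • D₁ = B₁ - B₂) :
    dressed c π σ B₂ D₁ D₂ * π = B₁ * π - π * (B₁ - B₂) * π := by
  have h3 : c • (σ * (D₁ * π)) = 0 := by
    rw [← mul_smul_comm, ← smul_mul_assoc, hD, sub_mul, mul_sub, ← mul_assoc, ← mul_assoc, h1, h2,
      sub_zero]
  have h4 : c • (D₁ * π) = B₁ * π - B₂ * π := by rw [← smul_mul_assoc, hD, sub_mul]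
  have h5 : c • (π * (D₁ * π)) = π * (B₁ * π) - π * (B₂ * π) := by
    rw [← mul_smul_comm, h4, mul_sub]
  simp only [dressed, add_mul, mul_sub, sub_mul, smul_mul_assoc, smul_sub,
    mul_zero, smul_zero, mul_assoc, h.left, h.right_left, h3, h4, h5]
  abel
end Gauge

/-! ### Matrix identities in the orthogonal Lie algebra -/

section MatrixFacts
open Matrix
variable {n : ℕ}

lemma val_rev (i : Fin (2 * n + 1)) : (i.rev : ℕ) = 2 * n - i := by
  rw [Fin.val_rev]; omega

lemma rho_apply_ne {i k : Fin (2 * n + 1)} (h : k ≠ i.rev) : rho n i k = 0 := by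
  have : (i : ℕ) + k ≠ 2 * n := fun h' => h (Fin.ext (by rw [val_rev]; omega))
  simp [rho, this]

lemma rho_apply_rev (i : Fin (2 * n + 1)) : rho n i i.rev = (-1) ^ (n + (i : ℕ)) := by
  have : (i : ℕ) + i.rev = 2 * n := by rw [val_rev]; omega
  rw [rho, of_apply, if_pos this]

lemma neg_one_pow_congr {a b : ℕ} (h : a % 2 = b % 2) : (-1 : ℝ) ^ a = (-1) ^ b := by
  rw [neg_one_pow_eq_pow_mod_two a, h, ← neg_one_pow_eq_pow_mod_two]

lemma sharp_apply (A : Mat n) (i k : Fin (2 * n + 1)) :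
    sharp A i k = (-1) ^ ((i : ℕ) + k) * A k.rev i.rev := by
  have hk : rho n k.rev k = (-1) ^ (n + (k.rev : ℕ)) := by
    have := rho_apply_rev k.rev
    rwa [Fin.rev_rev] at this
  rw [sharp, mul_apply, Finset.sum_eq_single k.rev, mul_apply, Finset.sum_eq_single i.rev,
    rho_apply_rev, hk, transpose_apply]
  · have : ((-1 : ℝ)) ^ (n + (i : ℕ)) * (-1) ^ (n + (k.rev : ℕ)) = (-1) ^ ((i : ℕ) + k) := by
      rw [← pow_add, val_rev]
      have := k.2
      exact neg_one_pow_congr (by omega)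
    rw [← this]; ring
  · intro l _ hl
    rw [rho_apply_ne hl, zero_mul]
  · simp
  · intro l _ hl
    rw [rho_apply_ne fun h => hl (by rw [h, Fin.rev_rev]), mul_zero]
  · simp

lemma rho_mul_rho : rho n * rho n = 1 := by
  ext i k
  have h := sharp_apply (1 : Mat n) i k
  rw [sharp, transpose_one, mul_one] at h
  rw [h]
  by_cases hik : i = k
  · subst hik; simp [← two_mul]
  · rw [one_apply_ne hik, one_apply_ne fun h => hik (Fin.rev_injective h.symm), mul_zero]

lemma rho_transpose : (rho n)ᵀ = rho n := by
  ext i k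
  simp only [transpose_apply, rho, of_apply, add_comm (k : ℕ)]
  split_ifs with h
  · exact neg_one_pow_congr (by omega)
  · rfl

lemma sharp_one : sharp (1 : Mat n) = 1 := by
  rw [sharp, transpose_one, mul_one, rho_mul_rho]

lemma sharp_zero : sharp (0 : Mat n) = 0 := by simp [sharp]

lemma sharp_add (A B : Mat n) : sharp (A + B) = sharp A + sharp B := by
  simp [sharp, mul_add, add_mul]

lemma sharp_neg (A : Mat n) : sharp (-A) = -sharp A := by simp [sharp]

lemma sharp_sub (A B : Mat n) : sharp (A - B) = sharp A - sharp B := by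
  rw [sub_eq_add_neg, sharp_add, sharp_neg, ← sub_eq_add_neg]

lemma sharp_smul (r : ℝ) (A : Mat n) : sharp (r • A) = r • sharp A := by simp [sharp]

lemma sharp_mul (A B : Mat n) : sharp (A * B) = sharp B * sharp A := by
  calc sharp (A * B) = rho n * Bᵀ * 1 * Aᵀ * rho n := by rw [sharp, transpose_mul]; noncomm_ring
    _ = sharp B * sharp A := by rw [← rho_mul_rho, sharp, sharp]; noncomm_ring

lemma sharp_sharp (A : Mat n) : sharp (sharp A) = A := by
  calc sharp (sharp A) = rho n * rho n * A * (rho n * rho n) := by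
        simp only [sharp, transpose_mul, transpose_transpose, rho_transpose]; noncomm_ring
    _ = A := by rw [rho_mul_rho, one_mul, mul_one]

lemma sharp_sum {ι : Type*} (s : Finset ι) (f : ι → Mat n) :
    sharp (∑ i ∈ s, f i) = ∑ i ∈ s, sharp (f i) :=
  map_sum (⟨⟨sharp, sharp_zero⟩, sharp_add⟩ : Mat n →+ Mat n) f s

lemma mem_o_iff (A : Mat n) : Aᵀ * rho n + rho n * A = 0 ↔ sharp A = -A := by
  constructor
  · intro h
    calc sharp A = rho n * (Aᵀ * rho n + rho n * A) - (rho n * rho n) * A := by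
          rw [sharp]; noncomm_ring
      _ = -A := by rw [h, rho_mul_rho]; simp
  · intro h
    calc Aᵀ * rho n + rho n * A = (rho n * rho n) * Aᵀ * rho n + rho n * A := by
          rw [rho_mul_rho, one_mul]
      _ = rho n * (sharp A + A) := by rw [sharp]; noncomm_ring
      _ = 0 := by rw [h]; simp

lemma sharp_beta : sharp (beta n) = -beta n := by
  ext i k
  rw [sharp_apply, neg_apply, beta, of_apply, of_apply, val_rev, val_rev]
  have hi := i.2
  have hk := k.2
  by_cases h1 : ((i : ℕ) = 0 ∧ (k : ℕ) + 1 = 2 * n) ∨ ((i : ℕ) = 1 ∧ (k : ℕ) = 2 * n)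
  · have ho : Odd ((i : ℕ) + k) := by rw [Nat.odd_iff]; omega
    rw [if_pos h1, if_pos (by omega), ho.neg_one_pow, neg_one_mul]
  · rw [if_neg h1, if_neg (by omega), mul_zero, neg_zero]

lemma sharp_bmat : sharp (bmat n) = -bmat n := by
  ext i k
  rw [sharp_apply, neg_apply, bmat, of_apply, of_apply, val_rev, val_rev]
  have hi := i.2
  have hk := k.2
  by_cases h1 : (i : ℕ) = k + 1
  · have ho : Odd ((i : ℕ) + k) := by rw [Nat.odd_iff]; omega
    rw [if_pos h1, if_pos (by omega), ho.neg_one_pow, neg_one_mul]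
  · rw [if_neg h1, if_neg (by omega), mul_zero, neg_zero]

lemma sharp_lie {A B : Mat n} (hA : sharp A = -A) (hB : sharp B = -B) :
    sharp ⁅A, B⁆ = -⁅A, B⁆ := by
  rw [Ring.lie_def, sharp_sub, sharp_mul, sharp_mul, hA, hB]; noncomm_ring

lemma exists_vecMulVec_of_rank_one {π : Mat n} (h : π.rank = 1) :
    ∃ v w : Fin (2 * n + 1) → ℝ, π = vecMulVec v w := by
  rw [rank_eq_finrank_range_toLin π (Pi.basisFun ℝ _) (Pi.basisFun ℝ _), finrank_eq_one_iff'] at h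
  obtain ⟨⟨v, hv⟩, -, hspan⟩ := h
  have hcol : ∀ k, ∃ c : ℝ, ∀ i, π i k = c * v i := by
    intro k
    obtain ⟨c, hc⟩ := hspan ⟨π *ᵥ Pi.single k 1, ⟨Pi.single k 1, by
      rw [← toLin'_apply, toLin_eq_toLin']⟩⟩
    refine ⟨c, fun i => ?_⟩
    have := congrFun (congrArg Subtype.val hc) i
    simpa using this.symm
  choose w hw using hcol
  exact ⟨v, w, by ext i k; rw [hw, vecMulVec_apply, mul_comm]⟩

lemma dotProduct_mulVec_self_of_skew {Y : Mat n} (hY : Yᵀ = -Y) (w : Fin (2 * n + 1) → ℝ) :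
    w ⬝ᵥ (Y *ᵥ w) = 0 := by
  have h : w ⬝ᵥ (Y *ᵥ w) = -(w ⬝ᵥ (Y *ᵥ w)) := by
    conv_lhs => rw [dotProduct_mulVec, ← mulVec_transpose, hY, neg_mulVec, neg_dotProduct,
      dotProduct_comm]
  linarith

/-- For `π = v wᵗ` the product is a multiple of the value at `(w, w)` of the alternating form with
matrix `X ρ`. -/
lemma mul_mul_sharp_eq_zero {π X : Mat n} (h : π.rank = 1) (hX : sharp X = -X) :
    π * X * sharp π = 0 := by
  obtain ⟨v, w, rfl⟩ := exists_vecMulVec_of_rank_one h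
  have hY : (X * rho n)ᵀ = -(X * rho n) := by
    calc (X * rho n)ᵀ = rho n * Xᵀ * (rho n * rho n) := by
          rw [transpose_mul, rho_transpose, rho_mul_rho, mul_one]
      _ = sharp X * rho n := by rw [sharp]; noncomm_ring
      _ = _ := by rw [hX, neg_mul]
  have hz : vecMulVec v w * (X * rho n) * vecMulVec w v = 0 := by
    rw [mul_assoc, mul_vecMulVec, vecMulVec_mul_vecMulVec, dotProduct_mulVec_self_of_skew hY]
    simp
  calc vecMulVec v w * X * sharp (vecMulVec v w)
      = vecMulVec v w * (X * rho n) * vecMulVec w v * rho n := by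
        rw [sharp, transpose_vecMulVec]; noncomm_ring
    _ = 0 := by rw [hz, zero_mul]

lemma rank_sharp (π : Mat n) : (sharp π).rank = π.rank := by
  have hu : IsUnit (rho n).det := by
    rw [← isUnit_iff_isUnit_det]
    exact ⟨⟨rho n, rho n, rho_mul_rho, rho_mul_rho⟩, rfl⟩
  rw [sharp, rank_mul_eq_left_of_isUnit_det _ _ hu, rank_mul_eq_right_of_isUnit_det _ _ hu,
    rank_transpose]

lemma sharp_mul_mul_eq_zero {π X : Mat n} (h : π.rank = 1) (hX : sharp X = -X) :
    sharp π * X * π = 0 := by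
  have := mul_mul_sharp_eq_zero ((rank_sharp π).trans h) hX
  rwa [sharp_sharp] at this

lemma isOrthogonalPair_sharp {π : Mat n} (h : π ∈ isoProj n) : IsOrthogonalPair π (sharp π) :=
  ⟨h.1, by rw [← sharp_mul, h.1], h.2.2.1, h.2.2.2⟩

lemma sharp_eq_neg_of_mem_borel {q : Mat n} (h : q ∈ borel n) : sharp q = -q :=
  (mem_o_iff q).1 h.1

/-- The new potential is again upper triangular: the only entries of `[β, X]` below the diagonal
involve the lower left entry of `X = π - π♯`, which vanishes by skewness. -/
lemma add_smul_lie_beta_mem_borel {q X : Mat n} (hq : q ∈ borel n) (hX : sharp X = -X) (c : ℝ) :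
    q + c • ⁅beta n, X⁆ ∈ borel n := by
  refine ⟨(mem_o_iff _).2 ?_, fun i k hik => ?_⟩
  · rw [sharp_add, sharp_smul, sharp_eq_neg_of_mem_borel hq, sharp_lie sharp_beta hX, smul_neg,
      neg_add]
  · have h0 : ∀ a c : Fin (2 * n + 1), (a : ℕ) = 2 * n → (c : ℕ) = 0 → X a c = 0 := by
      intro a c ha hc
      have := congrFun (congrFun hX a) c
      rw [sharp_apply, neg_apply, show c.rev = a from Fin.ext (by rw [val_rev]; omega),
        show a.rev = c from Fin.ext (by rw [val_rev]; omega), ha, hc] at this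
      simp at this
      linarith
    have hik' : (k : ℕ) < i := hik
    rw [Matrix.add_apply, hq.2 i k hik, Matrix.smul_apply, Ring.lie_def, Matrix.sub_apply,
      mul_apply, mul_apply, Finset.sum_eq_zero, Finset.sum_eq_zero]
    · simp
    · intro l _
      by_cases hl : ((l : ℕ) = 0 ∧ (k : ℕ) + 1 = 2 * n)
      · rw [h0 i l (by omega) hl.1, zero_mul]
      · have : beta n l k = 0 := by rw [beta, of_apply, if_neg (by omega)]
        rw [this, mul_zero]
    · intro l _
      by_cases hl : ((i : ℕ) = 1 ∧ (l : ℕ) = 2 * n)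
      · rw [h0 l k hl.2 (by omega), mul_zero]
      · have : beta n i l = 0 := by rw [beta, of_apply, if_neg (by omega)]
        rw [this, zero_mul]

end MatrixFacts

/-! ### Coefficients of formal series -/

section LoopCoefficients
variable {n : ℕ}

lemma loop_ext {X Y : Loop n} (h : ∀ i, lcoeff i X = lcoeff i Y) : X = Y := by
  ext1
  funext i
  simpa [lcoeff] using h (-i)

@[simp] lemma lcoeff_zero (i : ℤ) : lcoeff i (0 : Loop n) = 0 := rfl

@[simp] lemma lcoeff_add (i : ℤ) (X Y : Loop n) : lcoeff i (X + Y) = lcoeff i X + lcoeff i Y := rfl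

@[simp] lemma lcoeff_sub (i : ℤ) (X Y : Loop n) : lcoeff i (X - Y) = lcoeff i X - lcoeff i Y := by
  simp [lcoeff]

@[simp] lemma lcoeff_neg (i : ℤ) (X : Loop n) : lcoeff i (-X) = -lcoeff i X := rfl

@[simp] lemma lcoeff_smul (i : ℤ) (r : ℝ) (X : Loop n) : lcoeff i (r • X) = r • lcoeff i X := rfl

lemma lcoeff_monomial (i m : ℤ) (A : Mat n) :
    lcoeff i (monomial m A) = if i = m then A else 0 := by
  simp [lcoeff, monomial, HahnSeries.coeff_single]

lemma lcoeff_monomial_mul (i m : ℤ) (A : Mat n) (X : Loop n) :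
    lcoeff i (monomial m A * X) = A * lcoeff (i - m) X := by
  rw [lcoeff, monomial, HahnSeries.coeff_single_mul, lcoeff]
  congr 2; ring

lemma lcoeff_mul_monomial (i m : ℤ) (A : Mat n) (X : Loop n) :
    lcoeff i (X * monomial m A) = lcoeff (i - m) X * A := by
  rw [lcoeff, monomial, HahnSeries.coeff_mul_single, lcoeff]
  congr 2; ring

lemma monomial_add (i : ℤ) (A B : Mat n) : monomial i (A + B) = monomial i A + monomial i B := by
  simp [monomial]

lemma monomial_sub (i : ℤ) (A B : Mat n) : monomial i (A - B) = monomial i A - monomial i B := by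
  simp [monomial]

lemma monomial_zero_one : monomial 0 (1 : Mat n) = 1 := rfl

lemma monomial_mul_monomial (i m : ℤ) (A B : Mat n) :
    monomial i A * monomial m B = monomial (i + m) (A * B) := by
  rw [monomial, monomial, monomial, HahnSeries.single_mul_single, neg_add]

/-- The series whose coefficient of `λ^i` is `f i`. -/
def mkLoop (f : ℤ → Mat n) (N : ℤ) (h : ∀ i, N < i → f i = 0) : Loop n :=
  HahnSeries.ofSuppBddBelow (fun i => f (-i)) ⟨-N, fun i hi => by
    by_contra! hc
    exact hi (h (-i) (by omega))⟩

@[simp] lemma lcoeff_mkLoop (f : ℤ → Mat n) (N : ℤ) (h : ∀ i, N < i → f i = 0) (i : ℤ) :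
    lcoeff i (mkLoop f N h) = f i := by
  change f (- -i) = f i
  rw [neg_neg]

/-- The order in `λ` is at most `N`. -/
def HasDegreeLE (N : ℤ) (X : Loop n) : Prop := ∀ i, N < i → lcoeff i X = 0

lemma lcoeff_mul {a b : ℤ} {X Y : Loop n} (hX : HasDegreeLE a X) (hY : HasDegreeLE b Y) (i : ℤ) :
    lcoeff i (X * Y) = ∑ k ∈ Finset.Icc (i - b) a, lcoeff k X * lcoeff (i - k) Y := by
  rw [lcoeff, HahnSeries.coeff_mul]
  refine Finset.sum_of_injOn (fun ij => -ij.1) ?_ ?_ ?_ ?_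
  · rintro ⟨u, v⟩ h ⟨u', v'⟩ h' e
    simp only [Finset.mem_coe, Finset.mem_antidiagonal] at h h'
    simp only [neg_inj] at e
    ext <;> simp only <;> omega
  · rintro ⟨u, v⟩ h
    simp only [Finset.mem_coe, Finset.mem_antidiagonal, HahnSeries.mem_support] at h
    simp only [Finset.coe_Icc, Set.mem_Icc]
    constructor
    · by_contra! hc
      exact h.2.1 (by simpa [lcoeff] using hY (-v) (by omega))
    · by_contra! hc
      exact h.1 (by simpa [lcoeff] using hX (-u) (by omega))
  · intro k _ hk
    by_contra hne
    refine hk ⟨(-k, -(i - k)), ?_, by simp⟩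
    simp only [Finset.mem_coe, Finset.mem_antidiagonal, HahnSeries.mem_support]
    exact ⟨fun h => hne (by rw [lcoeff, h, zero_mul]), fun h => hne (by
      rw [lcoeff, lcoeff, h, mul_zero]), by ring⟩
  · rintro ⟨u, v⟩ h
    simp only [Finset.mem_antidiagonal] at h
    simp only [lcoeff, neg_neg]
    rw [show -(i - -u) = v by omega]

lemma HasDegreeLE.mul {a b : ℤ} {X Y : Loop n} (hX : HasDegreeLE a X) (hY : HasDegreeLE b Y) :
    HasDegreeLE (a + b) (X * Y) := by
  intro i hi
  rw [lcoeff_mul hX hY, Finset.Icc_eq_empty (by omega), Finset.sum_empty]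

lemma HasDegreeLE.mono {a b : ℤ} {X : Loop n} (hX : HasDegreeLE a X) (h : a ≤ b) :
    HasDegreeLE b X := fun i hi => hX i (by omega)

lemma hasDegreeLE_monomial (i : ℤ) (A : Mat n) : HasDegreeLE i (monomial i A) := by
  intro m hm
  rw [lcoeff_monomial, if_neg (by omega)]

lemma HasDegreeLE.pow {a : ℤ} {X : Loop n} (hX : HasDegreeLE a X) (k : ℕ) :
    HasDegreeLE (k * a) (X ^ k) := by
  induction k with
  | zero =>
    rw [pow_zero, Nat.cast_zero, zero_mul]
    exact hasDegreeLE_monomial 0 (1 : Mat n)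
  | succ k ih =>
    rw [pow_succ]
    exact (ih.mul hX).mono (by push_cast; ring_nf; rfl)

end LoopCoefficients

/-! ### Calculus of matrix valued functions -/

section SmoothCalculus
variable {n : ℕ} {U V : Set (ℝ × ℝ)} {f g : ℝ × ℝ → Mat n}

lemma SmoothOn.mono (hf : SmoothOn U f) (h : V ⊆ U) : SmoothOn V f :=
  fun i k => (hf i k).mono h

lemma SmoothOn.congr (hf : SmoothOn U f) (h : ∀ p ∈ U, g p = f p) : SmoothOn U g :=
  fun i k => (hf i k).congr fun p hp => by rw [h p hp]

lemma SmoothOn.add (hf : SmoothOn U f) (hg : SmoothOn U g) : SmoothOn U (fun p => f p + g p) :=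
  fun i k => (hf i k).add (hg i k)

lemma SmoothOn.sub (hf : SmoothOn U f) (hg : SmoothOn U g) : SmoothOn U (fun p => f p - g p) :=
  fun i k => (hf i k).sub (hg i k)

lemma smoothOn_const (A : Mat n) : SmoothOn U (fun _ => A) := fun _ _ => contDiffOn_const

lemma SmoothOn.smul (hf : SmoothOn U f) (r : ℝ) : SmoothOn U (fun p => r • f p) :=
  fun i k => contDiffOn_const.mul (hf i k)

lemma SmoothOn.mul (hf : SmoothOn U f) (hg : SmoothOn U g) : SmoothOn U (fun p => f p * g p) := by
  intro i k
  simp only [Matrix.mul_apply]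
  exact ContDiffOn.sum fun l _ => (hf i l).mul (hg l k)

lemma SmoothOn.sum {ι : Type*} {s : Finset ι} {f : ι → ℝ × ℝ → Mat n}
    (hf : ∀ a ∈ s, SmoothOn U (f a)) : SmoothOn U (fun p => ∑ a ∈ s, f a p) := by
  intro i k
  simp only [Matrix.sum_apply]
  exact ContDiffOn.sum fun a ha => hf a ha i k

lemma SmoothOn.sharp (hf : SmoothOn U f) : SmoothOn U (fun p => sharp (f p)) := by
  intro i k
  simp only [sharp_apply]
  exact contDiffOn_const.mul (hf _ _)

/-- The derivative of a matrix valued function in the direction `e`, entry by entry. -/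
def dirDeriv (e : ℝ × ℝ) (f : ℝ × ℝ → Mat n) (p : ℝ × ℝ) : Mat n :=
  Matrix.of fun i k => fderiv ℝ (fun p => f p i k) p e

lemma SmoothOn.differentiableAt (hf : SmoothOn U f) (hU : IsOpen U) {p : ℝ × ℝ} (hp : p ∈ U)
    (i k : Fin (2 * n + 1)) : DifferentiableAt ℝ (fun p => f p i k) p :=
  ((hf i k).contDiffAt (hU.mem_nhds hp)).differentiableAt (by simp)

lemma dx_eq_dirDeriv (hf : SmoothOn U f) (hU : IsOpen U) {p : ℝ × ℝ} (hp : p ∈ U) :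
    dx f p = dirDeriv (1, 0) f p := by
  ext i k
  have h1 : HasDerivAt (fun s : ℝ => (s, p.2)) ((1 : ℝ), (0 : ℝ)) p.1 :=
    (hasDerivAt_id p.1).prodMk (hasDerivAt_const p.1 p.2)
  exact ((hf.differentiableAt hU hp i k).hasFDerivAt.comp_hasDerivAt p.1 h1).deriv

lemma dt_eq_dirDeriv (hf : SmoothOn U f) (hU : IsOpen U) {p : ℝ × ℝ} (hp : p ∈ U) :
    dt f p = dirDeriv (0, 1) f p := by
  ext i k
  have h1 : HasDerivAt (fun s : ℝ => (p.1, s)) ((0 : ℝ), (1 : ℝ)) p.2 :=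
    (hasDerivAt_const p.2 p.1).prodMk (hasDerivAt_id p.2)
  exact ((hf.differentiableAt hU hp i k).hasFDerivAt.comp_hasDerivAt p.2 h1).deriv

lemma smoothOn_dirDeriv (e : ℝ × ℝ) (hf : SmoothOn U f) (hU : IsOpen U) :
    SmoothOn U (dirDeriv e f) := fun i k =>
  (((contDiffOn_infty_iff_fderiv_of_isOpen hU).1 (hf i k)).2).clm_apply contDiffOn_const

lemma dirDeriv_congr (e : ℝ × ℝ) (hU : IsOpen U) (h : ∀ p ∈ U, f p = g p) {p : ℝ × ℝ}
    (hp : p ∈ U) : dirDeriv e f p = dirDeriv e g p := by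
  ext i k
  have : (fun p => f p i k) =ᶠ[nhds p] fun p => g p i k := by
    filter_upwards [hU.mem_nhds hp] with p' hp'
    rw [h p' hp']
  simp only [dirDeriv, Matrix.of_apply, this.fderiv_eq]

lemma dirDeriv_const (e : ℝ × ℝ) (A : Mat n) (p : ℝ × ℝ) : dirDeriv e (fun _ => A) p = 0 := by
  ext i k
  simp [dirDeriv]

lemma dirDeriv_add (e : ℝ × ℝ) (hf : SmoothOn U f) (hg : SmoothOn U g) (hU : IsOpen U)
    {p : ℝ × ℝ} (hp : p ∈ U) :
    dirDeriv e (fun p => f p + g p) p = dirDeriv e f p + dirDeriv e g p := by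
  ext i k
  simp only [dirDeriv, Matrix.of_apply, Matrix.add_apply]
  rw [fderiv_fun_add (hf.differentiableAt hU hp i k) (hg.differentiableAt hU hp i k)]
  rfl

lemma dirDeriv_smul (e : ℝ × ℝ) (r : ℝ) (hf : SmoothOn U f) (hU : IsOpen U)
    {p : ℝ × ℝ} (hp : p ∈ U) : dirDeriv e (fun p => r • f p) p = r • dirDeriv e f p := by
  ext i k
  simp only [dirDeriv, Matrix.of_apply, Matrix.smul_apply]
  rw [fderiv_fun_const_smul (hf.differentiableAt hU hp i k)]
  rfl

lemma dirDeriv_sub (e : ℝ × ℝ) (hf : SmoothOn U f) (hg : SmoothOn U g) (hU : IsOpen U)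
    {p : ℝ × ℝ} (hp : p ∈ U) :
    dirDeriv e (fun p => f p - g p) p = dirDeriv e f p - dirDeriv e g p := by
  ext i k
  simp only [dirDeriv, Matrix.of_apply, Matrix.sub_apply]
  rw [fderiv_fun_sub (hf.differentiableAt hU hp i k) (hg.differentiableAt hU hp i k)]
  rfl

lemma dirDeriv_sum (e : ℝ × ℝ) {ι : Type*} {s : Finset ι} {f : ι → ℝ × ℝ → Mat n}
    (hf : ∀ a ∈ s, SmoothOn U (f a)) (hU : IsOpen U) {p : ℝ × ℝ} (hp : p ∈ U) :
    dirDeriv e (fun p => ∑ a ∈ s, f a p) p = ∑ a ∈ s, dirDeriv e (f a) p := by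
  ext i k
  simp only [dirDeriv, Matrix.of_apply, Matrix.sum_apply]
  rw [fderiv_fun_sum fun a ha => (hf a ha).differentiableAt hU hp i k, sum_apply]

lemma dirDeriv_mul (e : ℝ × ℝ) (hf : SmoothOn U f) (hg : SmoothOn U g) (hU : IsOpen U)
    {p : ℝ × ℝ} (hp : p ∈ U) :
    dirDeriv e (fun p => f p * g p) p = dirDeriv e f p * g p + f p * dirDeriv e g p := by
  ext i k
  simp only [dirDeriv, Matrix.of_apply, Matrix.mul_apply, Matrix.add_apply]
  rw [fderiv_fun_sum fun l _ => DifferentiableAt.fun_mul (hf.differentiableAt hU hp i l)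
    (hg.differentiableAt hU hp l k), sum_apply, ← Finset.sum_add_distrib]
  refine Finset.sum_congr rfl fun l _ => ?_
  rw [fderiv_fun_mul (hf.differentiableAt hU hp i l) (hg.differentiableAt hU hp l k)]
  simp only [add_apply, smul_apply, smul_eq_mul]
  ring

lemma dirDeriv_sharp (e : ℝ × ℝ) (hf : SmoothOn U f) (hU : IsOpen U) {p : ℝ × ℝ} (hp : p ∈ U) :
    dirDeriv e (fun p => sharp (f p)) p = sharp (dirDeriv e f p) := by
  ext i k
  simp only [dirDeriv, Matrix.of_apply, sharp_apply]
  rw [fderiv_const_mul (hf.differentiableAt hU hp _ _)]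
  rfl

lemma dirDeriv_comm (e e' : ℝ × ℝ) (hf : SmoothOn U f) (hU : IsOpen U) {p : ℝ × ℝ} (hp : p ∈ U) :
    dirDeriv e (dirDeriv e' f) p = dirDeriv e' (dirDeriv e f) p := by
  ext i k
  have hat : ContDiffAt ℝ ∞ (fun p => f p i k) p := (hf i k).contDiffAt (hU.mem_nhds hp)
  have hsymm : IsSymmSndFDerivAt ℝ (fun p => f p i k) p :=
    hat.isSymmSndFDerivAt (by
    rw [minSmoothness_of_isRCLikeNormedField]
    exact WithTop.coe_le_coe.2 (le_top : (2 : ℕ∞) ≤ ⊤))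
  have hd : DifferentiableAt ℝ (fderiv ℝ (fun p => f p i k)) p :=
    (((contDiffOn_infty_iff_fderiv_of_isOpen hU).1 (hf i k)).2.contDiffAt
      (hU.mem_nhds hp)).differentiableAt (by simp)
  simp only [dirDeriv, Matrix.of_apply]
  rw [fderiv_clm_apply hd (differentiableAt_const _),
    fderiv_clm_apply hd (differentiableAt_const _)]
  simpa using hsymm e e'

end SmoothCalculus

/-! ### The ring of formal series with smooth coefficients -/

section SmoothLoops
variable {n : ℕ} {U : Set (ℝ × ℝ)}

open Classical in
/-- The coefficient of `λ^i` of a family of series on `U`, extended by zero. -/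
def famCoeff (i : ℤ) (X : U → Loop n) (p : ℝ × ℝ) : Mat n :=
  if h : p ∈ U then lcoeff i (X ⟨p, h⟩) else 0

lemma famCoeff_of_mem (i : ℤ) (X : U → Loop n) {p : ℝ × ℝ} (h : p ∈ U) :
    famCoeff i X p = lcoeff i (X ⟨p, h⟩) := dif_pos h

lemma famCoeff_mul {a b : ℤ} {X Y : U → Loop n} (hX : ∀ p, HasDegreeLE a (X p))
    (hY : ∀ p, HasDegreeLE b (Y p)) (i : ℤ) :
    famCoeff i (X * Y) = fun p => ∑ k ∈ Finset.Icc (i - b) a,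
      famCoeff k X p * famCoeff (i - k) Y p := by
  funext p
  by_cases h : p ∈ U
  · simp only [famCoeff, dif_pos h, Pi.mul_apply]
    exact lcoeff_mul (hX _) (hY _) i
  · simp [famCoeff, dif_neg h]

lemma famCoeff_add (i : ℤ) (X Y : U → Loop n) :
    famCoeff i (X + Y) = fun p => famCoeff i X p + famCoeff i Y p := by
  funext p
  by_cases h : p ∈ U <;> simp [famCoeff, h]

lemma famCoeff_smul (i : ℤ) (r : ℝ) (X : U → Loop n) :
    famCoeff i (r • X) = fun p => r • famCoeff i X p := by
  funext p
  by_cases h : p ∈ U <;> simp [famCoeff, h]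

variable (n U) in
/-- The algebra of families of series on `U` with smooth coefficients and an order in `λ` that is
bounded uniformly on `U`. -/
def smoothLoops : Subalgebra ℝ (U → Loop n) where
  carrier := {X | (∃ N : ℤ, ∀ p, HasDegreeLE N (X p)) ∧ ∀ i, SmoothOn U (famCoeff i X)}
  mul_mem' := by
    rintro X Y ⟨⟨a, ha⟩, hX⟩ ⟨⟨b, hb⟩, hY⟩
    refine ⟨⟨a + b, fun p => (ha p).mul (hb p)⟩, fun i => ?_⟩
    rw [famCoeff_mul ha hb]
    exact SmoothOn.sum fun k _ => (hX k).mul (hY (i - k))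
  add_mem' := by
    rintro X Y ⟨⟨a, ha⟩, hX⟩ ⟨⟨b, hb⟩, hY⟩
    refine ⟨⟨max a b, fun p i hi => ?_⟩, fun i => ?_⟩
    · rw [Pi.add_apply, lcoeff_add, ha p i ((le_max_left a b).trans_lt hi),
        hb p i ((le_max_right a b).trans_lt hi), add_zero]
    · rw [famCoeff_add]
      exact (hX i).add (hY i)
  algebraMap_mem' := by
    intro r
    have e : algebraMap ℝ (U → Loop n) r = r • fun _ => monomial 0 1 := by
      rw [Algebra.algebraMap_eq_smul_one]; rfl
    refine ⟨⟨0, fun p i hi => ?_⟩, fun i => ?_⟩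
    · rw [e, Pi.smul_apply, lcoeff_smul, hasDegreeLE_monomial 0 1 i hi, smul_zero]
    · rw [e, famCoeff_smul]
      refine SmoothOn.smul (SmoothOn.congr (smoothOn_const (if i = 0 then 1 else 0)) ?_) r
      intro p hp
      rw [famCoeff_of_mem i _ hp, lcoeff_monomial]

lemma smoothLoops_ext {X Y : smoothLoops n U} (h : ∀ p i, lcoeff i (X.1 p) = lcoeff i (Y.1 p)) :
    X = Y :=
  Subtype.ext (funext fun p => loop_ext (h p))

lemma dirDeriv_famCoeff_eq_zero {c : ℤ} {X : U → Loop n} (hX : ∀ p, HasDegreeLE c (X p))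
    (e : ℝ × ℝ) {i : ℤ} (hi : c < i) (p : ℝ × ℝ) : dirDeriv e (famCoeff i X) p = 0 := by
  have : famCoeff i X = fun _ => 0 := by
    funext p'
    by_cases h : p' ∈ U
    · rw [famCoeff_of_mem i _ h]
      exact hX _ i hi
    · exact dif_neg h
  rw [this, dirDeriv_const]

/-- The derivative in `x` of a smooth family of series, coefficient by coefficient. -/
def loopDeriv (hU : IsOpen U) (X : smoothLoops n U) : smoothLoops n U :=
  ⟨fun p => mkLoop (fun i => dirDeriv (1, 0) (famCoeff i X.1) p) X.2.1.choose
    fun _ hi => dirDeriv_famCoeff_eq_zero X.2.1.choose_spec _ hi p, by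
    refine ⟨⟨X.2.1.choose, fun p i hi => ?_⟩, fun i => ?_⟩
    · rw [lcoeff_mkLoop, dirDeriv_famCoeff_eq_zero X.2.1.choose_spec _ hi]
    · refine (smoothOn_dirDeriv (1, 0) (X.2.2 i) hU).congr fun p hp => ?_
      rw [famCoeff_of_mem i _ hp, lcoeff_mkLoop]⟩

lemma lcoeff_loopDeriv (hU : IsOpen U) (X : smoothLoops n U) (i : ℤ) (p : U) :
    lcoeff i ((loopDeriv hU X).1 p) = dirDeriv (1, 0) (famCoeff i X.1) p := by
  simp only [loopDeriv, lcoeff_mkLoop]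

lemma loopDeriv_mul (hU : IsOpen U) (X Y : smoothLoops n U) :
    loopDeriv hU (X * Y) = loopDeriv hU X * Y + X * loopDeriv hU Y := by
  obtain ⟨⟨a, ha⟩, hX⟩ := X.2
  obtain ⟨⟨b, hb⟩, hY⟩ := Y.2
  have hd : ∀ {c : ℤ} (Z : smoothLoops n U), (∀ p, HasDegreeLE c (Z.1 p)) →
      ∀ p, HasDegreeLE c ((loopDeriv hU Z).1 p) := by
    intro c Z hZ p i hi
    rw [lcoeff_loopDeriv, dirDeriv_famCoeff_eq_zero hZ _ hi]
  refine smoothLoops_ext fun p i => ?_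
  have e1 : lcoeff i (((loopDeriv hU X * Y + X * loopDeriv hU Y : smoothLoops n U) :
      U → Loop n) p) = lcoeff i ((loopDeriv hU X).1 p * Y.1 p)
        + lcoeff i (X.1 p * (loopDeriv hU Y).1 p) := rfl
  rw [lcoeff_loopDeriv, e1, lcoeff_mul (hd X ha p) (hb p), lcoeff_mul (ha p) (hd Y hb p),
    ← Finset.sum_add_distrib]
  have e2 : famCoeff i (X * Y : smoothLoops n U).1 = fun p => ∑ k ∈ Finset.Icc (i - b) a,
      famCoeff k X.1 p * famCoeff (i - k) Y.1 p := famCoeff_mul ha hb i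
  rw [e2, dirDeriv_sum _ (fun k _ => (hX k).mul (hY (i - k))) hU p.2]
  refine Finset.sum_congr rfl fun k _ => ?_
  rw [dirDeriv_mul _ (hX k) (hY (i - k)) hU p.2, lcoeff_loopDeriv, lcoeff_loopDeriv,
    famCoeff_of_mem _ _ p.2, famCoeff_of_mem _ _ p.2]

/-- The principal filtration: the matrix unit `e_{ab} λ^i` has degree `2 n i + a - b`. It makes
`β λ + b` homogeneous of degree one and constant upper triangular matrices of degree at most
zero. -/
def principalLE (d : ℤ) : Submodule ℝ (smoothLoops n U) where
  carrier := {X | ∀ p i (a b : Fin (2 * n + 1)), d < 2 * n * i + (a : ℕ) - (b : ℕ) →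
    lcoeff i (X.1 p) a b = 0}
  add_mem' := by
    intro X Y hX hY p i a b h
    change (lcoeff i (X.1 p) + lcoeff i (Y.1 p)) a b = 0
    rw [Matrix.add_apply, hX p i a b h, hY p i a b h, add_zero]
  zero_mem' := fun _ _ _ _ _ => rfl
  smul_mem' := by
    intro r X hX p i a b h
    change (r • lcoeff i (X.1 p)) a b = 0
    rw [Matrix.smul_apply, hX p i a b h, smul_zero]

/-- The limit of a Cauchy sequence is taken entry by entry; each entry is eventually constant. -/
lemma principalLE_complete (hn : 1 ≤ n) (x : ℕ → smoothLoops n U)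
    (hx : ∀ k : ℕ, x (k + 1) - x k ∈ principalLE (-k)) :
    ∃ y, ∀ k : ℕ, y - x k ∈ principalLE (-k) := by
  -- an entry of principal degree `e` no longer changes from the index `1 - e` on
  let K : ℤ → Fin (2 * n + 1) → Fin (2 * n + 1) → ℕ := fun i a b =>
    (1 - (2 * n * i + (a : ℕ) - (b : ℕ))).toNat
  have hstable : ∀ p i a b k, K i a b ≤ k →
      lcoeff i ((x k).1 p) a b = lcoeff i ((x (K i a b)).1 p) a b := by
    intro p i a b k hk
    induction k, hk using Nat.le_induction with
    | base => rfl
    | succ k hk ih =>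
      rw [← ih, ← sub_eq_zero]
      refine hx k p i a b ?_
      have := Int.self_le_toNat (1 - (2 * n * i + (a : ℕ) - (b : ℕ)))
      simp only [K] at hk
      omega
  obtain ⟨⟨N, hN⟩, -⟩ := (x 0).2
  have hbound : ∀ p i, max N 1 < i →
      (Matrix.of fun a b => lcoeff i ((x (K i a b)).1 p) a b) = 0 := by
    intro p i hi
    ext a b
    have h0 : K i a b = 0 := by
      simp only [K, Int.toNat_eq_zero]
      have hb := b.2
      have : (2 : ℤ) ≤ i := by have := le_max_right N 1; omega
      nlinarith
    rw [Matrix.of_apply, h0, hN p i ((le_max_left N 1).trans_lt hi)]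
  refine ⟨⟨fun p => mkLoop (fun i => Matrix.of fun a b => lcoeff i ((x (K i a b)).1 p) a b)
    (max N 1) (hbound p), ⟨max N 1, fun p i hi => ?_⟩, fun i a b => ?_⟩, fun k p i a b h => ?_⟩
  · rw [lcoeff_mkLoop]
    exact hbound p i hi
  · refine ((x (K i a b)).2.2 i a b).congr fun p hp => ?_
    rw [famCoeff_of_mem _ _ hp, famCoeff_of_mem _ _ hp, lcoeff_mkLoop, Matrix.of_apply]
  · change lcoeff i (mkLoop _ _ _ - (x k).1 p) a b = 0
    rw [lcoeff_sub, lcoeff_mkLoop, Matrix.sub_apply, Matrix.of_apply, sub_eq_zero]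
    refine (hstable p i a b k ?_).symm
    simp only [K, Int.toNat_le]
    omega

variable (n) in
/-- Smooth families of series form a complete filtered differential ring. -/
def smoothLoopsFiltered (hn : 1 ≤ n) (hU : IsOpen U) : FilteredDiffRing (smoothLoops n U) where
  F := principalLE
  δ :=
    { toFun := loopDeriv hU
      map_add' := by
        intro X Y
        refine smoothLoops_ext fun p i => ?_
        change _ = lcoeff i ((loopDeriv hU X).1 p) + lcoeff i ((loopDeriv hU Y).1 p)
        rw [lcoeff_loopDeriv, lcoeff_loopDeriv, lcoeff_loopDeriv,
          ← dirDeriv_add _ (X.2.2 i) (Y.2.2 i) hU p.2]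
        exact congrArg (fun f => dirDeriv _ f _) (famCoeff_add i X.1 Y.1)
      map_smul' := by
        intro r X
        refine smoothLoops_ext fun p i => ?_
        change _ = r • lcoeff i ((loopDeriv hU X).1 p)
        rw [lcoeff_loopDeriv, lcoeff_loopDeriv, ← dirDeriv_smul _ r (X.2.2 i) hU p.2]
        exact congrArg (fun f => dirDeriv _ f _) (famCoeff_smul i r X.1) }
  mono := fun hde X hX p i a b h => hX p i a b (hde.trans_lt h)
  one_mem := by
    intro p i a b h
    change lcoeff i (monomial 0 1) a b = 0
    rw [lcoeff_monomial]
    split_ifs with hi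
    · subst hi
      rw [Matrix.one_apply_ne]
      rintro rfl
      simp at h
    · rfl
  mul_mem := by
    intro d e X Y hX hY p i a b h
    obtain ⟨N, hN⟩ := X.2.1
    obtain ⟨N', hN'⟩ := Y.2.1
    change lcoeff i (X.1 p * Y.1 p) a b = 0
    rw [lcoeff_mul (hN p) (hN' p), Matrix.sum_apply]
    refine Finset.sum_eq_zero fun k _ => ?_
    rw [Matrix.mul_apply]
    refine Finset.sum_eq_zero fun l _ => ?_
    by_cases hd : d < 2 * n * k + (a : ℕ) - (l : ℕ)
    · rw [hX p k a l hd, zero_mul]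
    · rw [hY p (i - k) l b (by rw [mul_sub]; omega), mul_zero]
  δ_mem := by
    intro d X hX p i a b h
    change lcoeff i ((loopDeriv hU X).1 p) a b = 0
    rw [lcoeff_loopDeriv]
    have : (fun p' => famCoeff i X.1 p' a b) = fun _ => 0 := by
      funext p'
      by_cases hp : p' ∈ U
      · rw [famCoeff_of_mem i _ hp]
        exact hX _ i a b h
      · rw [famCoeff, dif_neg hp, Matrix.zero_apply]
    simp only [dirDeriv, Matrix.of_apply, this]
    simp
  leibniz := loopDeriv_mul hU
  separated := by
    intro X hX
    refine smoothLoops_ext fun p i => ?_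
    ext a b
    exact hX (2 * n * i + (a : ℕ) - (b : ℕ) - 1) p i a b (by omega)
  complete := principalLE_complete hn

end SmoothLoops

/-! ### The cyclic element -/

section CyclicElement
open Matrix
variable {n : ℕ}

lemma lie_loop_def (X Y : Loop n) : ⁅X, Y⁆ = X * Y - Y * X := Ring.lie_def X Y

/-- The matrix whose first column is the `k`-th basis vector (zero if `k > 2n`) and whose other
columns vanish. Vectors are encoded in this way so that series in `λ` act on them by
multiplication. -/
def basisColumn (n k : ℕ) : Mat n :=
  Matrix.of fun i c => if (i : ℕ) = k ∧ (c : ℕ) = 0 then 1 else 0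

lemma bmat_mul_apply_succ (Y : Mat n) {i l : Fin (2 * n + 1)} (h : (i : ℕ) = l + 1)
    (k : Fin (2 * n + 1)) : (bmat n * Y) i k = Y l k := by
  rw [mul_apply, Finset.sum_eq_single l]
  · rw [bmat, of_apply, if_pos h, one_mul]
  · intro m _ hm
    rw [bmat, of_apply, if_neg fun h' => hm (Fin.ext (by omega)), zero_mul]
  · simp

lemma mul_bmat_apply_succ (Y : Mat n) {k l : Fin (2 * n + 1)} (h : (l : ℕ) = k + 1)
    (i : Fin (2 * n + 1)) : (Y * bmat n) i k = Y i l := by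
  rw [mul_apply, Finset.sum_eq_single l]
  · rw [bmat, of_apply, if_pos h, mul_one]
  · intro m _ hm
    rw [bmat, of_apply, if_neg fun h' => hm (Fin.ext (by omega)), mul_zero]
  · simp

lemma beta_mul_apply_eq_zero (Y : Mat n) {i : Fin (2 * n + 1)} (h : 2 ≤ (i : ℕ))
    (k : Fin (2 * n + 1)) : (beta n * Y) i k = 0 := by
  rw [mul_apply]
  refine Finset.sum_eq_zero fun l _ => ?_
  rw [beta, of_apply, if_neg (by omega), zero_mul]

lemma mul_beta_apply_eq_zero (Y : Mat n) {k : Fin (2 * n + 1)} (h : (k : ℕ) + 1 < 2 * n)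
    (i : Fin (2 * n + 1)) : (Y * beta n) i k = 0 := by
  rw [mul_apply]
  refine Finset.sum_eq_zero fun l _ => ?_
  rw [beta, of_apply, if_neg (by omega), mul_zero]

lemma mul_beta_apply (Y : Mat n) {k l : Fin (2 * n + 1)}
    (h : ((l : ℕ) = 0 ∧ (k : ℕ) + 1 = 2 * n) ∨ ((l : ℕ) = 1 ∧ (k : ℕ) = 2 * n))
    (i : Fin (2 * n + 1)) : (Y * beta n) i k = Y i l * (1 / 2) := by
  rw [mul_apply, Finset.sum_eq_single l]
  · rw [beta, of_apply, if_pos h]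
  · intro m _ hm
    rw [beta, of_apply, if_neg fun h' => hm (Fin.ext (by omega)), mul_zero]
  · simp

lemma mul_basisColumn_apply (Y : Mat n) (k a c : Fin (2 * n + 1)) :
    (Y * basisColumn n k) a c = if (c : ℕ) = 0 then Y a k else 0 := by
  rw [mul_apply, Finset.sum_eq_single k]
  · by_cases hc : (c : ℕ) = 0
    · rw [basisColumn, of_apply, if_pos ⟨rfl, hc⟩, if_pos hc, mul_one]
    · rw [basisColumn, of_apply, if_neg fun h => hc h.2, if_neg hc, mul_zero]
  · intro m _ hm
    rw [basisColumn, of_apply, if_neg fun h' => hm (Fin.ext h'.1), mul_zero]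
  · simp

lemma basisColumn_eq_zero {k : ℕ} (hk : 2 * n < k) : basisColumn n k = 0 := by
  ext i c
  have := i.2
  rw [basisColumn, of_apply, if_neg (by omega), Matrix.zero_apply]

lemma bmat_mul_basisColumn {k : ℕ} (hk : k ≤ 2 * n) :
    bmat n * basisColumn n k = basisColumn n (k + 1) := by
  ext a c
  have := mul_basisColumn_apply (bmat n) ⟨k, by omega⟩ a c
  simp only at this
  rw [this, basisColumn, bmat, of_apply, of_apply]
  by_cases hc : (c : ℕ) = 0 <;> simp [hc]

lemma beta_mul_basisColumn {k : ℕ} (hk : k ≤ 2 * n) :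
    beta n * basisColumn n k = if k + 1 = 2 * n then (1 / 2 : ℝ) • basisColumn n 0
      else if k = 2 * n then (1 / 2 : ℝ) • basisColumn n 1 else 0 := by
  ext a c
  have := mul_basisColumn_apply (beta n) ⟨k, by omega⟩ a c
  simp only at this
  rw [this, beta, of_apply]
  by_cases hc : (c : ℕ) = 0
  · rw [if_pos hc]
    (split_ifs <;> try dsimp only at *) <;>
      simp only [basisColumn, Matrix.smul_apply, Matrix.zero_apply, of_apply, hc, and_true,
        smul_eq_mul] <;> first | omega | (split_ifs <;> first | omega | norm_num)
  · rw [if_neg hc]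
    split_ifs <;> simp only [basisColumn, Matrix.smul_apply, Matrix.zero_apply, of_apply, hc,
      and_false, if_false, smul_zero]

/-- `J = β λ + b`. -/
def cyclicLoop (n : ℕ) : Loop n := monomial 1 (beta n) + monomial 0 (bmat n)

lemma cyclicLoop_mul_basisColumn {k : ℕ} (hk : k ≤ 2 * n) :
    cyclicLoop n * monomial 0 (basisColumn n k)
      = monomial 1 (beta n * basisColumn n k) + monomial 0 (basisColumn n (k + 1)) := by
  rw [cyclicLoop, add_mul, monomial_mul_monomial, monomial_mul_monomial, bmat_mul_basisColumn hk]
  rfl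

lemma cyclicLoop_pow_mul_basisColumn {k : ℕ} (hk : k < 2 * n) :
    cyclicLoop n ^ k * monomial 0 (basisColumn n 0) = monomial 0 (basisColumn n k) := by
  induction k with
  | zero => rw [pow_zero, one_mul]
  | succ k ih =>
    rw [pow_succ', mul_assoc, ih (by omega), cyclicLoop_mul_basisColumn (by omega),
      beta_mul_basisColumn (by omega), if_neg (by omega), if_neg (by omega)]
    simp [monomial]

lemma monomial_one_comm (i : ℤ) (X : Loop n) : monomial i 1 * X = X * monomial i 1 :=
  loop_ext fun m => by rw [lcoeff_monomial_mul, lcoeff_mul_monomial, one_mul, mul_one]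

lemma smul_one_comm (r : ℝ) (X : Loop n) :
    monomial 0 (r • (1 : Mat n)) * X = X * monomial 0 (r • 1) :=
  loop_ext fun m => by
    rw [lcoeff_monomial_mul, lcoeff_mul_monomial, Matrix.smul_mul, Matrix.mul_smul, one_mul,
      mul_one]

lemma loop_mul_smul (r : ℝ) (X Y : Loop n) : X * (r • Y) = r • (X * Y) := by
  have h : ∀ Z : Loop n, r • Z = monomial 0 (r • (1 : Mat n)) * Z := fun Z =>
    loop_ext fun m => by rw [lcoeff_monomial_mul, sub_zero, lcoeff_smul, Matrix.smul_mul, one_mul]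
  rw [h, h, ← mul_assoc, ← smul_one_comm, mul_assoc]

/-- The first basis vector is cyclic for `J`, so it suffices to verify `J^{2n+1} = λ J` on it. -/
theorem cyclicLoop_pow (hn : 1 ≤ n) :
    cyclicLoop n ^ (2 * n + 1) = monomial 1 1 * cyclicLoop n := by
  set J := cyclicLoop n with hJ
  set z : Loop n := monomial 1 1 with hz
  set E : ℕ → Loop n := fun k => monomial 0 (basisColumn n k) with hE
  have hhalf : ∀ k, monomial 1 ((1 / 2 : ℝ) • basisColumn n k) = z * ((1 / 2 : ℝ) • E k) := by
    intro k
    refine loop_ext fun m => ?_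
    rw [hz, lcoeff_monomial_mul, lcoeff_smul, hE, lcoeff_monomial, lcoeff_monomial, one_mul]
    by_cases hm : m = 1 <;> simp [hm, sub_eq_zero]
  have h2 : J ^ (2 * n) * E 0 = z * ((1 / 2 : ℝ) • E 0) + E (2 * n) := by
    obtain ⟨m, hm⟩ : ∃ m, 2 * n = m + 1 := ⟨2 * n - 1, by omega⟩
    have h1 : J ^ m * E 0 = E m := cyclicLoop_pow_mul_basisColumn (by omega)
    have h3 : J * E m = monomial 1 (beta n * basisColumn n m) + E (m + 1) :=
      cyclicLoop_mul_basisColumn (by omega)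
    have e1 : J ^ (2 * n) = J * J ^ m := by rw [← pow_succ', ← hm]
    have e2 : E (2 * n) = E (m + 1) := congrArg E hm
    rw [e1, e2, mul_assoc, h1, h3, beta_mul_basisColumn (by omega), if_pos hm.symm, hhalf]
  have hzc : ∀ X : Loop n, z * X = X * z := monomial_one_comm 1
  have hJ0 : J * E 0 = E 1 := by
    have := cyclicLoop_pow_mul_basisColumn (n := n) (k := 1) (by omega)
    rwa [pow_one] at this
  have h3 : J ^ (2 * n + 1) * E 0 = z * J * E 0 := by
    have h4 : J * E (2 * n) = z * ((1 / 2 : ℝ) • E 1) := by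
      have : J * E (2 * n) = monomial 1 (beta n * basisColumn n (2 * n)) + E (2 * n + 1) :=
        cyclicLoop_mul_basisColumn le_rfl
      rw [this, beta_mul_basisColumn le_rfl, if_neg (by omega), if_pos rfl, hhalf, hE]
      simp [basisColumn_eq_zero, monomial]
    rw [pow_succ', mul_assoc, h2, mul_add, h4, ← mul_assoc, ← hzc, mul_assoc, loop_mul_smul, hJ0,
      ← mul_add, mul_assoc, hJ0]
    congr 1
    refine loop_ext fun m => ?_
    rw [lcoeff_add, lcoeff_smul]
    module
  -- `Y` annihilates the first basis vector and commutes with `J`, so it annihilates all of them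
  set Y := J ^ (2 * n + 1) - z * J with hY
  have hYJ : ∀ k, Y * J ^ k = J ^ k * Y := fun k => by
    rw [hY, sub_mul, mul_sub, ← pow_add, ← pow_add, add_comm k, mul_assoc, ← pow_succ',
      ← mul_assoc (J ^ k), ← hzc, mul_assoc z, pow_succ]
  have hY0 : Y * E 0 = 0 := by rw [hY, sub_mul, h3, sub_self]
  have hYk : ∀ k : ℕ, k ≤ 2 * n → Y * E k = 0 := by
    intro k hk
    rcases hk.lt_or_eq with hk | rfl
    · rw [show E k = J ^ k * E 0 from (cyclicLoop_pow_mul_basisColumn hk).symm, ← mul_assoc, hYJ,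
        mul_assoc, hY0, mul_zero]
    · have : E (2 * n) = J ^ (2 * n) * E 0 - z * ((1 / 2 : ℝ) • E 0) := by rw [h2]; abel
      rw [this, mul_sub, ← mul_assoc, hYJ, mul_assoc, hY0, mul_zero, ← mul_assoc, ← hzc, mul_assoc,
        loop_mul_smul, hY0, smul_zero, mul_zero, sub_zero]
  rw [← sub_eq_zero, ← hY]
  refine loop_ext fun i => ?_
  ext a k
  have h5 := congrArg (lcoeff i) (hYk k (by have := k.2; omega))
  rw [hE, lcoeff_mul_monomial, sub_zero] at h5
  have h6 := congrFun (congrFun h5 a) 0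
  rw [show (k : ℕ) = ((k : Fin (2 * n + 1)) : ℕ) from rfl, mul_basisColumn_apply,
    if_pos (Fin.val_zero _)] at h6
  exact h6

end CyclicElement

/-! ### Skewness of the resolvent and its leading terms -/

section Resolvent
open Matrix
variable {n : ℕ} {U : Set (ℝ × ℝ)}

/-- A smooth matrix valued function times a power of `λ`. -/
def monFam (i : ℤ) (f : ℝ × ℝ → Mat n) (hf : SmoothOn U f) : smoothLoops n U :=
  ⟨fun p => monomial i (f p), ⟨i, fun _ => hasDegreeLE_monomial i _⟩, fun m => by
    refine SmoothOn.congr (f := if m = i then f else fun _ => 0) ?_ fun p hp => ?_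
    · split_ifs
      · exact hf
      · exact smoothOn_const 0
    · rw [famCoeff_of_mem _ _ hp, lcoeff_monomial]
      split_ifs <;> rfl⟩

lemma loopDeriv_monFam (hU : IsOpen U) (i : ℤ) (f : ℝ × ℝ → Mat n) (hf : SmoothOn U f)
    {f' : ℝ × ℝ → Mat n} (hf' : SmoothOn U f') (h : ∀ p ∈ U, f' p = dirDeriv (1, 0) f p) :
    loopDeriv hU (monFam i f hf) = monFam i f' hf' := by
  refine smoothLoops_ext fun p m => ?_
  have : ∀ p' ∈ U, famCoeff m (monFam i f hf).1 p' = if m = i then f p' else 0 := by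
    intro p' hp'
    rw [famCoeff_of_mem _ _ hp']
    exact lcoeff_monomial _ _ _
  rw [lcoeff_loopDeriv, dirDeriv_congr _ hU this p.2]
  change _ = lcoeff m (monomial i (f' p))
  rw [lcoeff_monomial]
  split_ifs
  · exact (h p p.2).symm
  · exact dirDeriv_const _ _ _

lemma loopDeriv_monFam_const (hU : IsOpen U) (i : ℤ) (A : Mat n) :
    loopDeriv hU (monFam i (fun _ => A) (smoothOn_const A)) = 0 := by
  rw [loopDeriv_monFam hU i _ _ (smoothOn_const (0 : Mat n)) fun p _ => (dirDeriv_const _ _ _).symm]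
  exact smoothLoops_ext fun p m => by simp [monFam, monomial]

variable (n U) in
/-- `J = β λ + b` as a constant family. -/
def cyclicFam : smoothLoops n U :=
  monFam 1 (fun _ => beta n) (smoothOn_const _) + monFam 0 (fun _ => bmat n) (smoothOn_const _)

variable (n) in
/-- The powers `λ` and `λ⁻¹` play the roles of the central element and its inverse. -/
lemma isCyclic (hn : 1 ≤ n) (hU : IsOpen U) :
    (smoothLoopsFiltered n hn hU).IsCyclic (2 * n) (cyclicFam n U)
      (monFam 1 (fun _ => 1) (smoothOn_const _)) (monFam (-1) (fun _ => 1) (smoothOn_const _)) where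
  pos := by omega
  J_mem := by
    intro p i a b h
    change (lcoeff i (monomial 1 (beta n)) + lcoeff i (monomial 0 (bmat n))) a b = 0
    have ha := a.2
    have hb := b.2
    rw [lcoeff_monomial, lcoeff_monomial]
    by_cases h1 : i = 1
    · subst h1
      rw [if_pos rfl, if_neg (by norm_num), add_zero, beta, of_apply, if_neg (by omega)]
    · by_cases h0 : i = 0
      · subst h0
        rw [if_neg (by norm_num), if_pos rfl, zero_add, bmat, of_apply, if_neg (by omega)]
      · rw [if_neg h1, if_neg h0]; simp
  z_mem := by
    intro p i a b h
    change lcoeff i (monomial 1 1) a b = 0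
    rw [lcoeff_monomial]
    split_ifs with hi
    · rw [one_apply_ne]
      rintro rfl
      subst hi
      push_cast at h
      omega
    · rfl
  w_mem := by
    intro p i a b h
    change lcoeff i (monomial (-1) 1) a b = 0
    rw [lcoeff_monomial]
    split_ifs with hi
    · rw [one_apply_ne]
      rintro rfl
      subst hi
      push_cast at h
      omega
    · rfl
  z_comm := fun X => Subtype.ext (funext fun p => monomial_one_comm 1 (X.1 p))
  zw := Subtype.ext (funext fun p => by
    change monomial 1 1 * monomial (-1) 1 = (1 : Loop n)
    rw [monomial_mul_monomial, mul_one]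
    rfl)
  pow := Subtype.ext (funext fun p => cyclicLoop_pow hn)
  δJ := by
    have := loopDeriv_monFam_const hU 1 (beta n)
    have h2 := loopDeriv_monFam_const hU 0 (bmat n)
    change (smoothLoopsFiltered n hn hU).δ (_ + _) = 0
    rw [map_add]
    change loopDeriv hU _ + loopDeriv hU _ = 0
    rw [this, h2, add_zero]

/-- The adjoint of a series, coefficient by coefficient. -/
def sharpLoop (X : Loop n) : Loop n :=
  HahnSeries.map X (⟨sharp, sharp_zero⟩ : ZeroHom (Mat n) (Mat n))

@[simp] lemma lcoeff_sharpLoop (i : ℤ) (X : Loop n) :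
    lcoeff i (sharpLoop X) = sharp (lcoeff i X) := rfl

lemma HasDegreeLE.sharp {a : ℤ} {X : Loop n} (hX : HasDegreeLE a X) :
    HasDegreeLE a (sharpLoop X) := fun i hi => by rw [lcoeff_sharpLoop, hX i hi, sharp_zero]

lemma sharpLoop_mul {a b : ℤ} {X Y : Loop n} (hX : HasDegreeLE a X) (hY : HasDegreeLE b Y) :
    sharpLoop (X * Y) = sharpLoop Y * sharpLoop X := by
  refine loop_ext fun i => ?_
  rw [lcoeff_sharpLoop, lcoeff_mul hX hY, lcoeff_mul hY.sharp hX.sharp, sharp_sum]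
  refine Finset.sum_nbij' (fun k => i - k) (fun k => i - k) ?_ ?_ ?_ ?_ ?_
  · intro k hk
    simp only [Finset.mem_Icc] at hk ⊢
    omega
  · intro k hk
    simp only [Finset.mem_Icc] at hk ⊢
    omega
  · intro k _; ring
  · intro k _; ring
  · intro k _
    rw [sharp_mul, lcoeff_sharpLoop, lcoeff_sharpLoop, sub_sub_cancel]

/-- The adjoint of a smooth family of series. -/
def sharpFam (X : smoothLoops n U) : smoothLoops n U :=
  ⟨fun p => sharpLoop (X.1 p), X.2.1.imp fun _ hN p => (hN p).sharp, fun i => by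
    refine (SmoothOn.sharp (X.2.2 i)).congr fun p hp => ?_
    rw [famCoeff_of_mem _ _ hp, famCoeff_of_mem _ _ hp, lcoeff_sharpLoop]⟩

lemma lcoeff_sharpFam (X : smoothLoops n U) (i : ℤ) (p : U) :
    lcoeff i ((sharpFam X).1 p) = sharp (lcoeff i (X.1 p)) := rfl

lemma sharpFam_mul (X Y : smoothLoops n U) : sharpFam (X * Y) = sharpFam Y * sharpFam X := by
  obtain ⟨a, ha⟩ := X.2.1
  obtain ⟨b, hb⟩ := Y.2.1
  exact Subtype.ext (funext fun p => sharpLoop_mul (ha p) (hb p))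

lemma sharpFam_add (X Y : smoothLoops n U) : sharpFam (X + Y) = sharpFam X + sharpFam Y :=
  smoothLoops_ext fun _ _ => sharp_add _ _

lemma sharpFam_one : sharpFam (1 : smoothLoops n U) = 1 := by
  refine smoothLoops_ext fun p i => ?_
  change sharp (lcoeff i (monomial 0 1)) = lcoeff i (monomial 0 1)
  rw [lcoeff_monomial]
  split_ifs
  · exact sharp_one
  · exact sharp_zero

lemma sharpFam_pow (X : smoothLoops n U) (k : ℕ) : sharpFam (X ^ k) = sharpFam X ^ k := by
  induction k with
  | zero => rw [pow_zero, pow_zero, sharpFam_one]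
  | succ k ih => rw [pow_succ, sharpFam_mul, ih, pow_succ']

lemma sharpFam_monFam (i : ℤ) {f f' : ℝ × ℝ → Mat n} (hf : SmoothOn U f) (hf' : SmoothOn U f')
    (h : ∀ p ∈ U, sharp (f p) = f' p) : sharpFam (monFam i f hf) = monFam i f' hf' := by
  refine smoothLoops_ext fun p m => ?_
  change sharp (lcoeff m (monomial i (f p))) = lcoeff m (monomial i (f' p))
  rw [lcoeff_monomial, lcoeff_monomial]
  split_ifs
  · exact h p p.2
  · exact sharp_zero

lemma monFam_neg (i : ℤ) (f : ℝ × ℝ → Mat n) (hf : SmoothOn U f) (hf' : SmoothOn U fun p => -f p) :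
    monFam i (fun p => -f p) hf' = -monFam i f hf := by
  refine smoothLoops_ext fun p m => ?_
  change lcoeff m (monomial i (-f p)) = lcoeff m (-monomial i (f p))
  rw [lcoeff_neg, lcoeff_monomial, lcoeff_monomial]
  split_ifs <;> simp

lemma sharpFam_monFam_of_skew (i : ℤ) {f : ℝ × ℝ → Mat n} (hf : SmoothOn U f)
    (h : ∀ p ∈ U, sharp (f p) = -f p) : sharpFam (monFam i f hf) = -monFam i f hf := by
  have hf' : SmoothOn U fun p => -f p := fun a b => (hf a b).neg
  rw [sharpFam_monFam i hf hf' h, monFam_neg]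

lemma sharpFam_cyclicFam : sharpFam (cyclicFam n U) = -cyclicFam n U := by
  rw [cyclicFam, sharpFam_add, sharpFam_monFam_of_skew _ _ fun _ _ => sharp_beta,
    sharpFam_monFam_of_skew _ _ fun _ _ => sharp_bmat]
  abel

lemma loopDeriv_sharpFam (hU : IsOpen U) (X : smoothLoops n U) :
    loopDeriv hU (sharpFam X) = sharpFam (loopDeriv hU X) := by
  refine smoothLoops_ext fun p i => ?_
  rw [lcoeff_sharpFam, lcoeff_loopDeriv, lcoeff_loopDeriv, ← dirDeriv_sharp _ (X.2.2 i) hU p.2]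
  refine dirDeriv_congr _ hU (fun p' hp' => ?_) p.2
  rw [famCoeff_of_mem _ _ hp', famCoeff_of_mem _ _ hp', lcoeff_sharpFam]

lemma sharpFam_mem {d : ℤ} {X : smoothLoops n U} (hX : X ∈ principalLE d) :
    sharpFam X ∈ principalLE d := by
  intro p i a b h
  rw [lcoeff_sharpFam, sharp_apply, hX p i b.rev a.rev, mul_zero]
  rw [val_rev, val_rev]
  omega

lemma monFam_mem_principalLE {q : ℝ × ℝ → Mat n} (hq : SmoothOn U q)
    (hb : ∀ p ∈ U, q p ∈ borel n) : monFam 0 q hq ∈ principalLE (0 : ℤ) := by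
  intro p i a b h
  change lcoeff i (monomial 0 (q p)) a b = 0
  rw [lcoeff_monomial]
  split_ifs with hi
  · subst hi
    exact (hb p p.2).2 a b (Fin.lt_def.2 (by omega))
  · rfl

variable (n U) in
lemma sharpFam_zero : sharpFam (0 : smoothLoops n U) = 0 := smoothLoops_ext fun _ _ => sharp_zero

/-- The resolvent is skew for the adjoint. -/
lemma sharpFam_resolvent (hn : 1 ≤ n) (hU : IsOpen U) {q : ℝ × ℝ → Mat n} (hq : SmoothOn U q)
    (hb : ∀ p ∈ U, q p ∈ borel n) {T : smoothLoops n U}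
    (hT : (isCyclic n hn hU).IsResolvent (monFam 0 q hq) T) : sharpFam T = -T :=
  hT.eq_neg_of_anti (isCyclic n hn hU) (even_two_mul n)
    (⟨⟨sharpFam, sharpFam_zero n U⟩, sharpFam_add⟩ : smoothLoops n U →+ smoothLoops n U)
    sharpFam_mul (fun hX => sharpFam_mem hX) (fun X => loopDeriv_sharpFam hU X) sharpFam_cyclicFam
    (sharpFam_monFam_of_skew _ _ fun p hp => sharp_eq_neg_of_mem_borel (hb p hp))
    (sharpFam_monFam _ _ _ fun _ _ => sharp_one) (monFam_mem_principalLE hq hb)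

/-- One step of the proof that `T₀ - b` is upper triangular: along the `d`-th subdiagonal the
matrix `Y = T₀ - b - q` is constant, and this constant vanishes because `Y` commutes with `β`. -/
lemma subdiagonal_eq_zero {Y q S : Mat n} {d : ℕ} (hd : 1 ≤ d)
    (hq : ∀ i k, k < i → q i k = 0)
    (hY : ∀ i k : Fin (2 * n + 1), (k : ℕ) + d + 1 ≤ i → Y i k = 0)
    (h1 : beta n * Y - Y * beta n = 0)
    (h0 : ∀ i k : Fin (2 * n + 1), (i : ℕ) = k + d + 1 →
      ((bmat n + q) * Y - Y * (bmat n + q) + (beta n * S - S * beta n)) i k = 0) :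
    ∀ i k : Fin (2 * n + 1), (i : ℕ) = k + d → Y i k = 0 := by
  have hstep : ∀ i k i' k' : Fin (2 * n + 1), (i : ℕ) = k + d → (i' : ℕ) = i + 1 →
      (k' : ℕ) = k + 1 → Y i k = Y i' k' := by
    intro i k i' k' hik hi hk
    have h := h0 i' k (by omega)
    have e1 : (q * Y) i' k = 0 := by
      rw [mul_apply]
      refine Finset.sum_eq_zero fun l _ => ?_
      by_cases hl : l < i'
      · rw [hq _ _ hl, zero_mul]
      · rw [hY l k (by have := Fin.le_def.1 (not_lt.1 hl); omega), mul_zero]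
    have e2 : (Y * q) i' k = 0 := by
      rw [mul_apply]
      refine Finset.sum_eq_zero fun l _ => ?_
      by_cases hl : k < l
      · rw [hq _ _ hl, mul_zero]
      · rw [hY i' l (by have := Fin.le_def.1 (not_lt.1 hl); omega), zero_mul]
    have := i'.2
    rw [add_mul, mul_add, Matrix.add_apply, Matrix.sub_apply, Matrix.sub_apply, Matrix.add_apply,
      Matrix.add_apply, e1, e2, beta_mul_apply_eq_zero _ (by omega),
      mul_beta_apply_eq_zero _ (by omega), bmat_mul_apply_succ Y hi, mul_bmat_apply_succ Y hk] at h
    linarith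
  -- an entry of `Y β` in a row that `β Y` does not meet
  have hβ : ∀ i l k : Fin (2 * n + 1), 2 ≤ (i : ℕ) →
      ((l : ℕ) = 0 ∧ (k : ℕ) + 1 = 2 * n) ∨ ((l : ℕ) = 1 ∧ (k : ℕ) = 2 * n) → Y i l = 0 := by
    intro i l k hi hlk
    have h := congrFun (congrFun h1 i) k
    rw [Matrix.sub_apply, beta_mul_apply_eq_zero _ hi, mul_beta_apply Y hlk, Matrix.zero_apply] at h
    linarith
  intro i k hik
  obtain ⟨m, hm⟩ : ∃ m, (k : ℕ) = m := ⟨_, rfl⟩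
  induction m generalizing i k with
  | zero =>
    have := i.2
    by_cases hd2 : 2 ≤ d
    · exact hβ i k ⟨2 * n - 1, by omega⟩ (by omega) (Or.inl ⟨hm, by simp only; omega⟩)
    · rw [hstep i k ⟨i + 1, by omega⟩ ⟨1, by omega⟩ hik rfl (by simp only; omega)]
      exact hβ _ _ ⟨2 * n, by omega⟩ (by simp only; omega) (Or.inr ⟨rfl, rfl⟩)
  | succ m ih =>
    have := i.2
    have h := ih ⟨i - 1, by omega⟩ ⟨m, by omega⟩ (by simp only; omega) rfl
    rwa [hstep _ _ i k (by simp only; omega) (by simp only; omega) (by simp only; omega)] at h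

end Resolvent

/-! ### Existence and uniqueness of the resolvent series -/

section ResolventOn
open Matrix
variable {n : ℕ} {U V : Set (ℝ × ℝ)} {q : ℝ × ℝ → Mat n}

/-- The family `β λ + b + q`. -/
def laxFam (q : ℝ × ℝ → Mat n) (hq : SmoothOn U q) : smoothLoops n U :=
  cyclicFam n U + monFam 0 q hq

lemma laxFam_apply (hq : SmoothOn U q) (p : U) : (laxFam q hq).1 p = laxLoop (q p) := by
  change monomial 1 (beta n) + monomial 0 (bmat n) + monomial 0 (q p) = _
  rw [laxLoop, monomial_add, add_assoc]

lemma lcoeff_lie_laxLoop (i : ℤ) (Q : Mat n) (X : Loop n) :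
    lcoeff i ⁅laxLoop Q, X⁆ = beta n * lcoeff (i - 1) X - lcoeff (i - 1) X * beta n
      + ((bmat n + Q) * lcoeff i X - lcoeff i X * (bmat n + Q)) := by
  rw [lie_loop_def, laxLoop, add_mul, mul_add, lcoeff_sub, lcoeff_add, lcoeff_add,
    lcoeff_monomial_mul, lcoeff_monomial_mul, lcoeff_mul_monomial, lcoeff_mul_monomial, sub_zero]
  abel

open Classical in
/-- A smooth family of series, extended by zero outside `U`. -/
def extendFam (X : smoothLoops n U) (p : ℝ × ℝ) : Loop n :=
  if h : p ∈ U then X.1 ⟨p, h⟩ else 0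

lemma extendFam_of_mem (X : smoothLoops n U) {p : ℝ × ℝ} (h : p ∈ U) :
    extendFam X p = X.1 ⟨p, h⟩ := dif_pos h

lemma lcoeff_extendFam (X : smoothLoops n U) (i : ℤ) :
    (fun p => lcoeff i (extendFam X p)) = famCoeff i X.1 := by
  funext p
  by_cases h : p ∈ U <;> simp [extendFam, famCoeff, h]

lemma isResolventOn_extendFam (hU : IsOpen U) (hq : SmoothOn U q) {X : smoothLoops n U}
    (hdeg : ∀ p, HasDegreeLE 1 (X.1 p)) (hβ : ∀ p, lcoeff 1 (X.1 p) = beta n)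
    (hcomm : loopDeriv hU X + (laxFam q hq * X - X * laxFam q hq) = 0)
    (hpow : X ^ (2 * n + 1) = monFam 1 (fun _ => 1) (smoothOn_const _) * X) :
    IsResolventOn U q (extendFam X) where
  smooth i := by
    rw [lcoeff_extendFam]
    exact X.2.2 i
  coeff_of_gt p hp i hi := by
    rw [extendFam_of_mem X hp]
    exact hdeg _ i hi
  coeff_one p hp := by rw [extendFam_of_mem X hp, hβ]
  commute p hp i := by
    have hs := X.2.2 i
    rw [lcoeff_extendFam, dx_eq_dirDeriv hs hU hp, extendFam_of_mem X hp,
      ← lcoeff_loopDeriv hU X i ⟨p, hp⟩, lie_loop_def, ← laxFam_apply hq ⟨p, hp⟩, ← lcoeff_add]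
    exact congrArg (fun Y : smoothLoops n U => lcoeff i (Y.1 ⟨p, hp⟩)) hcomm
  pow_eq p hp := by
    rw [extendFam_of_mem X hp]
    exact congrArg (fun Y : smoothLoops n U => Y.1 ⟨p, hp⟩) hpow

/-- The resolvent for the principal filtration is a series of order one in `λ`. That `T - J` has
principal degree at most zero leaves only the upper right entry of the coefficient of `λ` in
`T - J`, and this entry vanishes by skewness. -/
theorem exists_isResolventOn (hn : 1 ≤ n) (hU : IsOpen U) (hq : SmoothOn U q)
    (hb : ∀ p ∈ U, q p ∈ borel n) : ∃ T, IsResolventOn U q T := by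
  obtain ⟨T, hT⟩ := (isCyclic n hn hU).exists_resolvent (monFam_mem_principalLE hq hb)
  have hmem : ∀ p i (a b : Fin (2 * n + 1)), (0 : ℤ) < 2 * n * i + (a : ℕ) - (b : ℕ) →
      (lcoeff i (T.1 p) - lcoeff i ((cyclicFam n U).1 p)) a b = 0 := by
    intro p i a b h
    have := hT.diff_mem p i a b h
    rwa [← lcoeff_sub]
  have hJ : ∀ p i, lcoeff i ((cyclicFam n U).1 p) = (if i = 1 then beta n else 0)
      + if i = 0 then bmat n else 0 := by
    intro p i
    rw [← lcoeff_monomial, ← lcoeff_monomial]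
    rfl
  refine ⟨_, isResolventOn_extendFam hU hq (X := T) ?_ ?_ hT.commute hT.pow_eq⟩
  · intro p i hi
    ext a b
    have h := hmem p i a b (by have := b.2; nlinarith)
    rw [hJ, if_neg (by omega), if_neg (by omega), add_zero, sub_zero] at h
    rw [h, Matrix.zero_apply]
  · intro p
    have hX : ∀ a b : Fin (2 * n + 1), (lcoeff 1 (T.1 p) - beta n) a b = 0 := by
      intro a b
      by_cases hab : 0 < 2 * (n : ℤ) * 1 + (a : ℕ) - (b : ℕ)
      · have h := hmem p 1 a b hab
        rwa [hJ, if_pos rfl, if_neg (by omega), add_zero] at h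
      -- the upper right corner, which is fixed by the reflection in the antidiagonal
      · have hs := congrArg (fun Y : smoothLoops n U => lcoeff 1 (Y.1 p))
          (sharpFam_resolvent hn hU hq hb hT)
        change sharp (lcoeff 1 (T.1 p)) = -lcoeff 1 (T.1 p) at hs
        have hs' : sharp (lcoeff 1 (T.1 p) - beta n) = -(lcoeff 1 (T.1 p) - beta n) := by
          rw [sharp_sub, hs, sharp_beta]; abel
        have h := congrFun (congrFun hs' a) b
        have ha := a.2
        have hb' := b.2
        have hev : Even ((a : ℕ) + b) := by rw [Nat.even_iff]; omega
        rw [sharp_apply, hev.neg_one_pow, one_mul, show b.rev = a from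
          Fin.ext (by rw [val_rev]; omega), show a.rev = b from
          Fin.ext (by rw [val_rev]; omega), Matrix.neg_apply] at h
        linarith
    rw [← sub_eq_zero]
    ext a b
    exact hX a b

/-- The resolvent equations force `T - J` into filtration degree zero, that is, they force `T₀ - b`
to be upper triangular. -/
lemma IsResolventOn.sub_bmat_upper {T : ℝ × ℝ → Loop n} (hT : IsResolventOn U q T) (hU : IsOpen U)
    (hb : ∀ p ∈ U, q p ∈ borel n) :
    ∀ p ∈ U, ∀ i k : Fin (2 * n + 1), k < i → (lcoeff 0 (T p) - bmat n) i k = 0 := by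
  have hq0 : ∀ p ∈ U, ∀ i k : Fin (2 * n + 1), k < i → q p i k = 0 := fun p hp => (hb p hp).2
  -- downward induction on the subdiagonal `d = 2n + 1 - e`
  have key : ∀ e d : ℕ, d + e = 2 * n + 1 → 1 ≤ d → ∀ p ∈ U, ∀ i k : Fin (2 * n + 1),
      (k : ℕ) + d ≤ i → (lcoeff 0 (T p) - bmat n - q p) i k = 0 := by
    intro e
    induction e with
    | zero =>
      intro d hd _ p _ i k hik
      have := i.2
      omega
    | succ e ih =>
      intro d hd hd1 p hp i k hik
      have hY := ih (d + 1) (by omega) (by omega)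
      rcases hik.lt_or_eq with h | h
      · exact hY p hp i k (by omega)
      refine subdiagonal_eq_zero (q := q p) (S := lcoeff (-1) (T p)) hd1 (hq0 p hp)
        (fun i k hik => hY p hp i k (by omega)) ?_ ?_ i k (by omega)
      -- the coefficient of `λ` in the commutation relation
      · have h1 := hT.commute p hp 1
        have e1 : dx (fun p' => lcoeff 1 (T p')) p = 0 := by
          rw [dx_eq_dirDeriv (hT.smooth 1) hU hp,
            dirDeriv_congr (g := fun _ => beta n) _ hU (fun p' hp' => hT.coeff_one p' hp') hp,
            dirDeriv_const]
        rw [e1, lcoeff_lie_laxLoop, hT.coeff_one p hp, sub_self, zero_add] at h1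
        rw [← h1]
        noncomm_ring
      -- its constant coefficient
      · intro i k hik
        have h0 := hT.commute p hp 0
        have e0 : dx (fun p' => lcoeff 0 (T p')) p i k = 0 := by
          have hc : ∀ p' ∈ U, lcoeff 0 (T p') i k = 0 := by
            intro p' hp'
            have := hY p' hp' i k (by omega)
            rw [Matrix.sub_apply, Matrix.sub_apply, hq0 p' hp' i k (Fin.lt_def.2 (by omega)), bmat,
              of_apply, if_neg (by omega)] at this
            linarith
          rw [dx_eq_dirDeriv (hT.smooth 0) hU hp]
          have : (fun p' => lcoeff 0 (T p') i k) =ᶠ[nhds p] fun _ => 0 := by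
            filter_upwards [hU.mem_nhds hp] with p' hp' using hc p' hp'
          simp [dirDeriv, this.fderiv_eq]
        have h := congrFun (congrFun h0 i) k
        rw [Matrix.add_apply, e0, lcoeff_lie_laxLoop, zero_add] at h
        rw [zero_sub, Matrix.zero_apply] at h
        refine Eq.trans (congrFun (congrFun ?_ i) k) h
        noncomm_ring
  intro p hp i k hik
  have h := key (2 * n) 1 (by omega) le_rfl p hp i k hik
  rw [Matrix.sub_apply, hq0 p hp i k hik, sub_zero] at h
  exact h

/-- A resolvent series as an element of the ring of smooth families on `U`. -/
def IsResolventOn.fam {T : ℝ × ℝ → Loop n} (hT : IsResolventOn U q T) : smoothLoops n U :=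
  ⟨fun p => T p, ⟨1, fun p => hT.coeff_of_gt p p.2⟩, fun i =>
    (hT.smooth i).congr fun _ hp => famCoeff_of_mem i _ hp⟩

lemma IsResolventOn.isResolvent {T : ℝ × ℝ → Loop n} (hT : IsResolventOn U q T) (hn : 1 ≤ n)
    (hU : IsOpen U) (hq : SmoothOn U q) (hb : ∀ p ∈ U, q p ∈ borel n) :
    (isCyclic n hn hU).IsResolvent (monFam 0 q hq) hT.fam where
  diff_mem := by
    intro p i a b h
    change lcoeff i (T p - (monomial 1 (beta n) + monomial 0 (bmat n))) a b = 0
    rw [lcoeff_sub, lcoeff_add, lcoeff_monomial, lcoeff_monomial]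
    have ha := a.2
    have hb' := b.2
    rcases lt_trichotomy i 0 with hi | hi | hi
    · nlinarith
    · subst hi
      rw [if_neg (by omega), if_pos rfl, zero_add]
      exact hT.sub_bmat_upper hU hb p p.2 a b (Fin.lt_def.2 (by omega))
    · rcases eq_or_ne i 1 with rfl | h1
      · rw [if_pos rfl, if_neg (by omega), hT.coeff_one p p.2, add_zero, sub_self,
          Matrix.zero_apply]
      · rw [if_neg h1, if_neg hi.ne', hT.coeff_of_gt p p.2 i (by omega), add_zero, sub_self,
          Matrix.zero_apply]
  commute := by
    refine smoothLoops_ext fun p i => ?_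
    change lcoeff i ((loopDeriv hU hT.fam).1 p)
      + lcoeff i ((laxFam q hq).1 p * T p - T p * (laxFam q hq).1 p) = 0
    rw [lcoeff_loopDeriv, laxFam_apply, ← lie_loop_def, ← hT.commute p p.2 i,
      dx_eq_dirDeriv (hT.smooth i) hU p.2]
    congr 1
    exact dirDeriv_congr _ hU (fun p' hp' => famCoeff_of_mem i _ hp') p.2
  pow_eq := Subtype.ext (funext fun p => hT.pow_eq p p.2)

/-- Uniqueness of the series `T(q, λ)`. -/
lemma IsResolventOn.unique {T T' : ℝ × ℝ → Loop n} (hT : IsResolventOn U q T)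
    (hT' : IsResolventOn U q T') (hn : 1 ≤ n) (hU : IsOpen U) (hq : SmoothOn U q)
    (hb : ∀ p ∈ U, q p ∈ borel n) {p : ℝ × ℝ} (hp : p ∈ U) : T p = T' p :=
  congrArg (fun Y : smoothLoops n U => Y.1 ⟨p, hp⟩)
    ((hT.isResolvent hn hU hq hb).unique _ (monFam_mem_principalLE hq hb)
      (hT'.isResolvent hn hU hq hb))

lemma IsResolventOn.mono {T : ℝ × ℝ → Loop n} (hT : IsResolventOn U q T) (h : V ⊆ U) :
    IsResolventOn V q T where
  smooth i := (hT.smooth i).mono h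
  coeff_of_gt p hp := hT.coeff_of_gt p (h hp)
  coeff_one p hp := hT.coeff_one p (h hp)
  commute p hp := hT.commute p (h hp)
  pow_eq p hp := hT.pow_eq p (h hp)

/-- The series chosen in the definition of `resolvent` does solve the resolvent equations. -/
theorem isResolventOn_resolvent (hn : 1 ≤ n) (hU : IsOpen U) (hq : SmoothOn U q)
    (hb : ∀ p ∈ U, q p ∈ borel n) : IsResolventOn U q (resolvent U q) :=
  Classical.epsilon_spec (exists_isResolventOn hn hU hq hb)

end ResolventOn

/-! ### Expansions at infinity and polynomial parts -/

section InvPole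
open Matrix
variable {n : ℕ} {U V : Set (ℝ × ℝ)}

variable (n) in
/-- The expansion of `1 / (λ - α)` at `λ = ∞`. -/
def invPole (α : ℝ) : Loop n :=
  mkLoop (fun i => if i ≤ -1 then α ^ (-1 - i).toNat • (1 : Mat n) else 0) (-1) fun _ hi =>
    if_neg (by omega)

lemma hasDegreeLE_invPole (α : ℝ) : HasDegreeLE (-1) (invPole n α) := fun i hi => by
  rw [invPole, lcoeff_mkLoop, if_neg (by omega)]

lemma pole_mul_invPole (α : ℝ) :
    (monomial 1 1 - monomial 0 (α • (1 : Mat n))) * invPole n α = 1 := by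
  refine loop_ext fun i => ?_
  rw [sub_mul, lcoeff_sub, lcoeff_monomial_mul, lcoeff_monomial_mul, sub_zero, invPole,
    lcoeff_mkLoop, lcoeff_mkLoop, ← monomial_zero_one, lcoeff_monomial, one_mul]
  rcases lt_trichotomy i 0 with hi | rfl | hi
  · rw [if_pos (by omega), if_pos (by omega), if_neg (by omega), Matrix.smul_mul, one_mul,
      smul_smul, ← pow_succ', sub_eq_zero]
    congr 2
    omega
  · simp
  · rw [if_neg (by omega), if_neg (by omega), if_neg (by omega), mul_zero, sub_zero]

lemma invPole_comm (α : ℝ) (X : Loop n) : invPole n α * X = X * invPole n α := by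
  have hc : ∀ Y : Loop n, (monomial 1 1 - monomial 0 (α • (1 : Mat n))) * Y
      = Y * (monomial 1 1 - monomial 0 (α • (1 : Mat n))) := fun Y => by
    rw [sub_mul, mul_sub, monomial_one_comm, smul_one_comm]
  have h2 : invPole n α * (monomial 1 1 - monomial 0 (α • (1 : Mat n))) = 1 := by
    rw [← hc, pole_mul_invPole]
  calc invPole n α * X
      = invPole n α * (X * (monomial 1 1 - monomial 0 (α • (1 : Mat n)))) * invPole n α := by
        rw [mul_assoc, mul_assoc X, pole_mul_invPole, mul_one]
    _ = X * invPole n α := by rw [← hc, ← mul_assoc, h2, one_mul]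

/-- Multiplication by `λ - α` undoes the division by it, read off at the coefficient of `λ^i`. -/
lemma lcoeff_sub_smul_lcoeff_invPole_mul (α : ℝ) (i : ℤ) (X : Loop n) :
    lcoeff (i - 1) (invPole n α * X) - α • lcoeff i (invPole n α * X) = lcoeff i X := by
  have h : (monomial 1 1 - monomial 0 (α • (1 : Mat n))) * (invPole n α * X) = X := by
    rw [← mul_assoc, pole_mul_invPole, one_mul]
  conv_rhs => rw [← h]
  rw [sub_mul, lcoeff_sub, lcoeff_monomial_mul, lcoeff_monomial_mul, sub_zero, one_mul,
    Matrix.smul_mul, one_mul]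

/-- The polynomial part of a series of order less than `m`, evaluated at `λ = α`. -/
def evalPlus (m : ℕ) (α : ℝ) (X : Loop n) : Mat n :=
  ∑ i ∈ Finset.range m, α ^ i • lcoeff (i : ℤ) X

lemma evalPlus_add (m : ℕ) (α : ℝ) (X Y : Loop n) :
    evalPlus m α (X + Y) = evalPlus m α X + evalPlus m α Y := by
  simp [evalPlus, Finset.sum_add_distrib]

lemma evalPlus_sub (m : ℕ) (α : ℝ) (X Y : Loop n) :
    evalPlus m α (X - Y) = evalPlus m α X - evalPlus m α Y := by
  simp [evalPlus, smul_sub]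

lemma evalPlus_smul (m : ℕ) (α r : ℝ) (X : Loop n) :
    evalPlus m α (r • X) = r • evalPlus m α X := by
  simp only [evalPlus, lcoeff_smul, Finset.smul_sum, smul_comm r]

lemma evalPlus_monomial_mul (m : ℕ) (α : ℝ) (A : Mat n) (X : Loop n) :
    evalPlus m α (monomial 0 A * X) = A * evalPlus m α X := by
  simp only [evalPlus, lcoeff_monomial_mul, sub_zero, Finset.mul_sum, Matrix.mul_smul]

lemma evalPlus_mul_monomial (m : ℕ) (α : ℝ) (A : Mat n) (X : Loop n) :
    evalPlus m α (X * monomial 0 A) = evalPlus m α X * A := by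
  simp only [evalPlus, lcoeff_mul_monomial, sub_zero, Finset.sum_mul, Matrix.smul_mul]

/-- The polynomial part of `X / (λ - α)` is the divided difference of the polynomial part
of `X`. -/
lemma sub_smul_evalPlus_invPole_mul {m : ℕ} {X : Loop n} (hX : HasDegreeLE (m : ℤ) X)
    (l α : ℝ) : (l - α) • evalPlus (m + 1) l (invPole n α * X)
      = evalPlus (m + 1) l X - evalPlus (m + 1) α X := by
  set Y := invPole n α * X with hY
  have hdeg : lcoeff (m : ℤ) Y = 0 := (hasDegreeLE_invPole α).mul hX _ (by omega)
  have key : ∀ k : ℕ, ∀ μ : ℝ, evalPlus k μ X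
      = lcoeff (-1) Y + (μ - α) • evalPlus k μ Y - μ ^ k • lcoeff ((k : ℤ) - 1) Y := by
    intro k μ
    induction k with
    | zero => simp [evalPlus]
    | succ k ih =>
      rw [evalPlus, Finset.sum_range_succ, ← evalPlus, ih, evalPlus, evalPlus,
        Finset.sum_range_succ, ← lcoeff_sub_smul_lcoeff_invPole_mul α k X, ← hY]
      push_cast
      rw [add_sub_cancel_right]
      module
  have h1 := key (m + 1) l
  have h2 := key (m + 1) α
  push_cast at h1 h2
  rw [add_sub_cancel_right, hdeg, smul_zero, sub_zero] at h1 h2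
  rw [h1, h2, sub_self, zero_smul]
  abel

/-- The nonnegative coefficients of `X / (λ - α)` are finite sums because `X` has bounded order. -/
lemma lcoeff_invPole_mul {m : ℕ} {X : Loop n} (hX : HasDegreeLE (m : ℤ) X) (α : ℝ) (i : ℕ) :
    lcoeff (i : ℤ) (invPole n α * X)
      = ∑ k ∈ Finset.range m, α ^ k • lcoeff ((i + 1 + k : ℕ) : ℤ) X := by
  have key : ∀ r : ℕ, lcoeff (i : ℤ) (invPole n α * X)
      = ∑ k ∈ Finset.range r, α ^ k • lcoeff ((i + 1 + k : ℕ) : ℤ) X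
        + α ^ r • lcoeff ((i + r : ℕ) : ℤ) (invPole n α * X) := by
    intro r
    induction r with
    | zero => simp
    | succ r ih =>
      rw [ih, Finset.sum_range_succ, ← lcoeff_sub_smul_lcoeff_invPole_mul α _ X]
      have e1 : ((i + 1 + r : ℕ) : ℤ) - 1 = ((i + r : ℕ) : ℤ) := by push_cast; ring
      have e2 : i + (r + 1) = i + 1 + r := by ring
      rw [e1, e2]
      module
  rw [key m, (hasDegreeLE_invPole α).mul hX _ (by push_cast; omega), smul_zero, add_zero]

variable (n U) in
/-- The constant family `1 / (λ - α)`, as an element of the centre. -/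
def invPoleFam (α : ℝ) : Subring.center (smoothLoops n U) :=
  ⟨⟨fun _ => invPole n α, ⟨-1, fun _ => hasDegreeLE_invPole α⟩, fun i =>
    (smoothOn_const (lcoeff i (invPole n α))).congr fun _ hp => famCoeff_of_mem i _ hp⟩,
    Subring.mem_center_iff.2 fun X => Subtype.ext (funext fun p =>
      (invPole_comm α (X.1 p)).symm)⟩

variable (n U) in
/-- The constants, as elements of the centre. -/
def constFam (r : ℝ) : Subring.center (smoothLoops n U) :=
  ⟨algebraMap ℝ _ r, Subring.mem_center_iff.2 fun X => (Algebra.commutes r X).symm⟩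

lemma constFam_smul (r : ℝ) (X : smoothLoops n U) : constFam n U r • X = r • X :=
  (Algebra.smul_def r X).symm

lemma invPole_sub (α₁ α₂ : ℝ) :
    invPole n α₁ - invPole n α₂ = (α₁ - α₂) • invPole n α₁ * invPole n α₂ := by
  have e : (α₁ - α₂) • invPole n α₁ = invPole n α₁ *
      ((monomial 1 1 - monomial 0 (α₂ • (1 : Mat n)))
        - (monomial 1 1 - monomial 0 (α₁ • (1 : Mat n)))) := by
    rw [sub_sub_sub_cancel_left, ← monomial_sub, ← sub_smul]
    refine loop_ext fun i => ?_
    rw [lcoeff_mul_monomial, lcoeff_smul, sub_zero, Matrix.mul_smul, mul_one]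
  rw [e, mul_sub, sub_mul, mul_assoc, pole_mul_invPole, mul_one, invPole_comm α₁ (_ - _),
    pole_mul_invPole, one_mul]

lemma invPoleFam_sub (α₁ α₂ : ℝ) : invPoleFam n U α₁ - invPoleFam n U α₂
    = constFam n U (α₁ - α₂) * invPoleFam n U α₁ * invPoleFam n U α₂ := by
  have h : algebraMap ℝ (smoothLoops n U) (α₁ - α₂) * (invPoleFam n U α₁).1
      = (α₁ - α₂) • (invPoleFam n U α₁).1 := (Algebra.smul_def _ _).symm
  refine Subtype.ext ?_
  change _ = algebraMap ℝ (smoothLoops n U) (α₁ - α₂) * (invPoleFam n U α₁).1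
    * (invPoleFam n U α₂).1
  rw [h]
  exact Subtype.ext (funext fun _ => invPole_sub α₁ α₂)

end InvPole

/-! ### Gauge transformation of the resolvent -/

section GaugeTransformation
open Matrix
variable {n j : ℕ} {U V : Set (ℝ × ℝ)} {q π : ℝ × ℝ → Mat n} {α₁ α₂ : ℝ}

lemma sharp_laxA {p : ℝ × ℝ} (hq : q p ∈ borel n) (α : ℝ) :
    sharp (laxA q α p) = -laxA q α p := by
  rw [laxA, sharp_add, sharp_add, sharp_smul, sharp_beta, sharp_bmat,
    sharp_eq_neg_of_mem_borel hq]
  module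

/-- The new potential is defined so that `A(q̃, λ)` is the transform of `A(q, λ)`, whose divided
differences are both equal to `β`. -/
lemma laxA_newSol (α : ℝ) (p : ℝ × ℝ) : laxA (newSol q α₁ α₂ π) α p
    = dressed (α₁ - α₂) (π p) (sharp (π p)) (laxA q α p) (beta n) (beta n) := by
  simp only [laxA, newSol, dressed, Ring.lie_def, mul_sub, sub_mul, smul_sub, sub_self, zero_mul,
    mul_zero, smul_zero]
  abel

/-- The right-hand side `P B₂ - B̃₂ P` of the equations for `P`, where `B̃₂` is the transform of
`B₂`, is of Riccati type. -/
lemma mul_sub_dressed_mul {P B₁ B₂ D₁ : Mat n} (D₂ : Mat n) (hP : P ∈ isoProj n)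
    (h₁ : sharp B₁ = -B₁) (h₂ : sharp B₂ = -B₂) {c : ℝ} (hD : c • D₁ = B₁ - B₂) :
    P * B₂ - dressed c P (sharp P) B₂ D₁ D₂ * P = P * B₂ - B₁ * P + P * (B₁ - B₂) * P := by
  rw [dressed_mul (isOrthogonalPair_sharp hP) (sharp_mul_mul_eq_zero hP.2.1 h₁)
    (sharp_mul_mul_eq_zero hP.2.1 h₂) hD]
  abel

lemma sub_smul_beta (p : ℝ × ℝ) :
    (α₁ - α₂) • beta n = laxA q α₁ p - laxA q α₂ p := by
  rw [laxA, laxA]; module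

lemma mul_laxA_sub {p : ℝ × ℝ} (hπ : π p ∈ isoProj n) (hq : q p ∈ borel n) :
    π p * laxA q α₂ p - laxA (newSol q α₁ α₂ π) α₂ p * π p
      = π p * laxA q α₂ p - laxA q α₁ p * π p + π p * (laxA q α₁ p - laxA q α₂ p) * π p := by
  rw [laxA_newSol]
  exact mul_sub_dressed_mul _ hπ (sharp_laxA hq _) (sharp_laxA hq _) (sub_smul_beta p)

/-- The adjoint of the Riccati equation of `P` is the one of `P♯` with the poles exchanged. -/
lemma sharp_riccati {P B₁ B₂ : Mat n} (h₁ : sharp B₁ = -B₁) (h₂ : sharp B₂ = -B₂) :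
    sharp (P * B₂ - B₁ * P + P * (B₁ - B₂) * P)
      = sharp P * B₁ - B₂ * sharp P - sharp P * (B₁ - B₂) * sharp P := by
  simp only [sharp_add, sharp_sub, sharp_mul, h₁, h₂]
  noncomm_ring

lemma newSol_mem_borel {p : ℝ × ℝ} (hq : q p ∈ borel n) : newSol q α₁ α₂ π p ∈ borel n :=
  add_smul_lie_beta_mem_borel hq (by rw [sharp_sub, sharp_sharp, neg_sub]) _

lemma smoothOn_lie (A : Mat n) {f : ℝ × ℝ → Mat n} (hf : SmoothOn U f) :
    SmoothOn U fun p => ⁅A, f p⁆ :=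
  (((smoothOn_const A).mul hf).sub (hf.mul (smoothOn_const A))).congr fun _ _ => Ring.lie_def _ _

lemma smoothOn_newSol (hq : SmoothOn V q) (hπ : SmoothOn V π) : SmoothOn V (newSol q α₁ α₂ π) :=
  hq.add ((smoothOn_lie _ (hπ.sub hπ.sharp)).smul _)

lemma smoothOn_laxA (hq : SmoothOn V q) (α : ℝ) : SmoothOn V (laxA q α) :=
  (smoothOn_const _).add hq

lemma loopDeriv_eq_zero_of_const (hU : IsOpen U) {X : smoothLoops n U} {Y : Loop n}
    (h : ∀ p, X.1 p = Y) : loopDeriv hU X = 0 := by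
  refine smoothLoops_ext fun p i => ?_
  rw [lcoeff_loopDeriv, dirDeriv_congr (g := fun _ => lcoeff i Y) _ hU
    (fun p' hp' => by rw [famCoeff_of_mem _ _ hp', h]) p.2, dirDeriv_const]
  rfl

lemma loopDeriv_smul_of_const (hU : IsOpen U) (g : Subring.center (smoothLoops n U)) {Y : Loop n}
    (h : ∀ p, g.1.1 p = Y) (X : smoothLoops n U) : loopDeriv hU (g • X) = g • loopDeriv hU X := by
  change loopDeriv hU (g.1 * X) = g.1 * loopDeriv hU X
  rw [loopDeriv_mul, loopDeriv_eq_zero_of_const hU h, zero_mul, zero_add]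

/-- Conjugation by a solution `F` of `F_x = F B - C F` carries solutions of `[∂ + B, T] = 0` to
solutions of `[∂ + C, T] = 0`. -/
lemma gauge_commute {R : Type*} [Ring R] (δ : R →+ R) (hδ : ∀ x y, δ (x * y) = δ x * y + x * δ y)
    {F F' B C T : R} (h : F * F' = 1) (h' : F' * F = 1) (hF : δ F = F * B - C * F)
    (hT : δ T + (B * T - T * B) = 0) :
    δ (F * T * F') + (C * (F * T * F') - F * T * F' * C) = 0 := by
  have h1 : δ (1 : R) = 0 := by
    have := hδ 1 1
    simp only [mul_one, one_mul] at this
    simpa using this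
  have hF' : δ F' = F' * C - B * F' := by
    have e : F * δ F' = C - F * B * F' := by
      have e1 := hδ F F'
      rw [h, h1, hF, sub_mul, mul_assoc C, h, mul_one] at e1
      rw [eq_sub_iff_add_eq, ← sub_eq_zero, e1]
      abel
    calc δ F' = F' * (F * δ F') := by rw [← mul_assoc, h', one_mul]
      _ = F' * C - F' * F * B * F' := by rw [e]; noncomm_ring
      _ = _ := by rw [h', one_mul]
  have hT' : δ T = T * B - B * T := by rw [eq_neg_of_add_eq_zero_left hT, neg_sub]
  rw [hδ, hδ, hF, hF', hT']
  noncomm_ring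

lemma conj_pow_of_mul_eq_one {R : Type*} [Ring R] {F F' T : R} (h : F * F' = 1) (h' : F' * F = 1)
    (k : ℕ) : (F * T * F') ^ k = F * T ^ k * F' := by
  induction k with
  | zero => rw [pow_zero, pow_zero, mul_one, h]
  | succ k ih =>
    calc (F * T * F') ^ (k + 1) = F * T ^ k * (F' * F) * T * F' := by
          rw [pow_succ, ih]; noncomm_ring
      _ = _ := by rw [h', mul_one, pow_succ]; noncomm_ring

variable (π α₁ α₂) in
/-- The gauge factor `1 - c π / (λ - α₂) + c π♯ / (λ - α₁)` with `c = α₁ - α₂`. -/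
def gauge (hπ : SmoothOn V π) : smoothLoops n V :=
  darboux (constFam n V (α₁ - α₂)) (invPoleFam n V α₁) (invPoleFam n V α₂) (monFam 0 π hπ)
    (monFam 0 _ hπ.sharp)

variable (π α₁ α₂) in
/-- The inverse `1 - c π♯ / (λ - α₂) + c π / (λ - α₁)` of the gauge factor. -/
def gaugeInv (hπ : SmoothOn V π) : smoothLoops n V :=
  darboux (constFam n V (α₁ - α₂)) (invPoleFam n V α₁) (invPoleFam n V α₂) (monFam 0 _ hπ.sharp)
    (monFam 0 π hπ)

lemma isOrthogonalPair_monFam (hπ : SmoothOn V π) (hmem : ∀ p ∈ V, π p ∈ isoProj n) :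
    IsOrthogonalPair (monFam 0 π hπ) (monFam 0 _ hπ.sharp) := by
  have e : ∀ {f g h : ℝ × ℝ → Mat n} (hf : SmoothOn V f) (hg : SmoothOn V g) (hh : SmoothOn V h),
      (∀ p ∈ V, f p * g p = h p) → monFam 0 f hf * monFam 0 g hg = monFam 0 h hh := by
    intro f g h hf hg hh H
    refine Subtype.ext (funext fun p => ?_)
    change monomial 0 (f p) * monomial 0 (g p) = monomial 0 (h p)
    rw [monomial_mul_monomial, H p p.2, add_zero]
  have e0 : monFam 0 (fun _ => 0) (smoothOn_const 0) = (0 : smoothLoops n V) :=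
    smoothLoops_ext fun p i => by simp [monFam, monomial]
  exact ⟨e _ _ _ fun p hp => (isOrthogonalPair_sharp (hmem p hp)).left,
    e _ _ _ fun p hp => (isOrthogonalPair_sharp (hmem p hp)).right,
    (e _ _ _ fun p hp => (isOrthogonalPair_sharp (hmem p hp)).left_right).trans e0,
    (e _ _ _ fun p hp => (isOrthogonalPair_sharp (hmem p hp)).right_left).trans e0⟩

lemma gauge_mul_gaugeInv (hπ : SmoothOn V π) (hmem : ∀ p ∈ V, π p ∈ isoProj n) :
    gauge π α₁ α₂ hπ * gaugeInv π α₁ α₂ hπ = 1 :=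
  darboux_mul (invPoleFam_sub α₁ α₂) (isOrthogonalPair_monFam hπ hmem)

lemma gaugeInv_mul_gauge (hπ : SmoothOn V π) (hmem : ∀ p ∈ V, π p ∈ isoProj n) :
    gaugeInv π α₁ α₂ hπ * gauge π α₁ α₂ hπ = 1 :=
  darboux_mul (invPoleFam_sub α₁ α₂) (isOrthogonalPair_monFam hπ hmem).symm

/-- The vanishing products `π W π♯` and `π♯ W π` for a skew series `W`. -/
lemma monFam_mul_mul_sharp (hπ : SmoothOn V π) (hmem : ∀ p ∈ V, π p ∈ isoProj n)
    {W : smoothLoops n V} (hW : sharpFam W = -W) :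
    monFam 0 π hπ * W * monFam 0 _ hπ.sharp = 0 ∧ monFam 0 _ hπ.sharp * W * monFam 0 π hπ = 0 := by
  have hs : ∀ p i, sharp (lcoeff i (W.1 p)) = -lcoeff i (W.1 p) := fun p i =>
    congrArg (fun Y : smoothLoops n V => lcoeff i (Y.1 p)) hW
  constructor
  · refine smoothLoops_ext fun p i => ?_
    change lcoeff i (monomial 0 (π p) * W.1 p * monomial 0 (sharp (π p))) = 0
    rw [lcoeff_mul_monomial, lcoeff_monomial_mul]
    exact mul_mul_sharp_eq_zero (hmem p p.2).2.1 (hs p _)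
  · refine smoothLoops_ext fun p i => ?_
    change lcoeff i (monomial 0 (sharp (π p)) * W.1 p * monomial 0 (π p)) = 0
    rw [lcoeff_mul_monomial, lcoeff_monomial_mul]
    exact sharp_mul_mul_eq_zero (hmem p p.2).2.1 (hs p _)

lemma sharpFam_laxFam (hq : SmoothOn V q) (hb : ∀ p ∈ V, q p ∈ borel n) :
    sharpFam (laxFam q hq) = -laxFam q hq := by
  rw [laxFam, sharpFam_add, sharpFam_cyclicFam,
    sharpFam_monFam_of_skew _ _ fun p hp => sharp_eq_neg_of_mem_borel (hb p hp)]
  abel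

lemma laxFam_sub_monFam_laxA (hq : SmoothOn V q) (α : ℝ) :
    invPoleFam n V α • (laxFam q hq - monFam 0 _ (smoothOn_laxA hq α))
      = monFam 0 (fun _ => beta n) (smoothOn_const _) := by
  refine Subtype.ext (funext fun p => ?_)
  change invPole n α * ((laxFam q hq).1 p - monomial 0 (laxA q α p)) = monomial 0 (beta n)
  have e : (laxFam q hq).1 p - monomial 0 (laxA q α p)
      = (monomial 1 1 - monomial 0 (α • (1 : Mat n))) * monomial 0 (beta n) := by
    rw [laxFam_apply, laxLoop, laxA, sub_mul, monomial_mul_monomial, monomial_mul_monomial,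
      one_mul, Matrix.smul_mul, one_mul, add_zero, add_zero, add_assoc (α • beta n),
      monomial_add 0 (α • beta n)]
    abel
  rw [e, ← mul_assoc, invPole_comm, pole_mul_invPole, one_mul]

lemma laxFam_newSol (hq : SmoothOn V q) (hπ : SmoothOn V π) :
    laxFam (newSol q α₁ α₂ π) (smoothOn_newSol hq hπ)
      = dressed (constFam n V (α₁ - α₂)) (monFam 0 π hπ) (monFam 0 _ hπ.sharp) (laxFam q hq)
        (monFam 0 (fun _ => beta n) (smoothOn_const _))
        (monFam 0 (fun _ => beta n) (smoothOn_const _)) := by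
  rw [dressed_self]
  simp only [constFam_smul]
  refine Subtype.ext (funext fun p => ?_)
  change (laxFam _ (smoothOn_newSol hq hπ)).1 p = (laxFam q hq).1 p
    - (α₁ - α₂) • (monomial 0 (π p) * monomial 0 (beta n))
    + (α₁ - α₂) • (monomial 0 (sharp (π p)) * monomial 0 (beta n))
    - (α₁ - α₂) • (monomial 0 (beta n) * monomial 0 (sharp (π p)))
    + (α₁ - α₂) • (monomial 0 (beta n) * monomial 0 (π p))
  refine loop_ext fun i => ?_
  simp only [laxFam_apply, laxLoop, monomial_mul_monomial, add_zero, lcoeff_add, lcoeff_sub,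
    lcoeff_smul, lcoeff_monomial]
  by_cases hi : i = 0
  · subst hi
    simp only [if_true, newSol, Ring.lie_def, mul_sub, sub_mul]
    module
  · simp [hi]

lemma IsBTxSolutionOn.riccati (hb : ∀ p ∈ V, q p ∈ borel n) (hπ : IsBTxSolutionOn V q α₁ α₂ π)
    {p : ℝ × ℝ} (hp : p ∈ V) : dx π p = π p * laxA q α₂ p - laxA q α₁ p * π p
      + π p * (laxA q α₁ p - laxA q α₂ p) * π p := by
  rw [hπ.eq_x p hp, mul_laxA_sub (hπ.mem_isoProj p hp) (hb p hp)]

/-- The gauge factor intertwines the operators `∂_x + β λ + b + q` of the old and of the new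
potential, because its residues satisfy the Riccati equation. -/
lemma loopDeriv_gauge (hn : 1 ≤ n) (hV : IsOpen V) (hq : SmoothOn V q)
    (hb : ∀ p ∈ V, q p ∈ borel n) (hπ : IsBTxSolutionOn V q α₁ α₂ π) :
    loopDeriv hV (gauge π α₁ α₂ hπ.smooth) = gauge π α₁ α₂ hπ.smooth * laxFam q hq
      - laxFam (newSol q α₁ α₂ π) (smoothOn_newSol hq hπ.smooth) * gauge π α₁ α₂ hπ.smooth := by
  have hskew : ∀ α, sharpFam (monFam 0 _ (smoothOn_laxA hq α)) = -monFam 0 _ (smoothOn_laxA hq α) :=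
    fun α => sharpFam_monFam_of_skew _ _ fun p hp => sharp_laxA (hb p hp) α
  have hl := sharpFam_laxFam hq hb
  have h := darboux_deriv (invPoleFam_sub (n := n) (U := V) α₁ α₂)
    (isOrthogonalPair_monFam hπ.smooth hπ.mem_isoProj)
    (monFam_mul_mul_sharp hπ.smooth hπ.mem_isoProj hl).1
    (monFam_mul_mul_sharp hπ.smooth hπ.mem_isoProj (hskew α₂)).1
    (monFam_mul_mul_sharp hπ.smooth hπ.mem_isoProj hl).2
    (monFam_mul_mul_sharp hπ.smooth hπ.mem_isoProj (hskew α₁)).2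
  rw [laxFam_sub_monFam_laxA, laxFam_sub_monFam_laxA, ← laxFam_newSol hq hπ.smooth] at h
  rw [gauge, ← h]
  have hdx : ∀ p ∈ V, dirDeriv (1, 0) π p = π p * laxA q α₂ p - laxA q α₁ p * π p
      + π p * (laxA q α₁ p - laxA q α₂ p) * π p := fun p hp => by
    rw [← dx_eq_dirDeriv hπ.smooth hV hp, hπ.riccati hb hp]
  have h1 : loopDeriv hV (monFam 0 π hπ.smooth) = monFam 0 π hπ.smooth
        * monFam 0 _ (smoothOn_laxA hq α₂) - monFam 0 _ (smoothOn_laxA hq α₁) * monFam 0 π hπ.smooth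
      + monFam 0 π hπ.smooth * (monFam 0 _ (smoothOn_laxA hq α₁)
        - monFam 0 _ (smoothOn_laxA hq α₂)) * monFam 0 π hπ.smooth := by
    rw [loopDeriv_monFam hV 0 π hπ.smooth (smoothOn_dirDeriv _ hπ.smooth hV) fun _ _ => rfl]
    refine Subtype.ext (funext fun p => ?_)
    change monomial 0 (dirDeriv (1, 0) π p) = monomial 0 (π p) * monomial 0 (laxA q α₂ p)
      - monomial 0 (laxA q α₁ p) * monomial 0 (π p)
      + monomial 0 (π p) * (monomial 0 (laxA q α₁ p) - monomial 0 (laxA q α₂ p))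
        * monomial 0 (π p)
    simp only [← monomial_sub, monomial_mul_monomial, ← monomial_add, add_zero, hdx p p.2]
  have h2 : loopDeriv hV (monFam 0 _ hπ.smooth.sharp) = monFam 0 _ hπ.smooth.sharp
        * monFam 0 _ (smoothOn_laxA hq α₁)
        - monFam 0 _ (smoothOn_laxA hq α₂) * monFam 0 _ hπ.smooth.sharp
      - monFam 0 _ hπ.smooth.sharp * (monFam 0 _ (smoothOn_laxA hq α₁)
        - monFam 0 _ (smoothOn_laxA hq α₂)) * monFam 0 _ hπ.smooth.sharp := by
    rw [loopDeriv_monFam hV 0 _ hπ.smooth.sharp (smoothOn_dirDeriv (1, 0) hπ.smooth.sharp hV)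
      fun _ _ => rfl]
    refine Subtype.ext (funext fun p => ?_)
    change monomial 0 (dirDeriv (1, 0) (fun p => sharp (π p)) p)
      = monomial 0 (sharp (π p)) * monomial 0 (laxA q α₁ p)
      - monomial 0 (laxA q α₂ p) * monomial 0 (sharp (π p))
      - monomial 0 (sharp (π p)) * (monomial 0 (laxA q α₁ p) - monomial 0 (laxA q α₂ p))
        * monomial 0 (sharp (π p))
    rw [dirDeriv_sharp _ hπ.smooth hV p.2, hdx p p.2,
      sharp_riccati (sharp_laxA (hb p p.2) _) (sharp_laxA (hb p p.2) _)]
    simp only [← monomial_sub, monomial_mul_monomial, add_zero]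
  rw [← h1, ← h2, darboux]
  change (smoothLoopsFiltered n hn hV).δ _ = _
  rw [map_add, map_sub]
  change loopDeriv hV _ - loopDeriv hV _ + loopDeriv hV _ = _
  have hconst : ∀ α, ∀ p : V, (constFam n V (α₁ - α₂) * invPoleFam n V α).1.1 p
      = algebraMap ℝ (Loop n) (α₁ - α₂) * invPole n α := fun _ _ => rfl
  rw [loopDeriv_smul_of_const hV _ (hconst α₁), loopDeriv_smul_of_const hV _ (hconst α₂),
    loopDeriv_eq_zero_of_const hV (Y := 1) fun _ => rfl]
  have hz : ∀ x : smoothLoops n V, 0 - x = -x := fun x => zero_sub x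
  exact congrArg (· + _) (hz _)

/-- Conjugation by the gauge factor `F` carries the resolvent series of `q` to that of the new
potential. The leading coefficient stays `β` because `F` and its inverse are `1 + O(λ⁻¹)`. -/
lemma isResolventOn_gauge (hn : 1 ≤ n) (hV : IsOpen V) (hq : SmoothOn V q)
    (hb : ∀ p ∈ V, q p ∈ borel n) (hπ : IsBTxSolutionOn V q α₁ α₂ π) {T : ℝ × ℝ → Loop n}
    (hT : IsResolventOn V q T) : IsResolventOn V (newSol q α₁ α₂ π)
      (extendFam (gauge π α₁ α₂ hπ.smooth * hT.fam * gaugeInv π α₁ α₂ hπ.smooth)) := by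
  set F := gauge π α₁ α₂ hπ.smooth with hF
  set F' := gaugeInv π α₁ α₂ hπ.smooth with hF'
  have hFF' : F * F' = 1 := gauge_mul_gaugeInv hπ.smooth hπ.mem_isoProj
  have hF'F : F' * F = 1 := gaugeInv_mul_gauge hπ.smooth hπ.mem_isoProj
  have hsmall : ∀ {f g : ℝ × ℝ → Mat n} (hf : SmoothOn V f) (hg : SmoothOn V g) (p : V),
      HasDegreeLE (-1) (((darboux (constFam n V (α₁ - α₂)) (invPoleFam n V α₁) (invPoleFam n V α₂)
        (monFam 0 f hf) (monFam 0 g hg) : smoothLoops n V) - 1).1 p) := by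
    intro f g hf hg p i hi
    have e : darboux (constFam n V (α₁ - α₂)) (invPoleFam n V α₁) (invPoleFam n V α₂)
        (monFam 0 f hf) (monFam 0 g hg) - 1 = (α₁ - α₂) • (invPoleFam n V α₁ • monFam 0 g hg)
        - (α₁ - α₂) • (invPoleFam n V α₂ • monFam 0 f hf) := by
      rw [darboux_sub_one, constFam_smul, constFam_smul]
    rw [e]
    change lcoeff i ((α₁ - α₂) • (invPole n α₁ * monomial 0 (g p))
      - (α₁ - α₂) • (invPole n α₂ * monomial 0 (f p))) = 0
    rw [lcoeff_sub, lcoeff_smul, lcoeff_smul, lcoeff_mul_monomial, lcoeff_mul_monomial, sub_zero,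
      hasDegreeLE_invPole α₁ i hi, hasDegreeLE_invPole α₂ i hi]
    simp
  have hdiff : ∀ p, HasDegreeLE 0 ((F * hT.fam * F').1 p - T p) := by
    intro p
    have e : (F * hT.fam * F').1 p - T p = (F - 1).1 p * T p * ((F' - 1).1 p)
        + (F - 1).1 p * T p + T p * (F' - 1).1 p :=
      mul_mul_sub _ _ _
    have hT1 : HasDegreeLE 1 (T p) := hT.coeff_of_gt p p.2
    have a1 : HasDegreeLE (-1) ((F - 1).1 p) := hsmall hπ.smooth hπ.smooth.sharp p
    have a2 : HasDegreeLE (-1) ((F' - 1).1 p) := hsmall hπ.smooth.sharp hπ.smooth p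
    intro i hi
    rw [e, lcoeff_add, lcoeff_add, ((a1.mul hT1).mul a2) i (by omega), (a1.mul hT1) i (by omega),
      (hT1.mul a2) i (by omega)]
    simp
  refine isResolventOn_extendFam hV (smoothOn_newSol hq hπ.smooth) ?_ ?_ ?_ ?_
  · intro p i hi
    have := hdiff p i (by omega)
    rwa [lcoeff_sub, hT.coeff_of_gt p p.2 i hi, sub_zero] at this
  · intro p
    have := hdiff p 1 (by omega)
    rwa [lcoeff_sub, hT.coeff_one p p.2, sub_eq_zero] at this
  · exact gauge_commute ((smoothLoopsFiltered n hn hV).δ : smoothLoops n V →+ smoothLoops n V)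
      (loopDeriv_mul hV) hFF' hF'F (loopDeriv_gauge hn hV hq hb hπ)
      (hT.isResolvent hn hV hq hb).commute
  · have hz := (isCyclic n hn hV).z_comm F
    rw [conj_pow_of_mul_eq_one (R := smoothLoops n V) hFF' hF'F,
      (hT.isResolvent hn hV hq hb).pow_eq, ← mul_assoc F, ← hz]
    simp only [mul_assoc]

end GaugeTransformation

/-! ### The Lax matrix of the new potential -/

section LaxB
open Matrix
variable {n j : ℕ} {U V : Set (ℝ × ℝ)} {q π : ℝ × ℝ → Mat n} {α₁ α₂ : ℝ}

lemma laxB_eq_evalPlus (U : Set (ℝ × ℝ)) (j : ℕ) (q : ℝ × ℝ → Mat n) (α : ℝ) (p : ℝ × ℝ) :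
    laxB U j q α p = evalPlus (2 * j) α (resolvent U q p ^ (2 * j - 1)) := rfl

/-- The polynomial part of `T^{2j-1} / (λ - a)` at `λ = α`, which is the divided difference of
`B(q, ·)` at `a` and `α`. -/
def divDiffB (U : Set (ℝ × ℝ)) (j : ℕ) (q : ℝ × ℝ → Mat n) (a α : ℝ) (p : ℝ × ℝ) : Mat n :=
  evalPlus (2 * j) α (invPole n a * resolvent U q p ^ (2 * j - 1))

lemma hasDegreeLE_resolvent_pow (hn : 1 ≤ n) (hU : IsOpen U) (hq : IsFlowSolutionOn U j q)
    {p : ℝ × ℝ} (hp : p ∈ U) :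
    HasDegreeLE ((2 * j - 1 : ℕ) : ℤ) (resolvent U q p ^ (2 * j - 1)) := by
  have hT := isResolventOn_resolvent hn hU hq.smooth hq.mem_borel
  have h1 : HasDegreeLE 1 (resolvent U q p) := hT.coeff_of_gt p hp
  exact (h1.pow _).mono (by omega)

lemma sub_smul_divDiffB (hn : 1 ≤ n) (hU : IsOpen U) (hq : IsFlowSolutionOn U j q)
    (hj : 1 ≤ j) {p : ℝ × ℝ} (hp : p ∈ U) (a α : ℝ) :
    (α - a) • divDiffB U j q a α p = laxB U j q α p - laxB U j q a p := by
  have h := sub_smul_evalPlus_invPole_mul (hasDegreeLE_resolvent_pow hn hU hq hp) α a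
  rwa [show 2 * j - 1 + 1 = 2 * j by omega] at h

lemma sharpFam_pow_odd {T : smoothLoops n U} (hT : sharpFam T = -T) {k : ℕ} (hk : Odd k) :
    sharpFam (T ^ k) = -T ^ k := by
  rw [sharpFam_pow, hT]
  have h : ∀ {R : Type} [Ring R] (x : R), (-x) ^ k = -x ^ k := fun x => hk.neg_pow x
  exact h (R := smoothLoops n U) T

lemma IsResolventOn.sharpFam_fam_pow {T : ℝ × ℝ → Loop n} (hT : IsResolventOn U q T) (hn : 1 ≤ n)
    (hU : IsOpen U) (hq : SmoothOn U q) (hb : ∀ p ∈ U, q p ∈ borel n) (hj : 1 ≤ j) :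
    sharpFam (hT.fam ^ (2 * j - 1)) = -hT.fam ^ (2 * j - 1) :=
  sharpFam_pow_odd (sharpFam_resolvent hn hU hq hb (hT.isResolvent hn hU hq hb))
    (by rw [Nat.odd_iff]; omega)

lemma sharp_resCoeff (hn : 1 ≤ n) (hU : IsOpen U) (hq : IsFlowSolutionOn U j q)
    (hj : 1 ≤ j) {p : ℝ × ℝ} (hp : p ∈ U) (i : ℤ) :
    sharp (resCoeff U j q i p) = -resCoeff U j q i p :=
  congrArg (fun Y : smoothLoops n U => lcoeff i (Y.1 ⟨p, hp⟩))
    ((isResolventOn_resolvent hn hU hq.smooth hq.mem_borel).sharpFam_fam_pow hn hU hq.smooth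
      hq.mem_borel hj)

lemma sharp_laxB (hn : 1 ≤ n) (hU : IsOpen U) (hq : IsFlowSolutionOn U j q)
    (hj : 1 ≤ j) {p : ℝ × ℝ} (hp : p ∈ U) (α : ℝ) :
    sharp (laxB U j q α p) = -laxB U j q α p := by
  rw [laxB, sharp_sum, ← Finset.sum_neg_distrib]
  exact Finset.sum_congr rfl fun i _ => by
    rw [sharp_smul, sharp_resCoeff hn hU hq hj hp, smul_neg]

lemma evalPlus_dressed (m : ℕ) (α c : ℝ) (P S : Mat n) (W X₁ X₂ : Loop n) :
    evalPlus m α (W - c • (monomial 0 P * X₂) + c • (monomial 0 S * X₁) - c • (X₂ * monomial 0 S)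
      + c • (X₁ * monomial 0 P) - c • (monomial 0 P * (X₁ - X₂) * monomial 0 P)
      - c • (monomial 0 S * (X₁ - X₂) * monomial 0 S))
    = dressed c P S (evalPlus m α W) (evalPlus m α X₁) (evalPlus m α X₂) := by
  simp only [dressed, evalPlus_add, evalPlus_sub, evalPlus_smul, evalPlus_monomial_mul,
    evalPlus_mul_monomial]

/-- The value of `B(q̃, λ)` in terms of `B(q, λ)` and `π` alone: it is the polynomial part of
`F T^{2j-1} F⁻¹`, and the poles of `F` only produce divided differences. -/
theorem laxB_newSol (hn : 1 ≤ n) (hU : IsOpen U) (hq : IsFlowSolutionOn U j q) (hj : 1 ≤ j)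
    (hV : IsOpen V) (hVU : V ⊆ U) (hπ : IsBTxSolutionOn V q α₁ α₂ π) {p : ℝ × ℝ} (hp : p ∈ V)
    (α : ℝ) : laxB V j (newSol q α₁ α₂ π) α p = dressed (α₁ - α₂) (π p) (sharp (π p))
      (laxB U j q α p) (divDiffB U j q α₁ α p) (divDiffB U j q α₂ α p) := by
  have hqV := hq.smooth.mono hVU
  have hbV : ∀ p ∈ V, q p ∈ borel n := fun p hp => hq.mem_borel p (hVU hp)
  have hT := (isResolventOn_resolvent hn hU hq.smooth hq.mem_borel).mono hVU
  have hb' : ∀ p ∈ V, newSol q α₁ α₂ π p ∈ borel n := fun p hp => newSol_mem_borel (hbV p hp)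
  have hq' := smoothOn_newSol (α₁ := α₁) (α₂ := α₂) hqV hπ.smooth
  -- by uniqueness the resolvent of the new potential is `F T F⁻¹`
  have e1 := (isResolventOn_resolvent hn hV hq' hb').unique
    (isResolventOn_gauge hn hV hqV hbV hπ hT) hn hV hq' hb' hp
  rw [extendFam_of_mem _ hp] at e1
  have hFF' := gauge_mul_gaugeInv (α₁ := α₁) (α₂ := α₂) hπ.smooth hπ.mem_isoProj
  have hF'F := gaugeInv_mul_gauge (α₁ := α₁) (α₂ := α₂) hπ.smooth hπ.mem_isoProj
  have hW := monFam_mul_mul_sharp hπ.smooth hπ.mem_isoProj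
    (hT.sharpFam_fam_pow hn hV hqV hbV hj)
  have e2 : (gauge π α₁ α₂ hπ.smooth * hT.fam * gaugeInv π α₁ α₂ hπ.smooth) ^ (2 * j - 1)
      = dressed (constFam n V (α₁ - α₂)) (monFam 0 π hπ.smooth) (monFam 0 _ hπ.smooth.sharp)
        (hT.fam ^ (2 * j - 1)) (invPoleFam n V α₁ • hT.fam ^ (2 * j - 1))
        (invPoleFam n V α₂ • hT.fam ^ (2 * j - 1)) :=
    (conj_pow_of_mul_eq_one (R := smoothLoops n V) hFF' hF'F _).trans
      (darboux_conj (invPoleFam_sub (n := n) (U := V) α₁ α₂) hW.1 hW.2)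
  have e3 := congrArg (fun Y : smoothLoops n V => Y.1 ⟨p, hp⟩) e2
  simp only [dressed, constFam_smul] at e3
  rw [laxB_eq_evalPlus, e1, laxB_eq_evalPlus, divDiffB, divDiffB, ← evalPlus_dressed]
  exact congrArg (evalPlus _ _) e3

/-- The equation in `t` is of Riccati type as well. -/
lemma mul_laxB_sub (hn : 1 ≤ n) (hU : IsOpen U) (hq : IsFlowSolutionOn U j q) (hj : 1 ≤ j)
    (hV : IsOpen V) (hVU : V ⊆ U) (hπ : IsBTxSolutionOn V q α₁ α₂ π)
    {p : ℝ × ℝ} (hp : p ∈ V) :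
    π p * laxB U j q α₂ p - laxB V j (newSol q α₁ α₂ π) α₂ p * π p
      = π p * laxB U j q α₂ p - laxB U j q α₁ p * π p
        + π p * (laxB U j q α₁ p - laxB U j q α₂ p) * π p := by
  rw [laxB_newSol hn hU hq hj hV hVU hπ hp]
  refine mul_sub_dressed_mul _ (hπ.mem_isoProj p hp) (sharp_laxB hn hU hq hj (hVU hp) _)
    (sharp_laxB hn hU hq hj (hVU hp) _) ?_
  have := sub_smul_divDiffB hn hU hq hj (hVU hp) α₁ α₂
  rw [← neg_sub, neg_smul, this, neg_sub]

end LaxB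

/-! ### Polynomial dependence on the entries -/

section Polynomials
open Matrix
variable {n j : ℕ} {U V : Set (ℝ × ℝ)} {q π : ℝ × ℝ → Mat n} {α₁ α₂ : ℝ}

/-- The variables: the entries of `π` and of `2j` further matrices. -/
abbrev EntryVar (n j : ℕ) : Type :=
  (Fin (2 * n + 1) × Fin (2 * n + 1)) ⊕ (Fin (2 * j) × Fin (2 * n + 1) × Fin (2 * n + 1))

/-- Matrices of polynomials in the entries. -/
abbrev PolyMat (n j : ℕ) : Type :=
  Matrix (Fin (2 * n + 1)) (Fin (2 * n + 1)) (MvPolynomial (EntryVar n j) ℝ)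

variable (n j) in
/-- The matrix with the entries of `π` as indeterminates. -/
def projPoly : PolyMat n j := Matrix.of fun a c => MvPolynomial.X (Sum.inl (a, c))

variable (n j) in
/-- The adjoint of `projPoly`. -/
def projSharpPoly : PolyMat n j := Matrix.of fun a c =>
  MvPolynomial.C ((-1) ^ ((a : ℕ) + c)) * MvPolynomial.X (Sum.inl (c.rev, a.rev))

variable (n) in
/-- The coefficient of `λ^m` of `T^{2j-1}` as a matrix of indeterminates, zero for `m ≥ 2j`. -/
def coeffPoly (j m : ℕ) : PolyMat n j := Matrix.of fun a c =>
  if h : m < 2 * j then MvPolynomial.X (Sum.inr (⟨m, h⟩, a, c)) else 0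

variable (n) in
/-- The value `B(q, α)` as a matrix of polynomials. -/
def laxBPoly (j : ℕ) (α : ℝ) : PolyMat n j := ∑ i ∈ Finset.range (2 * j), α ^ i • coeffPoly n j i

variable (n) in
/-- The divided difference `divDiffB` as a matrix of polynomials. -/
def divDiffPoly (j : ℕ) (a α : ℝ) : PolyMat n j :=
  ∑ i ∈ Finset.range (2 * j), α ^ i •
    ∑ k ∈ Finset.range (2 * j - 1), a ^ k • coeffPoly n j (i + 1 + k)

variable (n j) in
/-- Evaluation of a matrix of polynomials entry by entry, as an algebra homomorphism. -/
def evalEntries (x : EntryVar n j → ℝ) : PolyMat n j →ₐ[ℝ] Mat n :=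
  (MvPolynomial.aeval x).mapMatrix

lemma evalEntries_apply (x : EntryVar n j → ℝ) (M : PolyMat n j) (a c : Fin (2 * n + 1)) :
    evalEntries n j x M a c = MvPolynomial.eval x (M a c) := by
  rw [← MvPolynomial.coe_aeval_eq_eval]; rfl

lemma map_dressed {K R S : Type*} [CommRing K] [Ring R] [Ring S] [Algebra K R] [Algebra K S]
    (f : R →ₐ[K] S) (c : K) (π σ B D₁ D₂ : R) :
    f (dressed c π σ B D₁ D₂) = dressed c (f π) (f σ) (f B) (f D₁) (f D₂) := by
  simp only [dressed, map_add, map_sub, map_mul, map_smul]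

lemma evalEntries_coeffPoly (hn : 1 ≤ n) (hU : IsOpen U) (hq : IsFlowSolutionOn U j q)
    (hj : 1 ≤ j) {p : ℝ × ℝ} (hp : p ∈ U) (f : Fin (2 * n + 1) × Fin (2 * n + 1) → ℝ) (m : ℕ) :
    evalEntries n j (Sum.elim f fun e => resCoeff U j q ((e.1 : ℕ) : ℤ) p e.2.1 e.2.2)
      (coeffPoly n j m) = resCoeff U j q m p := by
  ext a c
  rw [evalEntries_apply, coeffPoly, of_apply]
  split_ifs with h
  · simp
  · rw [resCoeff, hasDegreeLE_resolvent_pow hn hU hq hp _ (by omega), map_zero, Matrix.zero_apply]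

/-- The formula of `laxB_newSol` at `λ = α₂`, read as a polynomial identity: the divided differences
are polynomials in the coefficients of `B`. -/
theorem exists_polynomial (hn : 1 ≤ n) (hj : 1 ≤ j) (α₁ α₂ : ℝ) :
    ∃ P : Fin (2 * n + 1) → Fin (2 * n + 1) → MvPolynomial (EntryVar n j) ℝ,
      ∀ (U : Set (ℝ × ℝ)) (q : ℝ × ℝ → Mat n), IsOpen U → IsFlowSolutionOn U j q →
        ∀ (V : Set (ℝ × ℝ)) (π : ℝ × ℝ → Mat n), IsOpen V → V ⊆ U →
          IsBTxSolutionOn V q α₁ α₂ π →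
          ∀ p ∈ V, ∀ a c, laxB V j (newSol q α₁ α₂ π) α₂ p a c =
            MvPolynomial.eval
              (Sum.elim (fun e => π p e.1 e.2)
                (fun e => resCoeff U j q ((e.1 : ℕ) : ℤ) p e.2.1 e.2.2)) (P a c) := by
  refine ⟨fun a c => dressed (α₁ - α₂) (projPoly n j) (projSharpPoly n j) (laxBPoly n j α₂)
    (divDiffPoly n j α₁ α₂) (divDiffPoly n j α₂ α₂) a c, ?_⟩
  intro U q hU hq V π hV hVU hπ p hp a c
  have hc := evalEntries_coeffPoly hn hU hq hj (hVU hp) fun e => π p e.1 e.2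
  rw [← evalEntries_apply, map_dressed, laxB_newSol hn hU hq hj hV hVU hπ hp]
  refine congrFun (congrFun ?_ a) c
  congr 1
  · ext a c
    rw [evalEntries_apply]
    simp [projPoly]
  · ext a c
    rw [evalEntries_apply]
    simp [projSharpPoly, sharp_apply]
  · simp only [laxBPoly, map_sum, map_smul, hc]
    rfl
  · simp only [divDiffPoly, map_sum, map_smul, hc, divDiffB, evalPlus]
    refine Finset.sum_congr rfl fun i _ => ?_
    rw [lcoeff_invPole_mul (hasDegreeLE_resolvent_pow hn hU hq (hVU hp))]
    rfl
  · simp only [divDiffPoly, map_sum, map_smul, hc, divDiffB, evalPlus]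
    refine Finset.sum_congr rfl fun i _ => ?_
    rw [lcoeff_invPole_mul (hasDegreeLE_resolvent_pow hn hU hq (hVU hp))]
    rfl

end Polynomials

/-! ### Zero curvature -/

section ZeroCurvature
open Matrix
variable {n j : ℕ} {U V : Set (ℝ × ℝ)} {q π : ℝ × ℝ → Mat n} {α₁ α₂ : ℝ}

/-- Powers of a solution of `[∂ + B, T] = 0` solve the same equation. -/
lemma pow_commute {R : Type*} [Ring R] (δ : R →+ R) (hδ : ∀ x y, δ (x * y) = δ x * y + x * δ y)
    {B T : R} (hT : δ T + (B * T - T * B) = 0) (k : ℕ) :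
    δ (T ^ k) + (B * T ^ k - T ^ k * B) = 0 := by
  induction k with
  | zero =>
    have := hδ 1 1
    simp only [mul_one, one_mul] at this
    simpa using this
  | succ k ih =>
    have e1 : δ T = T * B - B * T := by rw [eq_neg_of_add_eq_zero_left hT, neg_sub]
    have e2 : δ (T ^ k) = T ^ k * B - B * T ^ k := by rw [eq_neg_of_add_eq_zero_left ih, neg_sub]
    rw [pow_succ, hδ, e1, e2]
    noncomm_ring

lemma smoothOn_resCoeff (hn : 1 ≤ n) (hU : IsOpen U) (hq : SmoothOn U q)
    (hb : ∀ p ∈ U, q p ∈ borel n) (i : ℤ) : SmoothOn U (resCoeff U j q i) :=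
  (((isResolventOn_resolvent hn hU hq hb).fam ^ (2 * j - 1)).2.2 i).congr fun _ hp =>
    (famCoeff_of_mem i ((isResolventOn_resolvent hn hU hq hb).fam ^ (2 * j - 1)).1 hp).symm

lemma smoothOn_laxB (hn : 1 ≤ n) (hU : IsOpen U) (hq : SmoothOn U q)
    (hb : ∀ p ∈ U, q p ∈ borel n) (α : ℝ) : SmoothOn U (laxB U j q α) :=
  SmoothOn.sum fun _ _ => (smoothOn_resCoeff hn hU hq hb _).smul _

/-- The coefficient of `λ^i` in `[∂_x + β λ + b + q, T^{2j-1}] = 0`. -/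
lemma dirDeriv_resCoeff (hn : 1 ≤ n) (hU : IsOpen U) (hq : SmoothOn U q)
    (hb : ∀ p ∈ U, q p ∈ borel n) (i : ℤ) {p : ℝ × ℝ} (hp : p ∈ U) :
    dirDeriv (1, 0) (resCoeff U j q i) p
      + (beta n * resCoeff U j q (i - 1) p - resCoeff U j q (i - 1) p * beta n)
      + ((bmat n + q p) * resCoeff U j q i p - resCoeff U j q i p * (bmat n + q p)) = 0 := by
  have hT := isResolventOn_resolvent hn hU hq hb
  have h : loopDeriv hU (hT.fam ^ (2 * j - 1))
      + (laxFam q hq * hT.fam ^ (2 * j - 1) - hT.fam ^ (2 * j - 1) * laxFam q hq) = 0 :=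
    pow_commute ((smoothLoopsFiltered n hn hU).δ : smoothLoops n U →+ smoothLoops n U)
      (loopDeriv_mul hU) (hT.isResolvent hn hU hq hb).commute _
  have h1 := congrArg (fun Y : smoothLoops n U => lcoeff i (Y.1 ⟨p, hp⟩)) h
  change lcoeff i ((loopDeriv hU _).1 ⟨p, hp⟩) + lcoeff i ((laxFam q hq).1 ⟨p, hp⟩ *
    resolvent U q p ^ (2 * j - 1) - resolvent U q p ^ (2 * j - 1) * (laxFam q hq).1 ⟨p, hp⟩) = 0
    at h1
  rw [lcoeff_loopDeriv, laxFam_apply, ← lie_loop_def, lcoeff_lie_laxLoop, ← add_assoc] at h1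
  rw [← h1]
  congr 2
  exact dirDeriv_congr _ hU (fun p' hp' =>
    (famCoeff_of_mem i (hT.fam ^ (2 * j - 1)).1 hp').symm) hp

/-- The curvature of the connection `(A(λ), B(λ))`, apart from the term `q_t`, does not depend on
`λ`. -/
theorem dirDeriv_laxB (hn : 1 ≤ n) (hU : IsOpen U) (hq : SmoothOn U q)
    (hb : ∀ p ∈ U, q p ∈ borel n) (hj : 1 ≤ j) (α : ℝ) {p : ℝ × ℝ} (hp : p ∈ U) :
    dirDeriv (1, 0) (laxB U j q α) p
      + (laxA q α p * laxB U j q α p - laxB U j q α p * laxA q α p)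
    = dx (resCoeff U j q 0) p + ⁅bmat n + q p, resCoeff U j q 0 p⁆ := by
  have hT := isResolventOn_resolvent hn hU hq hb
  set R : ℤ → Mat n := fun i => resCoeff U j q i p with hR
  set c : ℤ → Mat n := fun i => beta n * R i - R i * beta n with hc
  have hd : ∀ i, dirDeriv (1, 0) (resCoeff U j q i) p
      = -c (i - 1) - ((bmat n + q p) * R i - R i * (bmat n + q p)) := fun i => by
    rw [eq_sub_iff_add_eq, eq_neg_iff_add_eq_zero, ← dirDeriv_resCoeff hn hU hq hb i hp]
    simp only [hc, hR]
    abel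
  have hdeg : R (2 * j : ℕ) = 0 := by
    have h1 : HasDegreeLE 1 (resolvent U q p) := hT.coeff_of_gt p hp
    exact (h1.pow (2 * j - 1)) _ (by omega)
  -- the leading coefficient of `T^{2j-1}` commutes with `β`
  have htop : c (2 * j - 1 : ℕ) = 0 := by
    have h := hd (2 * j : ℕ)
    have e : dirDeriv (1, 0) (resCoeff U j q (2 * j : ℕ)) p = 0 := by
      rw [dirDeriv_congr (g := fun _ => 0) _ hU (fun p' hp' => ?_) hp, dirDeriv_const]
      have h1 : HasDegreeLE 1 (resolvent U q p') := hT.coeff_of_gt p' hp'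
      exact (h1.pow (2 * j - 1)) _ (by omega)
    rw [e, hdeg, mul_zero, zero_mul, sub_self, sub_zero, eq_comm, neg_eq_zero] at h
    rw [← h]
    congr 1
    omega
  -- the terms with `β` cancel by telescoping
  have hsum : ∀ k : ℕ, ∑ i ∈ Finset.range (k + 1), α ^ i • c ((i : ℤ) - 1)
      = c (-1) + α • ∑ i ∈ Finset.range (k + 1), α ^ i • c i - α ^ (k + 1) • c k := by
    intro k
    induction k with
    | zero => simp
    | succ k ih =>
      rw [Finset.sum_range_succ, ih, Finset.sum_range_succ _ (k + 1)]
      push_cast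
      rw [add_sub_cancel_right]
      module
  have hsum' := hsum (2 * j - 1)
  rw [htop, show 2 * j - 1 + 1 = 2 * j by omega, smul_zero, sub_zero] at hsum'
  have hB : laxB U j q α p = ∑ i ∈ Finset.range (2 * j), α ^ i • R i := rfl
  have hdB : dirDeriv (1, 0) (laxB U j q α) p
      = -(∑ i ∈ Finset.range (2 * j), α ^ i • c ((i : ℤ) - 1))
        - ((bmat n + q p) * laxB U j q α p - laxB U j q α p * (bmat n + q p)) := by
    have e : dirDeriv (1, 0) (laxB U j q α) p
        = ∑ i ∈ Finset.range (2 * j), α ^ i • dirDeriv (1, 0) (resCoeff U j q (i : ℤ)) p := by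
      have hs := fun i : ℤ => smoothOn_resCoeff (j := j) hn hU hq hb i
      change dirDeriv (1, 0) (fun p => ∑ i ∈ Finset.range (2 * j), α ^ i • resCoeff U j q i p) p = _
      rw [dirDeriv_sum (f := fun (i : ℕ) p => α ^ i • resCoeff U j q i p) _
        (fun i _ => (hs i).smul _) hU hp]
      exact Finset.sum_congr rfl fun i _ => dirDeriv_smul _ _ (hs i) hU hp
    rw [e, hB, Finset.mul_sum, Finset.sum_mul, ← Finset.sum_sub_distrib, ← Finset.sum_neg_distrib,
      ← Finset.sum_sub_distrib]
    refine Finset.sum_congr rfl fun i _ => ?_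
    rw [hd, smul_sub, smul_neg, smul_sub, smul_sub, Matrix.mul_smul, Matrix.smul_mul]
  have hβ : ∑ i ∈ Finset.range (2 * j), α ^ i • c i
      = beta n * laxB U j q α p - laxB U j q α p * beta n := by
    rw [hB, Finset.mul_sum, Finset.sum_mul, ← Finset.sum_sub_distrib]
    exact Finset.sum_congr rfl fun i _ => by
      rw [Matrix.mul_smul, Matrix.smul_mul, ← smul_sub]
  rw [hdB, hsum', hβ, dx_eq_dirDeriv (smoothOn_resCoeff hn hU hq hb 0) hU hp, hd 0, zero_sub,
    Ring.lie_def, laxA, add_assoc (α • beta n), add_mul (α • beta n), mul_add _ (α • beta n),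
    Matrix.mul_smul, Matrix.smul_mul, smul_sub]
  abel

lemma dirDeriv_laxA (e : ℝ × ℝ) (hU : IsOpen U) (hq : SmoothOn U q) (α : ℝ) {p : ℝ × ℝ}
    (hp : p ∈ U) : dirDeriv e (laxA q α) p = dirDeriv e q p := by
  change dirDeriv e (fun p => α • beta n + bmat n + q p) p = _
  rw [dirDeriv_add _ (smoothOn_const _) hq hU hp, dirDeriv_const, zero_add]

/-- The flow equation is the zero curvature equation for `(A(λ), B(λ))`, for every `λ`. -/
lemma IsFlowSolutionOn.zero_curvature (hn : 1 ≤ n) (hU : IsOpen U) (hq : IsFlowSolutionOn U j q)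
    (hj : 1 ≤ j) (α : ℝ) {p : ℝ × ℝ} (hp : p ∈ U) :
    dirDeriv (0, 1) (laxA q α) p = dirDeriv (1, 0) (laxB U j q α) p
      + (laxA q α p * laxB U j q α p - laxB U j q α p * laxA q α p) := by
  rw [dirDeriv_laxB hn hU hq.smooth hq.mem_borel hj α hp, dirDeriv_laxA _ hU hq.smooth α hp,
    ← dt_eq_dirDeriv hq.smooth hU hp, hq.flow p hp]

/-- The gauge factor at a fixed value of the spectral parameter off the poles intertwines the
operators `∂ + B` and `∂ + B̃` in a direction in which `π` satisfies the Riccati equation. -/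
lemma dirDeriv_darboux (e : ℝ × ℝ) (hV : IsOpen V) (hπ : SmoothOn V π) {p : ℝ × ℝ} (hp : p ∈ V)
    (hmem : π p ∈ isoProj n) {c g₁ g₂ : ℝ} (hg : g₁ - g₂ = c * g₁ * g₂) {B B₁ B₂ D₁ D₂ : Mat n}
    (h : sharp B = -B) (h₁ : sharp B₁ = -B₁) (h₂ : sharp B₂ = -B₂)
    (hD₁ : g₁ • (B - B₁) = D₁) (hD₂ : g₂ • (B - B₂) = D₂)
    (hd : dirDeriv e π p = π p * B₂ - B₁ * π p + π p * (B₁ - B₂) * π p) :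
    dirDeriv e (fun p => darboux c g₁ g₂ (π p) (sharp (π p))) p
      = darboux c g₁ g₂ (π p) (sharp (π p)) * B
        - dressed c (π p) (sharp (π p)) B D₁ D₂ * darboux c g₁ g₂ (π p) (sharp (π p)) := by
  rw [← hD₁, ← hD₂, ← darboux_deriv hg (isOrthogonalPair_sharp hmem)
    (mul_mul_sharp_eq_zero hmem.2.1 h) (mul_mul_sharp_eq_zero hmem.2.1 h₂)
    (sharp_mul_mul_eq_zero hmem.2.1 h) (sharp_mul_mul_eq_zero hmem.2.1 h₁), ← sharp_riccati h₁ h₂,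
    ← hd, ← dirDeriv_sharp e hπ hV hp]
  have hc : SmoothOn V fun _ => (1 : Mat n) := smoothOn_const 1
  simp only [darboux]
  rw [dirDeriv_add e (hc.sub (hπ.smul _)) (hπ.sharp.smul _) hV hp,
    dirDeriv_sub e hc (hπ.smul _) hV hp, dirDeriv_const, dirDeriv_smul e _ hπ hV hp,
    dirDeriv_smul e _ hπ.sharp hV hp, zero_sub]

/-- A gauge transformation carries a flat connection to a flat connection. -/
lemma zero_curvature_of_gauge (hV : IsOpen V) {f A B A' B' : ℝ × ℝ → Mat n} (hf : SmoothOn V f)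
    (hA : SmoothOn V A) (hB : SmoothOn V B) (hA' : SmoothOn V A') (hB' : SmoothOn V B')
    (hx : ∀ p ∈ V, dirDeriv (1, 0) f p = f p * A p - A' p * f p)
    (ht : ∀ p ∈ V, dirDeriv (0, 1) f p = f p * B p - B' p * f p)
    (hinv : ∀ p ∈ V, ∃ g, f p * g = 1)
    (hflat : ∀ p ∈ V, dirDeriv (0, 1) A p = dirDeriv (1, 0) B p + (A p * B p - B p * A p))
    {p : ℝ × ℝ} (hp : p ∈ V) :
    dirDeriv (0, 1) A' p = dirDeriv (1, 0) B' p + (A' p * B' p - B' p * A' p) := by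
  have h := dirDeriv_comm (0, 1) (1, 0) hf hV hp
  rw [dirDeriv_congr _ hV hx hp, dirDeriv_congr _ hV ht hp,
    dirDeriv_sub _ (hf.mul hA) (hA'.mul hf) hV hp, dirDeriv_sub _ (hf.mul hB) (hB'.mul hf) hV hp,
    dirDeriv_mul _ hf hA hV hp, dirDeriv_mul _ hA' hf hV hp, dirDeriv_mul _ hf hB hV hp,
    dirDeriv_mul _ hB' hf hV hp, hx p hp, ht p hp, hflat p hp] at h
  obtain ⟨g, hg⟩ := hinv p hp
  have h' : (dirDeriv (0, 1) A' p - (dirDeriv (1, 0) B' p + (A' p * B' p - B' p * A' p))) * f p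
      = 0 := by
    rw [← sub_eq_zero] at h
    rw [← neg_eq_zero, ← h]
    noncomm_ring
  rw [← sub_eq_zero]
  calc _ = (dirDeriv (0, 1) A' p - (dirDeriv (1, 0) B' p + (A' p * B' p - B' p * A' p)))
        * (f p * g) := by rw [hg, mul_one]
    _ = 0 := by rw [← mul_assoc, h', zero_mul]

/-- A solution of the system `(BT)` yields a new solution of the flow: the gauge factor at one value
of the spectral parameter carries the flat connection of `q` to the connection of the new potential,
and flatness at one value of the parameter already is the flow equation by `dirDeriv_laxB`. -/
theorem isFlowSolutionOn_newSol (hn : 1 ≤ n) (hU : IsOpen U) (hq : IsFlowSolutionOn U j q)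
    (hj : 1 ≤ j) (hV : IsOpen V) (hVU : V ⊆ U) (hπ : IsBTSolutionOn U V j q α₁ α₂ π) :
    IsFlowSolutionOn V j (newSol q α₁ α₂ π) := by
  have hqV := hq.smooth.mono hVU
  have hbV : ∀ p ∈ V, q p ∈ borel n := fun p hp => hq.mem_borel p (hVU hp)
  have hq' := smoothOn_newSol (α₁ := α₁) (α₂ := α₂) hqV hπ.smooth
  have hb' : ∀ p ∈ V, newSol q α₁ α₂ π p ∈ borel n := fun p hp => newSol_mem_borel (hbV p hp)
  refine ⟨hq', hb', fun p hp => ?_⟩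
  -- any value of the spectral parameter off the two poles will do
  obtain ⟨l, hl⟩ := (Set.toFinite {α₁, α₂}).infinite_compl.nonempty
  have h₁ : l - α₁ ≠ 0 := sub_ne_zero.2 fun h => hl (Or.inl h)
  have h₂ : l - α₂ ≠ 0 := sub_ne_zero.2 fun h => hl (Or.inr h)
  have hg : (l - α₁)⁻¹ - (l - α₂)⁻¹ = (α₁ - α₂) * (l - α₁)⁻¹ * (l - α₂)⁻¹ := by
    field_simp
    ring
  have hA : ∀ α, l - α ≠ 0 → ∀ p, (l - α)⁻¹ • (laxA q l p - laxA q α p) = beta n := by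
    intro α hα p
    rw [show laxA q l p - laxA q α p = (l - α) • beta n by rw [laxA, laxA]; module, smul_smul,
      inv_mul_cancel₀ hα, one_smul]
  have hB : ∀ α, l - α ≠ 0 → ∀ p ∈ V, (l - α)⁻¹ • (laxB U j q l p - laxB U j q α p)
      = divDiffB U j q α l p := by
    intro α hα p hp
    rw [← sub_smul_divDiffB hn hU hq hj (hVU hp), smul_smul, inv_mul_cancel₀ hα, one_smul]
  have hc : SmoothOn V fun _ => (1 : Mat n) := smoothOn_const 1
  have hflat := zero_curvature_of_gauge hV
    (f := fun p => darboux (α₁ - α₂) (l - α₁)⁻¹ (l - α₂)⁻¹ (π p) (sharp (π p)))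
    ((hc.sub (hπ.smooth.smul _)).add (hπ.smooth.sharp.smul _))
    (smoothOn_laxA hqV l) ((smoothOn_laxB hn hU hq.smooth hq.mem_borel l).mono hVU)
    (smoothOn_laxA hq' l) (smoothOn_laxB (j := j) hn hV hq' hb' l)
    (fun p hp => by
      rw [laxA_newSol]
      refine dirDeriv_darboux _ hV hπ.smooth hp (hπ.mem_isoProj p hp) hg (sharp_laxA (hbV p hp) l)
        (sharp_laxA (hbV p hp) α₁) (sharp_laxA (hbV p hp) α₂) (hA _ h₁ p) (hA _ h₂ p) ?_
      rw [← dx_eq_dirDeriv hπ.smooth hV hp, hπ.riccati hbV hp])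
    (fun p hp => by
      have hs := sharp_laxB hn hU hq hj (hVU hp)
      rw [laxB_newSol hn hU hq hj hV hVU hπ.toIsBTxSolutionOn hp]
      refine dirDeriv_darboux _ hV hπ.smooth hp (hπ.mem_isoProj p hp) hg (hs l) (hs α₁) (hs α₂)
        (hB _ h₁ p hp) (hB _ h₂ p hp) ?_
      rw [← dt_eq_dirDeriv hπ.smooth hV hp, hπ.eq_t p hp,
        mul_laxB_sub hn hU hq hj hV hVU hπ.toIsBTxSolutionOn hp])
    (fun p hp => ⟨_, darboux_mul hg (isOrthogonalPair_sharp (hπ.mem_isoProj p hp))⟩)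
    (fun p hp => hq.zero_curvature hn hU hj l (hVU hp)) hp
  rw [dirDeriv_laxB hn hV hq' hb' hj l hp, dirDeriv_laxA _ hV hq' l hp,
    ← dt_eq_dirDeriv hq' hV hp] at hflat
  exact hflat

end ZeroCurvature

/-! ### Local solutions with a given initial value -/

section Existence
set_option maxSynthPendingDepth 3
open Matrix Metric
variable {n j : ℕ} {U V : Set (ℝ × ℝ)} {q π : ℝ × ℝ → Mat n} {α₁ α₂ : ℝ}

/-- A linear map on matrices in terms of its values on the matrix units. It reduces statements about
`S ∘ f` to the entries of `f`, so that no norm on the space of matrices is needed. -/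
lemma sum_smul_map_single {X : Type*} [AddCommGroup X] [Module ℝ X] (S : Mat n →ₗ[ℝ] X)
    (M : Mat n) : ∑ i, ∑ k, M i k • S (Matrix.single i k 1) = S M := by
  conv_rhs => rw [matrix_eq_sum_single M]
  simp only [map_sum, ← map_smul, smul_single, smul_eq_mul, mul_one]

lemma SmoothOn.contDiffOn_map {X : Type*} [NormedAddCommGroup X] [NormedSpace ℝ X]
    (S : Mat n →ₗ[ℝ] X) {f : ℝ × ℝ → Mat n} (hf : SmoothOn U f) :
    ContDiffOn ℝ ∞ (fun p => S (f p)) U := by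
  rw [show (fun p => S (f p)) = fun p => ∑ i, ∑ k, f p i k • S (Matrix.single i k 1) from
    funext fun p => (sum_smul_map_single S (f p)).symm]
  exact ContDiffOn.sum fun i _ => ContDiffOn.sum fun k _ => (hf i k).smul contDiffOn_const

lemma SmoothOn.hasFDerivAt_map {X : Type*} [NormedAddCommGroup X] [NormedSpace ℝ X]
    (S : Mat n →ₗ[ℝ] X) {f : ℝ × ℝ → Mat n} (hf : SmoothOn U f) (hU : IsOpen U) {p : ℝ × ℝ}
    (hp : p ∈ U) : DifferentiableAt ℝ (fun p => S (f p)) p ∧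
      ∀ h, fderiv ℝ (fun p => S (f p)) p h = S (dirDeriv h f p) := by
  have hd : HasFDerivAt (fun p => S (f p)) (∑ i, ∑ k,
      (fderiv ℝ (fun p => f p i k) p).smulRight (S (Matrix.single i k 1))) p := by
    rw [show (fun p => S (f p)) = fun p => ∑ i, ∑ k, f p i k • S (Matrix.single i k 1) from
      funext fun p => (sum_smul_map_single S (f p)).symm]
    exact HasFDerivAt.fun_sum fun i _ => HasFDerivAt.fun_sum fun k _ =>
      (hf.differentiableAt hU hp i k).hasFDerivAt.smul_const _
  refine ⟨hd.differentiableAt, fun h => ?_⟩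
  rw [hd.fderiv, ← sum_smul_map_single S]
  simp [dirDeriv]

lemma dirDeriv_eq (f : ℝ × ℝ → Mat n) (h p : ℝ × ℝ) :
    dirDeriv h f p = h.1 • dirDeriv (1, 0) f p + h.2 • dirDeriv (0, 1) f p := by
  ext i k
  simp only [dirDeriv, Matrix.of_apply, Matrix.add_apply, Matrix.smul_apply]
  rw [← map_smul, ← map_smul, ← map_add]
  congr 1
  ext <;> simp

variable (n) in
/-- The matrix `M` times the linear form `ℓ`, as a connection form on vectors. -/
def mulVecForm (ℓ : ℝ × ℝ →L[ℝ] ℝ) :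
    Mat n →ₗ[ℝ] (ℝ × ℝ →L[ℝ] (Fin (2 * n + 1) → ℝ) →L[ℝ] (Fin (2 * n + 1) → ℝ)) where
  toFun M := ℓ.smulRight (LinearMap.toContinuousLinearMap M.mulVecLin)
  map_add' M M' := ContinuousLinearMap.ext fun h => ContinuousLinearMap.ext fun v => by
    change ℓ h • ((M + M') *ᵥ v) = ℓ h • (M *ᵥ v) + ℓ h • (M' *ᵥ v)
    rw [add_mulVec, smul_add]
  map_smul' r M := ContinuousLinearMap.ext fun h => ContinuousLinearMap.ext fun v => by
    change ℓ h • ((r • M) *ᵥ v) = r • ℓ h • (M *ᵥ v)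
    rw [smul_mulVec, smul_comm]

lemma mulVecForm_apply (ℓ : ℝ × ℝ →L[ℝ] ℝ) (M : Mat n) (h : ℝ × ℝ) (v : Fin (2 * n + 1) → ℝ) :
    mulVecForm n ℓ M h v = ℓ h • (M *ᵥ v) := rfl

/-- A flat linear system `v_x = -A v`, `v_t = -B v` is locally solvable. -/
lemma exists_parallel_vector (hU : IsOpen U) {A B : ℝ × ℝ → Mat n} (hA : SmoothOn U A)
    (hB : SmoothOn U B) (flat : ∀ p ∈ U,
      dirDeriv (0, 1) A p = dirDeriv (1, 0) B p + (A p * B p - B p * A p))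
    {p₀ : ℝ × ℝ} (hp₀ : p₀ ∈ U) (v₀ : Fin (2 * n + 1) → ℝ) :
    ∃ ε > 0, ball p₀ ε ⊆ U ∧ ∃ v : ℝ × ℝ → Fin (2 * n + 1) → ℝ, v p₀ = v₀ ∧
      ContDiffOn ℝ ∞ v (ball p₀ ε) ∧
      ∀ p ∈ ball p₀ ε, ∀ h, fderiv ℝ v p h = -((h.1 • A p + h.2 • B p) *ᵥ v p) := by
  set S₁ := mulVecForm n (ContinuousLinearMap.fst ℝ ℝ ℝ) with hS₁
  set S₂ := mulVecForm n (ContinuousLinearMap.snd ℝ ℝ ℝ) with hS₂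
  have hS : ∀ (M N : Mat n) (h : ℝ × ℝ) v, (S₁ M + S₂ N) h v = (h.1 • M + h.2 • N) *ᵥ v := by
    intro M N h v
    rw [add_mulVec, smul_mulVec, smul_mulVec, _root_.add_apply, _root_.add_apply, mulVecForm_apply,
      mulVecForm_apply]
    rfl
  obtain ⟨ε, hε, hsub, v, hv0, hv, hd⟩ := exists_parallel_section hU
    (θ := fun p => S₁ (A p) + S₂ (B p)) ((hA.contDiffOn_map S₁).add (hB.contDiffOn_map S₂))
    (fun p hp h k v => by
      have h1 := hA.hasFDerivAt_map S₁ hU hp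
      have h2 := hB.hasFDerivAt_map S₂ hU hp
      have e : ∀ h, fderiv ℝ (fun p => S₁ (A p) + S₂ (B p)) p h
          = S₁ (dirDeriv h A p) + S₂ (dirDeriv h B p) := fun h => by
        rw [fderiv_fun_add h1.1 h2.1, _root_.add_apply, h1.2, h2.2]
      rw [e, e, hS, hS, hS, hS, hS, hS, mulVec_mulVec, mulVec_mulVec, ← sub_mulVec, ← sub_mulVec,
        ← add_mulVec, dirDeriv_eq A h, dirDeriv_eq A k, dirDeriv_eq B h, dirDeriv_eq B k, flat p hp]
      convert zero_mulVec v
      simp only [add_mul, mul_add, Matrix.smul_mul, Matrix.mul_smul]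
      module) hp₀ v₀
  refine ⟨ε, hε, hsub, v, hv0, hv, fun p hp h => ?_⟩
  rw [(hd p hp).fderiv, _root_.neg_apply, ContinuousLinearMap.flip_apply, hS]

lemma smoothOn_vecMulVec {v w : ℝ × ℝ → Fin (2 * n + 1) → ℝ} (hv : ContDiffOn ℝ ∞ v U)
    (hw : ContDiffOn ℝ ∞ w U) : SmoothOn U fun p => vecMulVec (v p) (w p) := fun i k =>
  ((contDiffOn_pi.1 hv i).mul (contDiffOn_pi.1 hw k))

lemma dirDeriv_vecMulVec {v w : ℝ × ℝ → Fin (2 * n + 1) → ℝ} {p : ℝ × ℝ}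
    (hv : DifferentiableAt ℝ v p) (hw : DifferentiableAt ℝ w p) (h : ℝ × ℝ) :
    dirDeriv h (fun p => vecMulVec (v p) (w p)) p
      = vecMulVec (fderiv ℝ v p h) (w p) + vecMulVec (v p) (fderiv ℝ w p h) := by
  ext i k
  have h1 : ∀ {u : ℝ × ℝ → Fin (2 * n + 1) → ℝ}, DifferentiableAt ℝ u p → ∀ i,
      HasFDerivAt (fun p => u p i) ((ContinuousLinearMap.proj i).comp (fderiv ℝ u p)) p :=
    fun hu i => hasFDerivAt_pi'.1 hu.hasFDerivAt i
  simp only [dirDeriv, Matrix.of_apply, vecMulVec_apply, Matrix.add_apply]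
  rw [((h1 hv i).fun_mul (h1 hw k)).fderiv]
  simp
  ring

/-- A solution of a linear system with coefficients in the Lie algebra that starts on the null cone
of the bilinear form stays there. -/
lemma dotProduct_rho_mulVec_eq_zero {p₀ : ℝ × ℝ} {ε : ℝ} (hε : 0 < ε)
    {v : ℝ × ℝ → Fin (2 * n + 1) → ℝ} (hv : ContDiffOn ℝ ∞ v (ball p₀ ε))
    (hd : ∀ p ∈ ball p₀ ε, ∀ h, ∃ C : Mat n, sharp C = -C ∧ fderiv ℝ v p h = C *ᵥ v p)
    (h0 : v p₀ ⬝ᵥ rho n *ᵥ v p₀ = 0) : ∀ p ∈ ball p₀ ε, v p ⬝ᵥ rho n *ᵥ v p = 0 := by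
  have htr : ∀ p, v p ⬝ᵥ rho n *ᵥ v p
      = (traceLinearMap _ ℝ ℝ ∘ₗ LinearMap.mulLeft ℝ (rho n)) (vecMulVec (v p) (v p)) := by
    intro p
    change _ = trace (rho n * vecMulVec (v p) (v p))
    rw [mul_vecMulVec, trace_vecMulVec, dotProduct_comm]
  have hs := smoothOn_vecMulVec hv hv
  have hconst : ∀ p ∈ ball p₀ ε, v p ⬝ᵥ rho n *ᵥ v p = v p₀ ⬝ᵥ rho n *ᵥ v p₀ := fun p hp =>
    isOpen_ball.is_const_of_fderiv_eq_zero (𝕜 := ℝ) (s := ball p₀ ε)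
    (f := fun p => v p ⬝ᵥ rho n *ᵥ v p) (convex_ball p₀ ε).isPreconnected (by
      simp only [htr]
      exact fun p hp => (hs.hasFDerivAt_map _ isOpen_ball hp).1.differentiableWithinAt) (by
      intro p hp
      have hvp : DifferentiableAt ℝ v p :=
        (hv.contDiffAt (isOpen_ball.mem_nhds hp)).differentiableAt (by simp)
      refine ContinuousLinearMap.ext fun h => ?_
      obtain ⟨C, hC, hCd⟩ := hd p hp h
      simp only [htr]
      rw [(hs.hasFDerivAt_map _ isOpen_ball hp).2 h, dirDeriv_vecMulVec hvp hvp, hCd]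
      change trace (rho n * (_ + _)) = 0
      have e : vecMulVec (v p) (C *ᵥ v p) = vecMulVec (v p) (v p) * Cᵀ := by
        rw [vecMulVec_mul, vecMul_transpose]
      rw [← mul_vecMulVec, e, mul_add, trace_add, trace_mul_comm (rho n) (_ * Cᵀ),
        trace_mul_comm (rho n), mul_assoc, mul_assoc, trace_mul_comm C, mul_assoc, ← trace_add,
        ← mul_add, add_comm (rho n * C), (mem_o_iff C).2 hC, mul_zero, trace_zero]) hp
      (mem_ball_self hε)
  exact fun p hp => (hconst p hp).trans h0

lemma vecMulVec_mul_mul_vecMulVec (v w v' w' : Fin (2 * n + 1) → ℝ) (X : Mat n) :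
    vecMulVec v w * X * vecMulVec v' w' = (w ⬝ᵥ X *ᵥ v') • vecMulVec v w' := by
  rw [mul_assoc, mul_vecMulVec, vecMulVec_mul_vecMulVec]
  ext i k
  simp [vecMulVec_apply]
  ring

lemma vecMulVec_mul_mul_self (v w : Fin (2 * n + 1) → ℝ) (X : Mat n) :
    vecMulVec v w * X * vecMulVec v w = trace (vecMulVec v w * X) • vecMulVec v w := by
  rw [vecMulVec_mul_mul_vecMulVec, trace_mul_comm, mul_vecMulVec, trace_vecMulVec,
    dotProduct_comm]

lemma sharp_vecMulVec (v w : Fin (2 * n + 1) → ℝ) :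
    sharp (vecMulVec v w) = vecMulVec (rho n *ᵥ w) (rho n *ᵥ v) := by
  rw [sharp, transpose_vecMulVec, mul_vecMulVec, vecMulVec_mul, ← mulVec_transpose, rho_transpose]

lemma rho_mulVec_ne_zero {v : Fin (2 * n + 1) → ℝ} (hv : v ≠ 0) : rho n *ᵥ v ≠ 0 := by
  intro h
  have := congrArg (rho n *ᵥ ·) h
  simp only [mulVec_mulVec, rho_mul_rho, one_mulVec, mulVec_zero] at this
  exact hv this

lemma vecMulVec_ne_zero {v w : Fin (2 * n + 1) → ℝ} (hv : v ≠ 0) (hw : w ≠ 0) :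
    vecMulVec v w ≠ 0 := by
  obtain ⟨i, hi⟩ := Function.ne_iff.1 hv
  obtain ⟨k, hk⟩ := Function.ne_iff.1 hw
  intro h
  have := congrFun (congrFun h i) k
  rw [vecMulVec_apply] at this
  exact mul_ne_zero hi hk this

lemma vecMulVec_mem_isoProj {v w : Fin (2 * n + 1) → ℝ} (h1 : w ⬝ᵥ v = 1)
    (hv : v ⬝ᵥ rho n *ᵥ v = 0) (hw : w ⬝ᵥ rho n *ᵥ w = 0) : vecMulVec v w ∈ isoProj n := by
  have hv0 : v ≠ 0 := by
    rintro rfl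
    simp at h1
  refine ⟨?_, ?_, ?_, ?_⟩
  · rw [vecMulVec_mul_vecMulVec, h1, one_smul]
  · have h := rank_vecMulVec_le v w
    have h' : (vecMulVec v w).rank ≠ 0 := fun h0 => by
      have h2 := LinearMap.congr_fun (LinearMap.range_eq_bot.1 (Submodule.finrank_eq_zero.1 h0)) v
      rw [mulVecLin_apply, vecMulVec_mulVec, h1, LinearMap.zero_apply] at h2
      simp [hv0] at h2
    omega
  · rw [sharp_vecMulVec, vecMulVec_mul_vecMulVec, hw, zero_smul]
    simp
  · rw [sharp_vecMulVec, vecMulVec_mul_vecMulVec, dotProduct_comm, hv, zero_smul]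
    simp

lemma exists_vecMulVec_of_mem_isoProj {P : Mat n} (hP : P ∈ isoProj n) :
    ∃ v w : Fin (2 * n + 1) → ℝ, P = vecMulVec v w ∧ w ⬝ᵥ v = 1 ∧ v ⬝ᵥ rho n *ᵥ v = 0 ∧
      w ⬝ᵥ rho n *ᵥ w = 0 := by
  obtain ⟨v, w, rfl⟩ := exists_vecMulVec_of_rank_one hP.2.1
  have hne : vecMulVec v w ≠ 0 := fun h => by
    have := hP.2.1
    rw [h, rank_zero] at this
    omega
  have hv : v ≠ 0 := fun h => hne (by rw [h, zero_vecMulVec])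
  have hw : w ≠ 0 := fun h => hne (by rw [h, vecMulVec_zero])
  obtain ⟨h1, -, h2, h3⟩ := hP
  refine ⟨v, w, rfl, ?_, ?_, ?_⟩
  · have h := vecMulVec_mul_mul_vecMulVec v w v w 1
    rw [mul_one, h1, one_mulVec] at h
    have : (1 - w ⬝ᵥ v) • vecMulVec v w = 0 := by
      rw [sub_smul, one_smul, ← h, sub_self]
    linarith [(smul_eq_zero.1 this).resolve_right hne]
  · have h := vecMulVec_mul_mul_vecMulVec (rho n *ᵥ w) (rho n *ᵥ v) v w 1
    rw [mul_one, ← sharp_vecMulVec, h3, one_mulVec] at h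
    rw [dotProduct_comm]
    exact (smul_eq_zero.1 h.symm).resolve_right (vecMulVec_ne_zero (rho_mulVec_ne_zero hw) hw)
  · have h := vecMulVec_mul_mul_vecMulVec v w (rho n *ᵥ w) (rho n *ᵥ v) 1
    rw [mul_one, ← sharp_vecMulVec, h2, one_mulVec] at h
    exact (smul_eq_zero.1 h.symm).resolve_right (vecMulVec_ne_zero hv (rho_mulVec_ne_zero hv))

lemma dirDeriv_fun_smul {r : ℝ × ℝ → ℝ} {f : ℝ × ℝ → Mat n} {p : ℝ × ℝ}
    (hr : DifferentiableAt ℝ r p) (hf : SmoothOn V f) (hV : IsOpen V) (hp : p ∈ V) (h : ℝ × ℝ) :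
    dirDeriv h (fun p => r p • f p) p = fderiv ℝ r p h • f p + r p • dirDeriv h f p := by
  ext i k
  simp only [dirDeriv, Matrix.of_apply, Matrix.add_apply, Matrix.smul_apply, smul_eq_mul]
  rw [fderiv_fun_mul hr (hf.differentiableAt hV hp i k)]
  simp
  ring

lemma dirDeriv_neg_transpose (h : ℝ × ℝ) (f : ℝ × ℝ → Mat n) (p : ℝ × ℝ) :
    dirDeriv h (fun p => -(f p)ᵀ) p = -(dirDeriv h f p)ᵀ := by
  ext i k
  simp [dirDeriv, fderiv_fun_neg]

lemma sharp_transpose {C : Mat n} (hC : sharp C = -C) : sharp Cᵀ = -Cᵀ := by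
  have h := congrArg transpose hC
  rw [sharp, transpose_mul, transpose_mul, transpose_transpose, rho_transpose, transpose_neg,
    ← mul_assoc] at h
  rw [sharp, transpose_transpose, h]

/-- The normalized product of a solution `v` of the linear system for `α₁` and a solution `w` of the
dual system for `α₂` solves the Riccati system. -/
lemma dirDeriv_normalized {v w : ℝ × ℝ → Fin (2 * n + 1) → ℝ} (hV : IsOpen V)
    (hv : ContDiffOn ℝ ∞ v V) (hw : ContDiffOn ℝ ∞ w V) (hne : ∀ p ∈ V, w p ⬝ᵥ v p ≠ 0)
    {h p : ℝ × ℝ} (hp : p ∈ V) {C₁ C₂ : Mat n} (hdv : fderiv ℝ v p h = -(C₁ *ᵥ v p))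
    (hdw : fderiv ℝ w p h = C₂ᵀ *ᵥ w p) {P : ℝ × ℝ → Mat n}
    (hP : ∀ p ∈ V, P p = (w p ⬝ᵥ v p)⁻¹ • vecMulVec (v p) (w p)) (hPs : SmoothOn V P) :
    dirDeriv h P p = P p * C₂ - C₁ * P p + P p * (C₁ - C₂) * P p := by
  have hvp : DifferentiableAt ℝ v p := (hv.contDiffAt (hV.mem_nhds hp)).differentiableAt (by simp)
  have hwp : DifferentiableAt ℝ w p := (hw.contDiffAt (hV.mem_nhds hp)).differentiableAt (by simp)
  have hs := smoothOn_vecMulVec hv hw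
  have htr : ∀ p, w p ⬝ᵥ v p = traceLinearMap _ ℝ ℝ (vecMulVec (v p) (w p)) := fun p => by
    rw [traceLinearMap_apply, trace_vecMulVec, dotProduct_comm]
  have hM : dirDeriv h (fun p => vecMulVec (v p) (w p)) p
      = vecMulVec (v p) (w p) * C₂ - C₁ * vecMulVec (v p) (w p) := by
    rw [dirDeriv_vecMulVec hvp hwp, hdv, hdw, mulVec_transpose, ← vecMulVec_mul, neg_vecMulVec,
      ← mul_vecMulVec]
    abel
  have hr := hs.hasFDerivAt_map (traceLinearMap _ ℝ ℝ) hV hp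
  simp only [← htr] at hr
  have hM' : dirDeriv h (fun p => vecMulVec (v p) (w p)) p
      = dirDeriv h (fun p => (w p ⬝ᵥ v p) • P p) p := by
    refine dirDeriv_congr _ hV (fun p hp => ?_) hp
    rw [hP p hp, smul_smul, mul_inv_cancel₀ (hne p hp), one_smul]
  rw [dirDeriv_fun_smul hr.1 hPs hV hp, hr.2, hM] at hM'
  set r := w p ⬝ᵥ v p with hrdef
  have hr0 : r ≠ 0 := hne p hp
  have hMP : vecMulVec (v p) (w p) = r • P p := by
    rw [hP p hp, smul_smul, mul_inv_cancel₀ hr0, one_smul]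
  have hPvec : P p = vecMulVec (r⁻¹ • v p) (w p) := by rw [hP p hp, smul_vecMulVec]
  have hself : P p * (C₁ - C₂) * P p = trace (P p * (C₁ - C₂)) • P p := by
    rw [hPvec, vecMulVec_mul_mul_self]
  have htr' : trace (P p * C₂ - C₁ * P p) = -trace (P p * (C₁ - C₂)) := by
    rw [mul_sub, trace_sub, trace_sub, trace_mul_comm C₁]
    ring
  rw [hMP, Matrix.smul_mul, Matrix.mul_smul, ← smul_sub, traceLinearMap_apply, trace_smul, htr',
    smul_assoc, ← smul_add, neg_smul, ← hself] at hM'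
  have := smul_right_injective (Mat n) hr0 hM'
  rw [this]
  abel

/-- The system `(BT)` is locally solvable for every initial value, by linearization of the Riccati
system. -/
theorem exists_isBTSolutionOn (hn : 1 ≤ n) (hU : IsOpen U) (hq : IsFlowSolutionOn U j q)
    (hj : 1 ≤ j) (α₁ α₂ : ℝ) {p₀ : ℝ × ℝ} (hp₀ : p₀ ∈ U) {π₀ : Mat n} (hπ₀ : π₀ ∈ isoProj n) :
    ∃ (V : Set (ℝ × ℝ)) (π : ℝ × ℝ → Mat n), IsOpen V ∧ V ⊆ U ∧ p₀ ∈ V ∧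
      IsBTSolutionOn U V j q α₁ α₂ π ∧ π p₀ = π₀ := by
  obtain ⟨v₀, w₀, rfl, hwv, hv0, hw0⟩ := exists_vecMulVec_of_mem_isoProj hπ₀
  have hA := fun α => smoothOn_laxA hq.smooth α
  have hB := fun α => smoothOn_laxB (j := j) hn hU hq.smooth hq.mem_borel α
  have hflat := fun (p : ℝ × ℝ) (hp : p ∈ U) α => hq.zero_curvature hn hU hj α hp
  have hneg : ∀ {f : ℝ × ℝ → Mat n}, SmoothOn U f → SmoothOn U fun p => -(f p)ᵀ :=
    fun hf i k => (hf k i).neg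
  -- `v₀` is transported by the flat connection at `α₁`, and `w₀` by the dual of the one at `α₂`
  obtain ⟨ε₁, hε₁, hs₁, v, hvp, hv, hdv⟩ := exists_parallel_vector hU (hA α₁) (hB α₁)
    (fun p hp => hflat p hp α₁) hp₀ v₀
  obtain ⟨ε₂, hε₂, hs₂, w, hwp, hw, hdw⟩ := exists_parallel_vector hU (hneg (hA α₂)) (hneg (hB α₂))
    (fun p hp => by
      rw [dirDeriv_neg_transpose, dirDeriv_neg_transpose, hflat p hp α₂, transpose_add,
        transpose_sub, transpose_mul, transpose_mul]
      noncomm_ring) hp₀ w₀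
  set ε := min ε₁ ε₂ with hεdef
  have hε : 0 < ε := lt_min hε₁ hε₂
  have hb₁ : ball p₀ ε ⊆ ball p₀ ε₁ := ball_subset_ball (min_le_left _ _)
  have hb₂ : ball p₀ ε ⊆ ball p₀ ε₂ := ball_subset_ball (min_le_right _ _)
  have hskew : ∀ α, ∀ p ∈ ball p₀ ε, ∀ h : ℝ × ℝ,
      sharp (h.1 • laxA q α p + h.2 • laxB U j q α p)
        = -(h.1 • laxA q α p + h.2 • laxB U j q α p) := by
    intro α p hp h
    have hpU := hs₁ (hb₁ hp)
    rw [sharp_add, sharp_smul, sharp_smul, sharp_laxA (hq.mem_borel p hpU),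
      sharp_laxB hn hU hq hj hpU]
    module
  have hdv' : ∀ p ∈ ball p₀ ε, ∀ h, fderiv ℝ v p h
      = -((h.1 • laxA q α₁ p + h.2 • laxB U j q α₁ p) *ᵥ v p) := fun p hp h => hdv p (hb₁ hp) h
  have hdw' : ∀ p ∈ ball p₀ ε, ∀ h, fderiv ℝ w p h
      = (h.1 • laxA q α₂ p + h.2 • laxB U j q α₂ p)ᵀ *ᵥ w p := fun p hp h => by
    rw [hdw p (hb₂ hp) h, ← neg_mulVec, transpose_add, transpose_smul, transpose_smul]
    congr 1
    module
  have hv' := hv.mono hb₁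
  have hw' := hw.mono hb₂
  have hvnull := dotProduct_rho_mulVec_eq_zero hε hv' (fun p hp h =>
    ⟨-(h.1 • laxA q α₁ p + h.2 • laxB U j q α₁ p), by rw [sharp_neg, hskew _ p hp],
      by rw [hdv' p hp, neg_mulVec]⟩) (by rw [hvp]; exact hv0)
  have hwnull := dotProduct_rho_mulVec_eq_zero hε hw' (fun p hp h =>
    ⟨_, sharp_transpose (hskew α₂ p hp h), hdw' p hp h⟩) (by rw [hwp]; exact hw0)
  have hdot : ContDiffOn ℝ ∞ (fun p => w p ⬝ᵥ v p) (ball p₀ ε) :=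
    ContDiffOn.sum fun i _ => (contDiffOn_pi.1 hw' i).mul (contDiffOn_pi.1 hv' i)
  -- the projection is `v wᵗ / (w ⬝ v)`, where the denominator does not vanish
  set V := ball p₀ ε ∩ (fun p => w p ⬝ᵥ v p) ⁻¹' {0}ᶜ with hVdef
  have hV : IsOpen V := hdot.continuousOn.isOpen_inter_preimage isOpen_ball isOpen_compl_singleton
  have hVb : V ⊆ ball p₀ ε := Set.inter_subset_left
  have hVU : V ⊆ U := fun p hp => hs₁ (hb₁ (hVb hp))
  have hne : ∀ p ∈ V, w p ⬝ᵥ v p ≠ 0 := fun p hp => hp.2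
  set P : ℝ × ℝ → Mat n := fun p => (w p ⬝ᵥ v p)⁻¹ • vecMulVec (v p) (w p) with hP
  have hPs : SmoothOn V P := fun i k => ((hdot.mono hVb).inv hne).mul
    (smoothOn_vecMulVec (hv'.mono hVb) (hw'.mono hVb) i k)
  have hPmem : ∀ p ∈ V, P p ∈ isoProj n := by
    intro p hp
    have e : P p = vecMulVec ((w p ⬝ᵥ v p)⁻¹ • v p) (w p) := by rw [smul_vecMulVec]
    rw [e]
    refine vecMulVec_mem_isoProj ?_ ?_ (hwnull p (hVb hp))
    · rw [dotProduct_smul, smul_eq_mul, inv_mul_cancel₀ (hne p hp)]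
    · rw [mulVec_smul, dotProduct_smul, smul_dotProduct, hvnull p (hVb hp), smul_zero, smul_zero]
  have hric : ∀ p ∈ V, ∀ h : ℝ × ℝ, dirDeriv h P p
      = P p * (h.1 • laxA q α₂ p + h.2 • laxB U j q α₂ p)
        - (h.1 • laxA q α₁ p + h.2 • laxB U j q α₁ p) * P p
        + P p * ((h.1 • laxA q α₁ p + h.2 • laxB U j q α₁ p)
          - (h.1 • laxA q α₂ p + h.2 • laxB U j q α₂ p)) * P p := fun p hp h =>
    dirDeriv_normalized hV (hv'.mono hVb) (hw'.mono hVb) hne hp (hdv' p (hVb hp) h)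
      (hdw' p (hVb hp) h) (fun _ _ => rfl) hPs
  have hx : IsBTxSolutionOn V q α₁ α₂ P := ⟨hPs, hPmem, fun p hp => by
    rw [mul_laxA_sub (hPmem p hp) (hq.mem_borel p (hVU hp)), dx_eq_dirDeriv hPs hV hp, hric p hp]
    simp only [one_smul, zero_smul, add_zero]⟩
  refine ⟨V, P, hV, hVU, ⟨mem_ball_self hε, ?_⟩, ⟨hx, fun p hp => ?_⟩, ?_⟩
  · change w p₀ ⬝ᵥ v p₀ ≠ 0
    rw [hvp, hwp, hwv]
    exact one_ne_zero
  · rw [mul_laxB_sub hn hU hq hj hV hVU hx hp, dt_eq_dirDeriv hPs hV hp, hric p hp]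
    simp only [one_smul, zero_smul, zero_add]
  · simp only [hP]
    rw [hvp, hwp, hwv, inv_one, one_smul]

end Existence

end

end BHierarchy

theorem mainTheorem3 (n : ℕ) (hn : 1 ≤ n) (j : ℕ) (hj : 1 ≤ j) (α₁ α₂ : ℝ) (hα : α₁ ≠ α₂) :
    -- polynomials in the entries of `π̃` and of `T_{2j-1,i}(q)`, `0 ≤ i ≤ 2j-1`
    ∃ P : Fin (2 * n + 1) → Fin (2 * n + 1) →
        MvPolynomial ((Fin (2 * n + 1) × Fin (2 * n + 1)) ⊕
          (Fin (2 * j) × Fin (2 * n + 1) × Fin (2 * n + 1))) ℝ,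
      ∀ (U : Set (ℝ × ℝ)) (q : ℝ × ℝ → Mat n), IsOpen U → IsFlowSolutionOn U j q →
        -- (1) the system is of first order: no derivative of `π̃` enters its right hand side
        (∀ (V : Set (ℝ × ℝ)) (π : ℝ × ℝ → Mat n), IsOpen V → V ⊆ U →
          IsBTxSolutionOn V q α₁ α₂ π →
          ∀ p ∈ V, ∀ a c, laxB V j (newSol q α₁ α₂ π) α₂ p a c =
            MvPolynomial.eval
              (Sum.elim (fun e => π p e.1 e.2)
                (fun e => resCoeff U j q ((e.1 : ℕ) : ℤ) p e.2.1 e.2.2)) (P a c)) ∧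
        -- (1) the system is solvable for any initial value in `Π`
        (∀ p₀ ∈ U, ∀ π₀ ∈ isoProj n, ∃ (V : Set (ℝ × ℝ)) (π : ℝ × ℝ → Mat n),
          IsOpen V ∧ V ⊆ U ∧ p₀ ∈ V ∧ IsBTSolutionOn U V j q α₁ α₂ π ∧ π p₀ = π₀) ∧
        -- (2) every solution of the system gives a new solution of the flow
        (∀ (V : Set (ℝ × ℝ)) (π : ℝ × ℝ → Mat n), IsOpen V → V ⊆ U →
          IsBTSolutionOn U V j q α₁ α₂ π → IsFlowSolutionOn V j (newSol q α₁ α₂ π)) := by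
  obtain ⟨P, hP⟩ := exists_polynomial hn hj α₁ α₂
  exact ⟨P, fun U q hU hq => ⟨hP U q hU hq,
    fun p₀ hp₀ π₀ hπ₀ => exists_isBTSolutionOn hn hU hq hj α₁ α₂ hp₀ hπ₀,
    fun V π hV hVU hπ => isFlowSolutionOn_newSol hn hU hq hj hV hVU hπ⟩⟩
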